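/- Let $0<m<1$, $\nu>0$, and let $h$ be a probability density supported on $(0,\infty)$. Let $N=\sum_j\vartheta_{U_j}C_j$ be the stationary Poisson branching-cluster process (the cluster representation of the stationary linear Hawkes process) with immigrant rate $\nu$ and offspring density $mh$: the immigrants $\{U_j\}$ form a homogeneous Poisson process on $\mathbb R$ of rate $\nu$; the clusters $C_j$ are i.i.d. and independent of the immigrants; each cluster is rooted at $0$, and, independently, every point $x$ of a cluster has offspring forming a Poisson process of intensity $m\,h(y-x)\,dy$; $\vartheta_u$ denotes translation by $u$. For a point process $N$ on $\mathbb R$ whose counts on compact sets have finite third moments, let $\alpha_n$ ($n\le 3$) be the factorial moment measures, $\int f_0\otimes\cdots\otimes f_{n-1}\,d\alpha_n=\mathbb E\sum^{\ne}_{x_0,\dots,x_{n-1}\in N}\prod_j f_j(x_j)$, the sum being over ordered tuples of pairwise distinct points, and let the factorial cumulant measures be given by $\kappa_1=\alpha_1$, $\kappa_2=\alpha_2-\kappa_1\otimes\kappa_1$ and $\kappa_3=\alpha_3-\kappa_1^{\otimes3}-\kappa_2^{01}\otimes\kappa_1^{2}-\kappa_2^{02}\otimes\kappa_1^{1}-\kappa_2^{12}\otimes\kappa_1^{0}$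 (superscripts indicate the coordinates acted on). The reduced third factorial cumulant of $N$ has the $L^1$ density $c_3$ if $c_3\in L^1(\mathbb R^2)$ and, for all bounded compactly supported Borel functions $f_0,f_1,f_2$, $$\int f_0\otimes f_1\otimes f_2\,d\kappa_3=\int_{\mathbb R}\int_{\mathbb R^2}f_0(t)f_1(t+\tau_1)f_2(t+\tau_2)\,c_3(\tau_1,\tau_2)\,d\tau_1d\tau_2\,dt .$$ The bispectrum is then $B(\omega_1,\omega_2)=\int_{\mathbb R^2}e^{-i(\omega_1\tau_1+\omega_2\tau_2)}c_3(\tau_1,\tau_2)\,d\tau_1d\tau_2$. Suppose that either (i) $\int_x^\infty h(u)\,du\sim x^{-\alpha}L(x)$ as $x\to\infty$ for some $0<\alpha\le2$ and some slowly varying $L$; or (ii) $h$ is nonincreasing on $(0,\infty)$, $\int_0^\infty u^2h(u)\,du<\infty$, and $h$ is not almost everywhere equal to $a^{-1}\mathbf 1_{(0,a)}$ for any $a>0$. Then the reduced third factorial cumulant of the branching-cluster process $N$ has an $L^1$ density $c_3$, and its bispectrum $B$ satisfies $\operatorname{Im}B(t_0,t_0)\ne0$ for some $t_0>0$. Consequently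 $N$ is separated at third order from every reversible process with an $L^1$ third factorial cumulant density: if $N'$ is a stationary point process on $\mathbb R$ which has the same law as its reflection $A\mapsto N'(-A)$ and whose reduced third factorial cumulant has an $L^1$ density $c_3'$, with bispectrum $B'$, then $B'$ is real-valued, $B'(t_0,t_0)\ne B(t_0,t_0)$, and $c_3'$ and $c_3$ are not almost everywhere equal. -/

import Mathlib

open MeasureTheory ProbabilityTheory Filter Set Topology
open scoped NNReal ENNReal

noncomputable section

namespace HawkesBispectrum

/-! ### Point processes on the line -/

/-- A counting measure: it takes a finite integer value on every bounded Borel set. Atoms may have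
multiplicity larger than one. -/
def IsCountingMeasure (μ : Measure ℝ) : Prop :=
  ∀ A : Set ℝ, MeasurableSet A → Bornology.IsBounded A → ∃ n : ℕ, μ A = n

/-- A point process: a random measure which is almost surely a counting measure. -/
structure IsPointProcess {Ω : Type*} [MeasurableSpace Ω] (P : Measure Ω) (N : Ω → Measure ℝ) :
    Prop where
  measurable : Measurable N
  counting : ∀ᵐ ω ∂P, IsCountingMeasure (N ω)

/-- Stationarity: the law is invariant under the translations `μ ↦ μ(· - u)`. -/
def IsStationaryProcess {Ω : Type*} [MeasurableSpace Ω] (P : Measure Ω) (N : Ω → Measure ℝ) : Prop :=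
  ∀ u : ℝ, P.map (fun ω => (N ω).map (fun x => x + u)) = P.map N

/-- Reversibility: `N` and the reflected process `A ↦ N(-A)` have the same law. -/
def IsReversible {Ω : Type*} [MeasurableSpace Ω] (P : Measure Ω) (N : Ω → Measure ℝ) : Prop :=
  P.map (fun ω => (N ω).map (fun x => -x)) = P.map N

/-- A homogeneous Poisson process of rate `ν` on the line: Poisson counts on Borel sets of finite
length, and independent counts on disjoint Borel sets. -/
structure IsPoissonProcess {Ω : Type*} [MeasurableSpace Ω] (P : Measure Ω) (ν : ℝ≥0)
    (N : Ω → Measure ℝ) : Prop where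
  count_law : ∀ A : Set ℝ, MeasurableSet A → volume A ≠ ∞ →
    HasLaw (fun ω => N ω A)
      ((poissonMeasure (ν * (volume A).toNNReal)).map (fun k : ℕ => (k : ℝ≥0∞))) P
  indep : ∀ (n : ℕ) (A : Fin n → Set ℝ), (∀ i, MeasurableSet (A i)) →
    Pairwise (fun i j => Disjoint (A i) (A j)) → iIndepFun (fun i ω => N ω (A i)) P

/-! ### Poisson branching clusters

Potential individuals are labelled by finite words: `[]` is the root, `[j]` is the `j`-th child of
the root, and `v ++ [j]` is the `j`-th child of `v`. A word `v` carries a number of children and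
the displacement of `v` from its parent (the displacement of the root is not used). -/

/-- The word belongs to the family tree in which `v` has the children `v ++ [j]`, `j < K v`. -/
def InTree : (List ℕ → ℕ) → List ℕ → Prop
  | _, [] => True
  | K, j :: w => j < K [] ∧ InTree (fun u => K (j :: u)) w

/-- Position relative to the root: the sum of the displacements along the ancestral line. -/
def position : (List ℕ → ℝ) → List ℕ → ℝ
  | _, [] => 0
  | D, j :: w => D [j] + position (fun u => D (j :: u)) w

open Classical in
/-- The rooted cluster: one unit atom at the position of each individual of the family tree. -/
def cluster (ξ : List ℕ → ℕ × ℝ) : Measure ℝ :=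
  Measure.sum fun v : List ℕ =>
    if InTree (fun u => (ξ u).1) v then Measure.dirac (position (fun u => (ξ u).2) v) else 0

/-- The superposition `∑ⱼ ϑ_{Uⱼ} Cⱼ` of the clusters `Cⱼ` translated to the immigrants `Uⱼ`. -/
def clusterProcess {Ω : Type*} (U : ℕ → Ω → ℝ) (ξ : ℕ × List ℕ → Ω → ℕ × ℝ) (ω : Ω) :
    Measure ℝ :=
  Measure.sum fun j : ℕ => (cluster fun v => ξ (j, v) ω).map (fun x => x + U j ω)

/-- The function `h` is a probability density supported on `(0, ∞)`. -/
structure IsDelayDensity (h : ℝ → ℝ) : Prop where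
  measurable : Measurable h
  nonneg : ∀ x, 0 ≤ h x
  eq_zero : ∀ x, x ≤ 0 → h x = 0
  lintegral_eq_one : ∫⁻ x, ENNReal.ofReal (h x) = 1

/-- The randomness driving the Poisson branching-cluster process with immigrant rate `ν` and
offspring density `m • h`: the immigrants `U 0, U 1, …` are the points of a Poisson process of rate
`ν`; independently of them, every label of every cluster carries, independently, a Poisson(`m`)
number of children and a displacement with density `h`. (A Poisson(`m`) number of independent
displacements with density `h` is the Poisson process with intensity `m * h x dx`.) -/
structure IsBranchingModel {Ω : Type*} [MeasurableSpace Ω] (P : Measure Ω) (ν m : ℝ≥0) (h : ℝ → ℝ)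
    (U : ℕ → Ω → ℝ) (ξ : ℕ × List ℕ → Ω → ℕ × ℝ) : Prop where
  measurable_immigrants : ∀ j, Measurable (U j)
  measurable_marks : ∀ p, Measurable (ξ p)
  immigrants : IsPoissonProcess P ν (fun ω => Measure.sum fun j : ℕ => Measure.dirac (U j ω))
  marks_law : ∀ p, HasLaw (ξ p)
    ((poissonMeasure m).prod (volume.withDensity fun x => ENNReal.ofReal (h x))) P
  marks_indep : iIndepFun ξ P
  indep : IndepFun (fun ω j => U j ω) (fun ω p => ξ p ω) P

/-! ### Factorial moments, the third factorial cumulant, and the bispectrum -/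

/-- The linear statistic `N(f)`, the sum of `f` over the points. -/
def linStat (μ : Measure ℝ) (f : ℝ → ℝ) : ℝ := ∫ x, f x ∂μ

/-- The sum of `f x * g y` over ordered pairs of distinct points of a counting measure. -/
def pairSum (μ : Measure ℝ) (f g : ℝ → ℝ) : ℝ :=
  linStat μ f * linStat μ g - linStat μ (fun x => f x * g x)

/-- The sum of `f x * g y * k z` over ordered triples of pairwise distinct points of a counting
measure (atoms being counted with multiplicity, see `tripleSum_sum_dirac`). -/
def tripleSum (μ : Measure ℝ) (f g k : ℝ → ℝ) : ℝ :=
  linStat μ f * linStat μ g * linStat μ k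
    - linStat μ (fun x => f x * g x) * linStat μ k
    - linStat μ (fun x => f x * k x) * linStat μ g
    - linStat μ (fun x => g x * k x) * linStat μ f
    + 2 * linStat μ (fun x => f x * g x * k x)

theorem linStat_sum_dirac {n : ℕ} (x : Fin n → ℝ) (f : ℝ → ℝ) :
    linStat (∑ i, Measure.dirac (x i)) f = ∑ i, f (x i) := by
  unfold linStat
  rw [integral_finsetSum_measure (fun i _ => integrable_dirac (by simp))]
  simp

theorem pairSum_sum_dirac {n : ℕ} (x : Fin n → ℝ) (f g : ℝ → ℝ) :
    pairSum (∑ i, Measure.dirac (x i)) f g =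
      ∑ i, ∑ j, if i ≠ j then f (x i) * g (x j) else 0 := by
  have key : ∀ i j : Fin n, (if i ≠ j then f (x i) * g (x j) else 0) =
      f (x i) * g (x j) - (if i = j then f (x i) * g (x j) else 0) := by
    intro i j
    by_cases h : i = j <;> simp [h]
  simp only [pairSum, linStat_sum_dirac, key, Finset.sum_sub_distrib, Finset.sum_ite_eq,
    Finset.mem_univ, if_true, Finset.sum_mul_sum]

theorem tripleSum_sum_dirac {n : ℕ} (x : Fin n → ℝ) (f g k : ℝ → ℝ) :
    tripleSum (∑ i, Measure.dirac (x i)) f g k =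
      ∑ i, ∑ j, ∑ l, if i ≠ j ∧ i ≠ l ∧ j ≠ l then f (x i) * g (x j) * k (x l) else 0 := by
  have key : ∀ i j l : Fin n,
      (if i ≠ j ∧ i ≠ l ∧ j ≠ l then f (x i) * g (x j) * k (x l) else 0) =
      f (x i) * g (x j) * k (x l) - (if i = j then f (x i) * g (x j) * k (x l) else 0)
        - (if i = l then f (x i) * g (x j) * k (x l) else 0)
        - (if j = l then f (x i) * g (x j) * k (x l) else 0)
        + 2 * (if i = l then (if i = j then f (x i) * g (x j) * k (x l) else 0) else 0) := by
    intro i j l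
    by_cases h1 : i = j
    · by_cases h2 : i = l
      · subst h1 h2; simp; ring
      · subst h1; simp [h2]
    · by_cases h2 : i = l
      · subst h2; simp [h1, Ne.symm h1]
      · by_cases h3 : j = l
        · subst h3; simp [h1]
        · simp [h1, h2, h3]
  have e1 : ∀ i : Fin n, ∑ j, ∑ l, (if i = j then f (x i) * g (x j) * k (x l) else 0) =
      ∑ l, f (x i) * g (x i) * k (x l) := by
    intro i
    rw [Finset.sum_comm]
    simp
  simp only [tripleSum, linStat_sum_dirac, key, Finset.sum_sub_distrib, Finset.sum_add_distrib, e1,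
    ← Finset.mul_sum, ← Finset.sum_mul, Finset.sum_ite_eq, Finset.mem_univ, if_true]
  have e2 : ∑ i, f (x i) * (∑ j, g (x j)) * k (x i) =
      (∑ i, f (x i) * k (x i)) * ∑ j, g (x j) := by
    rw [Finset.sum_mul]
    exact Finset.sum_congr rfl fun i _ => by ring
  have e3 : ∑ i, ∑ j, f (x i) * g (x j) * k (x j) =
      (∑ i, g (x i) * k (x i)) * ∑ j, f (x j) := by
    rw [Finset.sum_mul_sum, Finset.sum_comm]
    exact Finset.sum_congr rfl fun i _ => Finset.sum_congr rfl fun j _ => by ring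
  rw [e2, e3]

section Cumulants

variable {Ω : Type*} [MeasurableSpace Ω] (P : Measure Ω) (N : Ω → Measure ℝ)

/-- The first factorial moment measure, integrated against `f`. -/
def factorialMoment₁ (f : ℝ → ℝ) : ℝ := ∫ ω, linStat (N ω) f ∂P

/-- The second factorial moment measure, integrated against `f ⊗ g`. -/
def factorialMoment₂ (f g : ℝ → ℝ) : ℝ := ∫ ω, pairSum (N ω) f g ∂P

/-- The third factorial moment measure, integrated against `f ⊗ g ⊗ k`. -/
def factorialMoment₃ (f g k : ℝ → ℝ) : ℝ := ∫ ω, tripleSum (N ω) f g k ∂P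

/-- The second factorial cumulant measure, integrated against `f ⊗ g`. -/
def factorialCumulant₂ (f g : ℝ → ℝ) : ℝ :=
  factorialMoment₂ P N f g - factorialMoment₁ P N f * factorialMoment₁ P N g

/-- The third factorial cumulant measure, integrated against `f ⊗ g ⊗ k`, from the
moment-cumulant partition identity. -/
def factorialCumulant₃ (f g k : ℝ → ℝ) : ℝ :=
  factorialMoment₃ P N f g k
    - factorialMoment₁ P N f * factorialMoment₁ P N g * factorialMoment₁ P N k
    - factorialCumulant₂ P N f g * factorialMoment₁ P N k
    - factorialCumulant₂ P N f k * factorialMoment₁ P N g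
    - factorialCumulant₂ P N g k * factorialMoment₁ P N f

/-- Bounded compactly supported Borel functions. -/
structure IsTestFunction (f : ℝ → ℝ) : Prop where
  measurable : Measurable f
  bounded : ∃ C : ℝ, ∀ x, |f x| ≤ C
  compactSupport : HasCompactSupport f

/-- The third moments are locally finite, and the reduced third factorial cumulant measure has the
`L¹` density `c` with respect to Lebesgue measure on the plane of lags `(τ₁, τ₂)`. -/
structure HasThirdCumulantDensity (c : ℝ × ℝ → ℝ) : Prop where
  moment_lt_top : ∀ K : Set ℝ, IsCompact K → ∫⁻ ω, (N ω K) ^ 3 ∂P < ∞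
  integrable : Integrable c
  cumulant_eq : ∀ f g k : ℝ → ℝ, IsTestFunction f → IsTestFunction g → IsTestFunction k →
    factorialCumulant₃ P N f g k =
      ∫ t : ℝ, ∫ τ : ℝ × ℝ, f t * g (t + τ.1) * k (t + τ.2) * c τ

end Cumulants

/-- The Fourier transform of the third cumulant density `c`. -/
def bispectrum (c : ℝ × ℝ → ℝ) (ω₁ ω₂ : ℝ) : ℂ :=
  ∫ τ : ℝ × ℝ, Complex.exp (-(Complex.I * ((ω₁ * τ.1 + ω₂ * τ.2 : ℝ) : ℂ))) * (c τ : ℂ)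

/-! ### Conditions on the kernel -/

/-- Slow variation at infinity. -/
structure IsSlowlyVarying (L : ℝ → ℝ) : Prop where
  measurable : Measurable L
  eventually_pos : ∀ᶠ x in atTop, 0 < L x
  tendsto_ratio : ∀ c : ℝ, 0 < c → Tendsto (fun x => L (c * x) / L x) atTop (𝓝 1)

/-- The tail of `h` is regularly varying with index `-α` for some `0 < α ≤ 2`. -/
def HasRegularlyVaryingTail (h : ℝ → ℝ) : Prop :=
  ∃ (α : ℝ) (L : ℝ → ℝ), 0 < α ∧ α ≤ 2 ∧ IsSlowlyVarying L ∧
    Asymptotics.IsEquivalent atTop (fun x : ℝ => ∫ u in Ioi x, h u) (fun x : ℝ => x ^ (-α) * L x)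

/-- The density `h` is nonincreasing on `(0, ∞)`, has a finite second moment, and is not (almost
everywhere) a uniform density on an interval `(0, a)`. -/
def IsNonuniformMonotone (h : ℝ → ℝ) : Prop :=
  AntitoneOn h (Ioi 0) ∧ IntegrableOn (fun u => u ^ 2 * h u) (Ioi 0) ∧
    ¬ ∃ a : ℝ, 0 < a ∧ h =ᵐ[volume] (Ioo 0 a).indicator (fun _ => a⁻¹)

end HawkesBispectrum

end

open HawkesBispectrum

namespace HawkesBispectrum

/-! ### Moments of the Poisson distribution -/

/-! The process is a Poisson superposition of independent clusters, so its factorial cumulants are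
`ν` times the factorial moment measures of one cluster, integrated over the position of the root
(`factorialCumulant₃_clusterProcess_eq_toReal`). At third order, translation invariance splits off
one coordinate and leaves `ν` times the measure of the lags between three distinct individuals of a
cluster (`intensity₃_eq_lintegral_lagMeasure`). This measure is finite because the size of a
subcritical cluster has a third moment (`lintegral_size_cube_ne_top`). It has a density because,
once all other displacements are frozen, the displacement of a longest word among the three still
has one (`map_lag_absolutelyContinuous`).

On the diagonal the imaginary part of the bispectrum is a sum of sines over distinct triples.
Triples with coincidences contribute zero by antisymmetry, hence `Im B(t, t) = ν Im E[Z(t)²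
Z(-2t)]`, where `Z` is the Fourier transform of a cluster (`bispectrum_clusterDensity_im`). The
branching recursion, in which `Z - 1` is a Poisson sum of independent shifted copies of `Z`, gives
this moment in closed form (`third_moment_identity`). Up to a positive factor its imaginary part is
`-m²` times that of `G = φ(t)² + 2 φ(t) φ(-2t) - 2m φ(t)² φ(-2t)`, where `φ(t) = E exp(itX)` is the
characteristic function of a delay `X`; this is `diagonalForm`.

Suppose that `Im G` vanishes at every `t > 0`. For independent delays `X`, `Y`, `V` the three terms
of `G` are the characteristic functions of `X + Y`, `X - 2Y` and `X + Y - 2V`. Therefore `E F(X + Y)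
+ 2 E F(X - 2Y) - 2m E F(X + Y - 2V) = 0` for every odd `F` with the required integrability
(`integral_three_odd_eq_zero`). Two choices of `F` finish the proof.

With `F` the truncation of `x / r` to `[-1, 1]`, the terms with a single large delay produce at
least a multiple of `(1 - m) P(X ≥ r)`. The error needs a large delay together with a second,
independent factor, and is of order `P(X ≥ r/4) E min(X/r, 1)` (`tail_le`). Hence `P(X ≥ r) = o(P(X
≥ r/4))`, which is impossible for a regularly varying tail and forces a finite third moment in
general.

With `F(x) = x³` one gets `(1 - m)(2μ₃ - 3μ₁μ₂) + m μ₁ (3μ₂ - 4μ₁²) = 0` (`third_moment_relation`).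
Comparing a nonincreasing density with the uniform density of the same mean shows that the first
bracket is nonnegative (`third_moment_ge`) and that the second is positive unless the density is
uniform (`second_moment_gt`), a contradiction.

For the separation, the bispectrum depends only on the cumulant functional
(`bispectrum_eq_of_kernel_eq`), and reversing time conjugates it
(`IsReversible.bispectrum_im_eq_zero`). -/

theorem tsum_poisson_succ (r : ℝ≥0) (f : ℕ → ℝ≥0∞) :
    ∫⁻ n, (n : ℝ≥0∞) * f n ∂(poissonMeasure r) = r * ∫⁻ n, f (n + 1) ∂(poissonMeasure r) := by
  -- The term at `0` carries the factor `0`. In the others, `(n+1) r^(n+1)/(n+1)! = r · r^n/n!`.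
  rw [lintegral_countable', lintegral_countable', tsum_eq_zero_add' ENNReal.summable,
    ← ENNReal.tsum_mul_left]
  simp only [Nat.cast_zero, zero_mul, zero_add]
  refine tsum_congr fun n => ?_
  simp only [poissonMeasure_singleton]
  have e : ((n + 1 : ℕ) : ℝ≥0∞) = ENNReal.ofReal (n + 1 : ℕ) := by
    rw [ENNReal.ofReal_natCast]
  have e2 : (r : ℝ≥0∞) = ENNReal.ofReal r := by simp
  rw [mul_assoc, mul_left_comm, mul_left_comm (r : ℝ≥0∞), e, e2,
    ← ENNReal.ofReal_mul (by positivity), ← ENNReal.ofReal_mul (by positivity)]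
  congr 2
  push_cast [Nat.factorial_succ]
  field_simp
  ring

theorem lintegral_poisson_one (r : ℝ≥0) : ∫⁻ n, (n : ℝ≥0∞) ∂(poissonMeasure r) = r := by
  simpa using tsum_poisson_succ r (fun _ => 1)

theorem lintegral_poisson_sq (r : ℝ≥0) :
    ∫⁻ n, (n : ℝ≥0∞) * n ∂(poissonMeasure r) = r * r + r := by
  rw [tsum_poisson_succ]
  push_cast
  rw [lintegral_add_left (by fun_prop), lintegral_poisson_one]
  simp [mul_add]

theorem lintegral_poisson_cube (r : ℝ≥0) :
    ∫⁻ n, (n : ℝ≥0∞) * (n * n) ∂(poissonMeasure r) = r * r * r + 3 * (r * r) + r := by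
  rw [tsum_poisson_succ]
  push_cast
  have : ∀ n : ℕ, ((n : ℝ≥0∞) + 1) * (n + 1) = n * n + 2 * n + 1 := fun n => by ring
  simp only [this]
  rw [lintegral_add_left (by fun_prop), lintegral_add_left (by fun_prop),
    lintegral_const_mul _ (by fun_prop), lintegral_poisson_one, lintegral_poisson_sq]
  simp
  ring

/-! ### Products of sums of independent terms -/

section MarkedSums

variable {T : Type*} [MeasurableSpace T] (Q : Measure T) [IsProbabilityMeasure Q]

theorem lintegral_infinitePi_eval (i : ℕ) {f : T → ℝ≥0∞} (hf : Measurable f) :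
    ∫⁻ x, f (x i) ∂(Measure.infinitePi fun _ : ℕ => Q) = ∫⁻ x, f x ∂Q :=
  (measurePreserving_eval_infinitePi (fun _ : ℕ => Q) i).lintegral_comp hf

theorem lintegral_infinitePi_pair {i j : ℕ} (hij : i ≠ j) {f g : T → ℝ≥0∞} (hf : Measurable f)
    (hg : Measurable g) :
    ∫⁻ x, f (x i) * g (x j) ∂(Measure.infinitePi fun _ : ℕ => Q) =
      (∫⁻ x, f x ∂Q) * ∫⁻ x, g x ∂Q := by
  rw [lintegral_mul_eq_lintegral_mul_lintegral_of_indepFun'' (f := fun x : ℕ → T => f (x i))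
    (g := fun x : ℕ → T => g (x j)) (Measurable.aemeasurable (by fun_prop))
    (Measurable.aemeasurable (by fun_prop)), lintegral_infinitePi_eval Q i hf,
    lintegral_infinitePi_eval Q j hg]
  have := (iIndepFun_infinitePi (P := fun _ : ℕ => Q) (X := fun _ ω => ω)
    (by fun_prop)).indepFun hij
  exact this.comp hf hg

theorem lintegral_infinitePi_triple {i j k : ℕ} (hij : i ≠ j) (hik : i ≠ k) (hjk : j ≠ k)
    {f g l : T → ℝ≥0∞} (hf : Measurable f) (hg : Measurable g) (hl : Measurable l) :
    ∫⁻ x, f (x i) * g (x j) * l (x k) ∂(Measure.infinitePi fun _ : ℕ => Q) =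
      (∫⁻ x, f x ∂Q) * (∫⁻ x, g x ∂Q) * ∫⁻ x, l x ∂Q := by
  rw [lintegral_mul_eq_lintegral_mul_lintegral_of_indepFun'' (f := fun x : ℕ → T => f (x i) * g (x j))
    (g := fun x : ℕ → T => l (x k)) (Measurable.aemeasurable (by fun_prop))
    (Measurable.aemeasurable (by fun_prop)), lintegral_infinitePi_pair Q hij hf hg,
    lintegral_infinitePi_eval Q k hl]
  have := (iIndepFun_infinitePi (P := fun _ : ℕ => Q) (X := fun _ ω => ω)
    (by fun_prop)).indepFun_prodMk (by fun_prop) i j k hik hjk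
  exact this.comp (φ := fun p : T × T => f p.1 * g p.2) (by fun_prop) hl

variable {A B C : ℕ → T → ℝ≥0∞}

theorem lintegral_tsum_eval (hA : ∀ i, Measurable (A i)) :
    ∫⁻ x, ∑' i, A i (x i) ∂(Measure.infinitePi fun _ : ℕ => Q) = ∑' i, ∫⁻ x, A i x ∂Q := by
  have hA' : ∀ i, Measurable fun x : ℕ → T => A i (x i) := fun i =>
    (hA i).comp (measurable_pi_apply i)
  rw [lintegral_tsum fun i => (hA' i).aemeasurable]
  exact tsum_congr fun i => lintegral_infinitePi_eval Q i (hA i)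

theorem tsum_mul_tsum (a b : ℕ → ℝ≥0∞) : (∑' i, a i) * ∑' j, b j = ∑' i, ∑' j, a i * b j := by
  simp_rw [ENNReal.tsum_mul_left, ENNReal.tsum_mul_right]

theorem tsum_mul_tsum_mul_tsum (a b c : ℕ → ℝ≥0∞) :
    (∑' i, a i) * (∑' j, b j) * ∑' k, c k = ∑' i, ∑' j, ∑' k, a i * b j * c k := by
  simp only [ENNReal.tsum_mul_left, ENNReal.tsum_mul_right]

/-- Off the diagonal, independence factors the integral; on the diagonal, the mean of the product
replaces the product of the means. The term to be subtracted is added on the left, so that the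
identity also holds with infinite values. -/
theorem lintegral_tsum_mul_tsum (hA : ∀ i, Measurable (A i)) (hB : ∀ i, Measurable (B i)) :
    ∫⁻ x, (∑' i, A i (x i)) * (∑' j, B j (x j)) ∂(Measure.infinitePi fun _ : ℕ => Q) +
        ∑' i, (∫⁻ x, A i x ∂Q) * ∫⁻ x, B i x ∂Q =
      (∑' i, ∫⁻ x, A i x ∂Q) * (∑' j, ∫⁻ x, B j x ∂Q) + ∑' i, ∫⁻ x, A i x * B i x ∂Q := by
  have hA' : ∀ i, Measurable fun x : ℕ → T => A i (x i) := fun i =>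
    (hA i).comp (measurable_pi_apply i)
  have hB' : ∀ i, Measurable fun x : ℕ → T => B i (x i) := fun i =>
    (hB i).comp (measurable_pi_apply i)
  have hm : ∀ i j, Measurable fun x : ℕ → T => A i (x i) * B j (x j) := fun i j => (hA' i).mul (hB' j)
  have e1 : ∀ d : ℕ → ℝ≥0∞, ∑' i, d i = ∑' i, ∑' j, if j = i then d i else 0 := fun d =>
    tsum_congr fun i => by rw [tsum_ite_eq]
  simp_rw [tsum_mul_tsum]
  rw [lintegral_tsum fun i => (Measurable.tsum fun j => hm i j).aemeasurable,
    e1 fun i => (∫⁻ x, A i x ∂Q) * ∫⁻ x, B i x ∂Q, e1 fun i => ∫⁻ x, A i x * B i x ∂Q]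
  simp only [← ENNReal.tsum_add]
  refine tsum_congr fun i => ?_
  rw [lintegral_tsum fun j => (hm i j).aemeasurable]
  simp only [← ENNReal.tsum_add]
  refine tsum_congr fun j => ?_
  by_cases h : j = i
  · subst h
    simp only [if_true]
    rw [lintegral_infinitePi_eval Q j (f := fun y => A j y * B j y) (by fun_prop), add_comm]
  · simp only [h, if_false]
    rw [lintegral_infinitePi_pair Q (Ne.symm h) (hA i) (hB j)]

/-- Inclusion-exclusion over the coincidences among three indices, with the negative terms moved to
the left. The coefficient `2` is the Möbius weight of the total coincidence. -/
theorem lintegral_tsum_mul_tsum_mul_tsum (hA : ∀ i, Measurable (A i)) (hB : ∀ i, Measurable (B i))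
    (hC : ∀ i, Measurable (C i)) :
    ∫⁻ x, (∑' i, A i (x i)) * (∑' j, B j (x j)) * (∑' k, C k (x k))
          ∂(Measure.infinitePi fun _ : ℕ => Q) +
        ((∑' i, (∫⁻ x, A i x ∂Q) * ∫⁻ x, B i x ∂Q) * (∑' k, ∫⁻ x, C k x ∂Q) +
        (∑' i, (∫⁻ x, A i x ∂Q) * ∫⁻ x, C i x ∂Q) * (∑' k, ∫⁻ x, B k x ∂Q) +
        (∑' i, (∫⁻ x, B i x ∂Q) * ∫⁻ x, C i x ∂Q) * (∑' k, ∫⁻ x, A k x ∂Q) +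
        ∑' i, ((∫⁻ x, A i x * B i x ∂Q) * (∫⁻ x, C i x ∂Q) +
          (∫⁻ x, A i x * C i x ∂Q) * (∫⁻ x, B i x ∂Q) +
          (∫⁻ x, B i x * C i x ∂Q) * (∫⁻ x, A i x ∂Q))) =
      (∑' i, ∫⁻ x, A i x ∂Q) * (∑' j, ∫⁻ x, B j x ∂Q) * (∑' j, ∫⁻ x, C j x ∂Q) +
        ((∑' i, ∫⁻ x, A i x * B i x ∂Q) * (∑' k, ∫⁻ x, C k x ∂Q) +
        (∑' i, ∫⁻ x, A i x * C i x ∂Q) * (∑' k, ∫⁻ x, B k x ∂Q) +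
        (∑' i, ∫⁻ x, B i x * C i x ∂Q) * (∑' k, ∫⁻ x, A k x ∂Q)) +
        ∑' i, (∫⁻ x, A i x * B i x * C i x ∂Q +
          2 * ((∫⁻ x, A i x ∂Q) * (∫⁻ x, B i x ∂Q) * ∫⁻ x, C i x ∂Q)) := by
  have hA' : ∀ i, Measurable fun x : ℕ → T => A i (x i) := fun i =>
    (hA i).comp (measurable_pi_apply i)
  have hB' : ∀ i, Measurable fun x : ℕ → T => B i (x i) := fun i =>
    (hB i).comp (measurable_pi_apply i)
  have hC' : ∀ i, Measurable fun x : ℕ → T => C i (x i) := fun i =>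
    (hC i).comp (measurable_pi_apply i)
  have hm : ∀ i j k, Measurable fun x : ℕ → T => A i (x i) * B j (x j) * C k (x k) :=
    fun i j k => ((hA' i).mul (hB' j)).mul (hC' k)
  -- Each lower-order sum is spread over all triples by indicators, so that the identity can be
  -- checked triple by triple.
  have eA : ∀ d c : ℕ → ℝ≥0∞, (∑' i, d i) * ∑' k, c k =
      ∑' i, ∑' j, ∑' k, if j = i then d i * c k else 0 := fun d c => by
    rw [tsum_mul_tsum]
    refine tsum_congr fun i => ?_
    rw [ENNReal.tsum_comm]
    exact tsum_congr fun k => by rw [tsum_ite_eq]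
  have eB : ∀ d c : ℕ → ℝ≥0∞, (∑' i, d i) * ∑' k, c k =
      ∑' i, ∑' j, ∑' k, if k = i then d i * c j else 0 := fun d c => by
    rw [tsum_mul_tsum]
    exact tsum_congr fun i => tsum_congr fun j => by rw [tsum_ite_eq]
  have eC : ∀ d c : ℕ → ℝ≥0∞, (∑' i, d i) * ∑' k, c k =
      ∑' i, ∑' j, ∑' k, if k = j then d j * c i else 0 := fun d c => by
    rw [mul_comm, tsum_mul_tsum]
    exact tsum_congr fun i => tsum_congr fun j => by rw [tsum_ite_eq, mul_comm]
  have eD : ∀ d : ℕ → ℝ≥0∞, (∑' i, d i) =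
      ∑' i, ∑' j, ∑' k, if j = i then (if k = i then d i else 0) else 0 := fun d => by
    refine tsum_congr fun i => ?_
    rw [ENNReal.tsum_comm]
    simp_rw [tsum_ite_eq]
  rw [eA, eB, eC, eD fun i => ((∫⁻ x, A i x * B i x ∂Q) * (∫⁻ x, C i x ∂Q) +
          (∫⁻ x, A i x * C i x ∂Q) * (∫⁻ x, B i x ∂Q) +
          (∫⁻ x, B i x * C i x ∂Q) * (∫⁻ x, A i x ∂Q)), eA (fun i => ∫⁻ x, A i x * B i x ∂Q), eB (fun i => ∫⁻ x, A i x * C i x ∂Q),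
    eC (fun i => ∫⁻ x, B i x * C i x ∂Q), eD fun i => ∫⁻ x, A i x * B i x * C i x ∂Q + _]
  simp_rw [tsum_mul_tsum_mul_tsum]
  rw [lintegral_tsum fun i => (Measurable.tsum fun j =>
    Measurable.tsum fun k => hm i j k).aemeasurable]
  simp only [← ENNReal.tsum_add]
  refine tsum_congr fun i => ?_
  rw [lintegral_tsum fun j => (Measurable.tsum fun k => hm i j k).aemeasurable]
  simp only [← ENNReal.tsum_add]
  refine tsum_congr fun j => ?_
  rw [lintegral_tsum fun k => (hm i j k).aemeasurable]
  simp only [← ENNReal.tsum_add]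
  refine tsum_congr fun k => ?_
  by_cases h1 : j = i
  · subst h1
    by_cases h2 : k = j
    · subst h2
      simp only [if_true]
      rw [lintegral_infinitePi_eval Q k (f := fun y => A k y * B k y * C k y) (by fun_prop)]
      ring
    · simp only [if_true, h2, if_false]
      rw [lintegral_infinitePi_pair Q (Ne.symm h2) (f := fun y => A j y * B j y) (by fun_prop)
        (hC k)]
      ring
  · by_cases h2 : k = i
    · subst h2
      simp only [if_true, h1, if_false, Ne.symm h1]
      have : ∀ x : ℕ → T, A k (x k) * B j (x j) * C k (x k) = (A k (x k) * C k (x k)) * B j (x j) :=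
        fun x => by ring
      simp_rw [this]
      rw [lintegral_infinitePi_pair Q (Ne.symm h1) (f := fun y => A k y * C k y) (by fun_prop)
        (hB j)]
      ring
    · by_cases h3 : k = j
      · subst h3
        simp only [if_true, h1, if_false]
        have : ∀ x : ℕ → T, A i (x i) * B k (x k) * C k (x k) =
          (B k (x k) * C k (x k)) * A i (x i) := fun x => by ring
        simp_rw [this]
        rw [lintegral_infinitePi_pair Q h1 (f := fun y => B k y * C k y) (by fun_prop) (hA i)]
        ring
      · simp only [h1, h2, h3, if_false]
        rw [lintegral_infinitePi_triple Q (Ne.symm h1) (Ne.symm h2) (Ne.symm h3) (hA i) (hB j)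
          (hC k)]
        ring

end MarkedSums

/-! ### Moments of Poisson integrals -/

theorem iSup_mul_iSup_of_monotone {a b : ℕ → ℝ≥0∞} (ha : Monotone a) (hb : Monotone b) :
    (⨆ n, a n) * ⨆ n, b n = ⨆ n, a n * b n := by
  refine le_antisymm ?_ (iSup_le fun n => mul_le_mul' (le_iSup a n) (le_iSup b n))
  rw [ENNReal.iSup_mul]
  refine iSup_le fun i => ?_
  rw [ENNReal.mul_iSup]
  refine iSup_le fun j => ?_
  exact (mul_le_mul' (ha (le_max_left i j)) (hb (le_max_right i j))).trans
    (le_iSup (fun n => a n * b n) (max i j))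

/-! ### Coincidence patterns in finite double and triple sums. -/

section FiniteSums

variable {ι : Type*} (I : Finset ι) (p q r v : ι → ℝ≥0∞)

theorem mul_sum_cells (c : ℝ≥0∞) : c * ∑ s ∈ I, p s * v s = ∑ s ∈ I, p s * (c * v s) := by
  rw [Finset.mul_sum]
  exact Finset.sum_congr rfl fun s _ => mul_left_comm _ _ _

theorem sum_mul_sum_eq : (∑ s ∈ I, p s * v s) * (∑ t ∈ I, q t * v t) =
    ∑ s ∈ I, ∑ t ∈ I, p s * q t * (v s * v t) := by
  rw [Finset.sum_mul_sum]
  exact Finset.sum_congr rfl fun s _ => Finset.sum_congr rfl fun t _ => by ring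

theorem sum_mul_sum_mul_sum_eq : (∑ s ∈ I, p s * v s) * (∑ t ∈ I, q t * v t) *
    (∑ u ∈ I, r u * v u) = ∑ s ∈ I, ∑ t ∈ I, ∑ u ∈ I, p s * q t * r u * (v s * v t * v u) := by
  rw [Finset.sum_mul_sum, Finset.sum_mul]
  refine Finset.sum_congr rfl fun s _ => ?_
  rw [Finset.sum_mul_sum]
  exact Finset.sum_congr rfl fun t _ => Finset.sum_congr rfl fun u _ => by ring

variable [DecidableEq ι]

theorem sum_pattern₂ : ∑ s ∈ I, ∑ t ∈ I, p s * q t * (v s * v t + if t = s then v s else 0) =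
    (∑ s ∈ I, p s * v s) * (∑ t ∈ I, q t * v t) + ∑ s ∈ I, p s * q s * v s := by
  rw [sum_mul_sum_eq, ← Finset.sum_add_distrib]
  refine Finset.sum_congr rfl fun s hs => ?_
  simp only [mul_add, mul_ite, mul_zero, Finset.sum_add_distrib, Finset.sum_ite_eq', hs, if_true]

theorem sum_pattern₃ : ∑ s ∈ I, ∑ t ∈ I, ∑ u ∈ I, p s * q t * r u * (v s * v t * v u +
      ((if t = s then v s * v u else 0) + (if u = s then v s * v t else 0) +
        (if u = t then v t * v s else 0)) + (if t = s then (if u = s then v s else 0) else 0)) =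
    (∑ s ∈ I, p s * v s) * (∑ t ∈ I, q t * v t) * (∑ u ∈ I, r u * v u) +
      ((∑ s ∈ I, p s * q s * v s) * (∑ u ∈ I, r u * v u) +
        (∑ s ∈ I, p s * r s * v s) * (∑ u ∈ I, q u * v u) +
        (∑ s ∈ I, q s * r s * v s) * (∑ u ∈ I, p u * v u)) +
      ∑ s ∈ I, p s * q s * r s * v s := by
  have e1 : ∑ s ∈ I, ∑ t ∈ I, ∑ u ∈ I, p s * q t * r u * (if t = s then v s * v u else 0) =
      (∑ s ∈ I, p s * q s * v s) * (∑ u ∈ I, r u * v u) := by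
    rw [Finset.sum_mul_sum]
    refine Finset.sum_congr rfl fun s hs => ?_
    rw [Finset.sum_comm]
    refine Finset.sum_congr rfl fun u _ => ?_
    simp only [mul_ite, mul_zero, Finset.sum_ite_eq', hs, if_true]
    ring
  have e2 : ∑ s ∈ I, ∑ t ∈ I, ∑ u ∈ I, p s * q t * r u * (if u = s then v s * v t else 0) =
      (∑ s ∈ I, p s * r s * v s) * (∑ u ∈ I, q u * v u) := by
    rw [Finset.sum_mul_sum]
    refine Finset.sum_congr rfl fun s hs => Finset.sum_congr rfl fun t _ => ?_
    simp only [mul_ite, mul_zero, Finset.sum_ite_eq', hs, if_true]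
    ring
  have e3 : ∑ s ∈ I, ∑ t ∈ I, ∑ u ∈ I, p s * q t * r u * (if u = t then v t * v s else 0) =
      (∑ s ∈ I, q s * r s * v s) * (∑ u ∈ I, p u * v u) := by
    rw [mul_comm, Finset.sum_mul_sum]
    refine Finset.sum_congr rfl fun s _ => Finset.sum_congr rfl fun t ht => ?_
    simp only [mul_ite, mul_zero, Finset.sum_ite_eq', ht, if_true]
    ring
  have e4 : ∑ s ∈ I, ∑ t ∈ I, ∑ u ∈ I, p s * q t * r u *
      (if t = s then (if u = s then v s else 0) else 0) = ∑ s ∈ I, p s * q s * r s * v s := by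
    refine Finset.sum_congr rfl fun s hs => ?_
    rw [Finset.sum_comm]
    simp only [mul_ite, mul_zero, Finset.sum_ite_eq', hs, if_true]
  rw [sum_mul_sum_mul_sum_eq, ← e1, ← e2, ← e3, ← e4]
  simp only [mul_add, Finset.sum_add_distrib]

end FiniteSums

theorem monotone_window : Monotone fun n : ℕ => Icc (-(n : ℝ)) n := fun a b hab => by
  have : (a : ℝ) ≤ b := by exact_mod_cast hab
  exact Icc_subset_Icc (by linarith) this

theorem iUnion_window : ⋃ n : ℕ, Icc (-(n : ℝ)) n = univ := by
  refine eq_univ_of_forall fun x => mem_iUnion.2 ?_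
  obtain ⟨n, hn⟩ := exists_nat_ge |x|
  exact ⟨n, abs_le.1 hn⟩

/-! ### Exhaustion of the line by bounded windows. -/

section Window

variable {F G : ℕ → ℝ → ℝ≥0∞} (hF : ∀ n, Measurable (F n)) (hm : Monotone F) (hmG : Monotone G)
  (μ : Measure ℝ)
include hm

theorem monotone_mul_fun (hmG : Monotone G) : Monotone fun n x => F n x * G n x :=
  fun _ _ hab x => mul_le_mul' (hm hab x) (hmG hab x)

theorem monotone_setLIntegral_window :
    Monotone fun n : ℕ => ∫⁻ x in Icc (-(n : ℝ)) n, F n x ∂μ := fun _ _ hab =>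
  (lintegral_mono (hm hab)).trans (lintegral_mono_set (monotone_window hab))

include hF

theorem iSup_setLIntegral_window :
    ⨆ n : ℕ, ∫⁻ x in Icc (-(n : ℝ)) n, F n x ∂μ = ∫⁻ x, ⨆ n, F n x ∂μ := by
  simp_rw [← lintegral_indicator measurableSet_Icc]
  rw [← lintegral_iSup (fun n => (hF n).indicator measurableSet_Icc)]
  · refine lintegral_congr fun x => le_antisymm ?_ ?_
    · exact iSup_mono fun n => indicator_le_self _ _ x
    · refine iSup_le fun n => ?_
      obtain ⟨k, hk⟩ := mem_iUnion.1 (iUnion_window ▸ mem_univ x)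
      refine le_iSup_of_le (max n k) ?_
      rw [indicator_of_mem (monotone_window (le_max_right n k) hk)]
      exact hm (le_max_left n k) x
  · intro a b hab x
    exact (indicator_le_indicator (hm hab x)).trans
      (indicator_le_indicator_of_subset (monotone_window hab) (fun _ => zero_le) x)

end Window

section Approx

variable {f g k : ℝ → ℝ≥0∞} (hf : Measurable f) (hg : Measurable g) (hk : Measurable k)
  (μ : Measure ℝ)
include hf

/-- The function and the domain are truncated at the same level. Bounded windows keep the level sets
of finite length, as the Poisson count law requires, and monotonicity in both makes one supremum
suffice. -/
theorem lintegral_eq_iSup_window : ∫⁻ x, f x ∂μ =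
    ⨆ n : ℕ, ∫⁻ x in Icc (-(n : ℝ)) n, SimpleFunc.eapprox f n x ∂μ := by
  rw [iSup_setLIntegral_window (fun n => (SimpleFunc.eapprox f n).measurable)
    (SimpleFunc.monotone_eapprox f)]
  exact lintegral_congr fun x => (SimpleFunc.iSup_eapprox_apply hf x).symm

include hg

theorem lintegral_mul_eq_iSup_window : ∫⁻ x, f x * g x ∂μ =
    ⨆ n : ℕ, ∫⁻ x in Icc (-(n : ℝ)) n,
      SimpleFunc.eapprox f n x * SimpleFunc.eapprox g n x ∂μ := by
  have hfm : Monotone fun n x => SimpleFunc.eapprox f n x := SimpleFunc.monotone_eapprox f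
  have hgm : Monotone fun n x => SimpleFunc.eapprox g n x := SimpleFunc.monotone_eapprox g
  rw [iSup_setLIntegral_window
    (F := fun n x => SimpleFunc.eapprox f n x * SimpleFunc.eapprox g n x)
    (fun n => (SimpleFunc.eapprox f n).measurable.mul (SimpleFunc.eapprox g n).measurable) (monotone_mul_fun hfm hgm)]
  refine lintegral_congr fun x => ?_
  rw [← iSup_mul_iSup_of_monotone (fun _ _ h => hfm h x) (fun _ _ h => hgm h x),
    SimpleFunc.iSup_eapprox_apply hf, SimpleFunc.iSup_eapprox_apply hg]

include hk

theorem lintegral_mul_mul_eq_iSup_window : ∫⁻ x, f x * g x * k x ∂μ =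
    ⨆ n : ℕ, ∫⁻ x in Icc (-(n : ℝ)) n,
      SimpleFunc.eapprox f n x * SimpleFunc.eapprox g n x * SimpleFunc.eapprox k n x ∂μ := by
  have hfm : Monotone fun n x => SimpleFunc.eapprox f n x := SimpleFunc.monotone_eapprox f
  have hgm : Monotone fun n x => SimpleFunc.eapprox g n x := SimpleFunc.monotone_eapprox g
  have hkm : Monotone fun n x => SimpleFunc.eapprox k n x := SimpleFunc.monotone_eapprox k
  rw [iSup_setLIntegral_window (F := fun n x =>
    SimpleFunc.eapprox f n x * SimpleFunc.eapprox g n x * SimpleFunc.eapprox k n x)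
    (fun n => ((SimpleFunc.eapprox f n).measurable.mul
    (SimpleFunc.eapprox g n).measurable).mul (SimpleFunc.eapprox k n).measurable)
    (monotone_mul_fun (monotone_mul_fun hfm hgm) hkm)]
  refine lintegral_congr fun x => ?_
  rw [← iSup_mul_iSup_of_monotone (fun _ _ h => mul_le_mul' (hfm h x) (hgm h x))
    (fun _ _ h => hkm h x), ← iSup_mul_iSup_of_monotone (fun _ _ h => hfm h x)
    (fun _ _ h => hgm h x), SimpleFunc.iSup_eapprox_apply hf, SimpleFunc.iSup_eapprox_apply hg,
    SimpleFunc.iSup_eapprox_apply hk]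

end Approx

/-! ### Campbell formulas of orders one to three. -/

section Poisson

variable {Ω : Type*} [MeasurableSpace Ω] {P : Measure Ω} {ν : ℝ≥0} {N : Ω → Measure ℝ}

theorem measurable_lintegral_comp (hN : Measurable N) {f : ℝ → ℝ≥0∞} (hf : Measurable f) :
    Measurable fun ω => ∫⁻ x, f x ∂(N ω) :=
  (Measure.measurable_lintegral hf).comp hN

theorem measurable_setLIntegral_comp (hN : Measurable N) {W : Set ℝ} (hW : MeasurableSet W)
    {f : ℝ → ℝ≥0∞} (hf : Measurable f) : Measurable fun ω => ∫⁻ x in W, f x ∂(N ω) := by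
  simp_rw [← lintegral_indicator hW]
  exact measurable_lintegral_comp hN (hf.indicator hW)

namespace IsPoissonProcess

variable (hP : IsPoissonProcess P ν N)
include hP

theorem lintegral_count_comp {A : Set ℝ} (hA : MeasurableSet A) (hA' : volume A ≠ ∞)
    (g : ℝ≥0∞ → ℝ≥0∞) (hg : Measurable g) :
    ∫⁻ ω, g (N ω A) ∂P = ∫⁻ n, g (n : ℝ≥0∞) ∂(poissonMeasure (ν * (volume A).toNNReal)) := by
  rw [(hP.count_law A hA hA').lintegral_comp hg.aemeasurable, lintegral_map hg (by fun_prop)]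

omit hP in
theorem coe_rate {A : Set ℝ} (hA' : volume A ≠ ∞) :
    ((ν * (volume A).toNNReal : ℝ≥0) : ℝ≥0∞) = ν * volume A := by
  rw [ENNReal.coe_mul, ENNReal.coe_toNNReal hA']

theorem lintegral_count {A : Set ℝ} (hA : MeasurableSet A) (hA' : volume A ≠ ∞) :
    ∫⁻ ω, N ω A ∂P = ν * volume A := by
  rw [hP.lintegral_count_comp hA hA' (fun x => x) measurable_id, lintegral_poisson_one,
    coe_rate hA']

theorem lintegral_count_sq {A : Set ℝ} (hA : MeasurableSet A) (hA' : volume A ≠ ∞) :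
    ∫⁻ ω, N ω A * N ω A ∂P = (ν * volume A) * (ν * volume A) + ν * volume A := by
  rw [hP.lintegral_count_comp hA hA' (fun x => x * x) (by fun_prop), lintegral_poisson_sq,
    coe_rate hA']

theorem lintegral_count_cube {A : Set ℝ} (hA : MeasurableSet A) (hA' : volume A ≠ ∞) :
    ∫⁻ ω, N ω A * N ω A * N ω A ∂P = (ν * volume A) * (ν * volume A) * (ν * volume A) +
      3 * ((ν * volume A) * (ν * volume A)) + ν * volume A := by
  simp_rw [mul_assoc (N _ A)]
  rw [hP.lintegral_count_comp hA hA' (fun x => x * (x * x)) (by fun_prop), lintegral_poisson_cube,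
    coe_rate hA']

variable (hN : Measurable N)
include hN

theorem lintegral_count_mul {A B : Set ℝ} (hA : MeasurableSet A) (hB : MeasurableSet B)
    (hAB : Disjoint A B) {f g : ℝ≥0∞ → ℝ≥0∞} (hf : Measurable f) (hg : Measurable g) :
    ∫⁻ ω, f (N ω A) * g (N ω B) ∂P = (∫⁻ ω, f (N ω A) ∂P) * ∫⁻ ω, g (N ω B) ∂P := by
  have h := hP.indep 2 ![A, B] (by simp [Fin.forall_fin_two, hA, hB])
    (by intro i j hij; fin_cases i <;> fin_cases j <;> simp_all [hAB.symm])
  have h2 := h.indepFun (show (0 : Fin 2) ≠ 1 by decide)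
  have mA : Measurable fun ω => N ω A := (Measure.measurable_coe hA).comp hN
  have mB : Measurable fun ω => N ω B := (Measure.measurable_coe hB).comp hN
  exact lintegral_mul_eq_lintegral_mul_lintegral_of_indepFun'' (hf.comp mA).aemeasurable
    (hg.comp mB).aemeasurable (h2.comp hf hg)

theorem lintegral_count_mul_mul {A B C : Set ℝ} (hA : MeasurableSet A) (hB : MeasurableSet B)
    (hC : MeasurableSet C) (hAB : Disjoint A B) (hAC : Disjoint A C) (hBC : Disjoint B C) :
    ∫⁻ ω, N ω A * N ω B * N ω C ∂P =
      (∫⁻ ω, N ω A ∂P) * (∫⁻ ω, N ω B ∂P) * ∫⁻ ω, N ω C ∂P := by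
  have mA : Measurable fun ω => N ω A := (Measure.measurable_coe hA).comp hN
  have mB : Measurable fun ω => N ω B := (Measure.measurable_coe hB).comp hN
  have mC : Measurable fun ω => N ω C := (Measure.measurable_coe hC).comp hN
  have h := hP.indep 3 ![A, B, C] (by intro i; fin_cases i <;> simp [hA, hB, hC])
    (by intro i j hij; fin_cases i <;> fin_cases j <;>
          simp_all [hAB.symm, hBC.symm, hAC.symm])
  have h2 := h.indepFun_prodMk (by intro i; fin_cases i <;> simpa) 0 1 2 (by decide) (by decide)
  rw [lintegral_mul_eq_lintegral_mul_lintegral_of_indepFun''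
    (f := fun ω => N ω A * N ω B) (mA.mul mB).aemeasurable
    mC.aemeasurable (h2.comp (φ := fun p : ℝ≥0∞ × ℝ≥0∞ => p.1 * p.2) (ψ := id) (by fun_prop)
      measurable_id), hP.lintegral_count_mul hN hA hB hAB (f := fun x => x) (g := fun x => x)
      measurable_id measurable_id]

section Cells

variable {ι : Type*} [DecidableEq ι] {E : ι → Set ℝ} (hE : ∀ s, MeasurableSet (E s))
  (hE' : ∀ s, volume (E s) ≠ ∞) (hd : ∀ s t, s ≠ t → Disjoint (E s) (E t))
include hE hE' hd

theorem lintegral_cell_mul (s t : ι) :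
    ∫⁻ ω, N ω (E s) * N ω (E t) ∂P = (ν * volume (E s)) * (ν * volume (E t)) +
      if t = s then ν * volume (E s) else 0 := by
  by_cases h : t = s
  · subst h
    simp only [if_true]
    exact hP.lintegral_count_sq (hE _) (hE' _)
  · rw [hP.lintegral_count_mul hN (hE s) (hE t) (hd s t (Ne.symm h)) (f := fun x => x)
      (g := fun x => x) measurable_id measurable_id, hP.lintegral_count (hE _) (hE' _),
      hP.lintegral_count (hE _) (hE' _)]
    simp [h]

/-- There is one summand for each set partition of the three positions, present when the positions
in each block carry the same cell. If all cells agree, the five partitions add up to the third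
Poisson moment `λ³ + 3λ² + λ`. -/
theorem lintegral_cell_mul_mul (s t r : ι) :
    ∫⁻ ω, N ω (E s) * N ω (E t) * N ω (E r) ∂P =
      (ν * volume (E s)) * (ν * volume (E t)) * (ν * volume (E r)) +
      ((if t = s then (ν * volume (E s)) * (ν * volume (E r)) else 0) +
      (if r = s then (ν * volume (E s)) * (ν * volume (E t)) else 0) +
      (if r = t then (ν * volume (E t)) * (ν * volume (E s)) else 0)) +
      (if t = s then (if r = s then ν * volume (E s) else 0) else 0) := by
  by_cases h1 : t = s
  · subst h1
    by_cases h2 : r = t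
    · subst h2
      simp only [if_true]
      rw [hP.lintegral_count_cube (hE _) (hE' _)]
      ring
    · rw [hP.lintegral_count_mul hN (hE t) (hE r) (hd t r (Ne.symm h2)) (f := fun x => x * x)
        (g := fun x => x) (by fun_prop) measurable_id, hP.lintegral_count_sq (hE _) (hE' _),
        hP.lintegral_count (hE _) (hE' _)]
      simp only [if_true, h2, if_false]
      ring
  · by_cases h2 : r = s
    · subst h2
      have : ∀ ω, N ω (E r) * N ω (E t) * N ω (E r) = (N ω (E r) * N ω (E r)) * N ω (E t) :=
        fun ω => by ring
      simp_rw [this]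
      rw [hP.lintegral_count_mul hN (hE r) (hE t) (hd r t (Ne.symm h1)) (f := fun x => x * x)
        (g := fun x => x) (by fun_prop) measurable_id, hP.lintegral_count_sq (hE _) (hE' _),
        hP.lintegral_count (hE _) (hE' _)]
      simp only [if_true, h1, if_false, Ne.symm h1]
      ring
    · by_cases h3 : r = t
      · subst h3
        have : ∀ ω, N ω (E s) * N ω (E r) * N ω (E r) = (N ω (E r) * N ω (E r)) * N ω (E s) :=
          fun ω => by ring
        simp_rw [this]
        rw [hP.lintegral_count_mul hN (hE r) (hE s) (hd r s h1) (f := fun x => x * x)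
          (g := fun x => x) (by fun_prop) measurable_id, hP.lintegral_count_sq (hE _) (hE' _),
          hP.lintegral_count (hE _) (hE' _)]
        simp only [if_true, h1, if_false]
        ring
      · rw [hP.lintegral_count_mul_mul hN (hE s) (hE t) (hE r) (hd s t (Ne.symm h1))
          (hd s r (Ne.symm h2)) (hd t r (Ne.symm h3)), hP.lintegral_count (hE _) (hE' _),
          hP.lintegral_count (hE _) (hE' _), hP.lintegral_count (hE _) (hE' _)]
        simp [h1, h2, h3]

end Cells

section SimpleFunctions

variable {β : Type*} (φ : SimpleFunc ℝ β) (p q r : β → ℝ≥0∞) {W : Set ℝ} (hW : MeasurableSet W)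
  (hW' : volume W ≠ ∞)

omit hP hN in
theorem setLIntegral_simpleFunc_comp (μ : Measure ℝ) :
    ∫⁻ x in W, p (φ x) ∂μ = ∑ s ∈ φ.range, p s * μ (φ ⁻¹' {s} ∩ W) := by
  have := SimpleFunc.map_lintegral (μ := μ.restrict W) p φ
  rw [← SimpleFunc.lintegral_eq_lintegral] at this
  simp only [SimpleFunc.coe_map, Function.comp_apply] at this
  rw [this]
  exact Finset.sum_congr rfl fun s _ => by
    rw [Measure.restrict_apply (φ.measurableSet_fiber s)]

include hW

omit hP hN in
theorem measurableSet_cell (s : β) : MeasurableSet (φ ⁻¹' {s} ∩ W) :=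
  (φ.measurableSet_fiber s).inter hW

omit hP hN hW in
theorem disjoint_cell (s t : β) (hst : s ≠ t) : Disjoint (φ ⁻¹' {s} ∩ W) (φ ⁻¹' {t} ∩ W) := by
  refine Set.disjoint_left.2 fun x hx hx' => hst ?_
  have h1 : φ x = s := hx.1
  have h2 : φ x = t := hx'.1
  exact h1.symm.trans h2

include hW'

omit hP hN hW in
theorem volume_cell_ne_top (s : β) : volume (φ ⁻¹' {s} ∩ W) ≠ ∞ :=
  ((measure_mono inter_subset_right).trans_lt hW'.lt_top).ne

theorem lintegral_simpleFunc :
    ∫⁻ ω, (∫⁻ x in W, p (φ x) ∂(N ω)) ∂P = ν * ∫⁻ x in W, p (φ x) := by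
  have hm : ∀ s, Measurable fun ω => N ω (φ ⁻¹' {s} ∩ W) := fun s =>
    (Measure.measurable_coe (measurableSet_cell φ hW s)).comp hN
  simp_rw [setLIntegral_simpleFunc_comp φ p]
  rw [lintegral_finsetSum _ fun s _ => (hm s).const_mul _, Finset.mul_sum]
  refine Finset.sum_congr rfl fun s _ => ?_
  rw [lintegral_const_mul _ (hm s), hP.lintegral_count (measurableSet_cell φ hW s)
    (volume_cell_ne_top φ hW' s), mul_left_comm]

theorem lintegral_simpleFunc_mul :
    ∫⁻ ω, (∫⁻ x in W, p (φ x) ∂(N ω)) * (∫⁻ x in W, q (φ x) ∂(N ω)) ∂P =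
      (ν * ∫⁻ x in W, p (φ x)) * (ν * ∫⁻ x in W, q (φ x)) + ν * ∫⁻ x in W, p (φ x) * q (φ x) := by
  classical
  have hm : ∀ s, Measurable fun ω => N ω (φ ⁻¹' {s} ∩ W) := fun s =>
    (Measure.measurable_coe (measurableSet_cell φ hW s)).comp hN
  simp_rw [setLIntegral_simpleFunc_comp φ p, setLIntegral_simpleFunc_comp φ q,
    setLIntegral_simpleFunc_comp φ (fun s => p s * q s), mul_sum_cells _ _ _ (ν : ℝ≥0∞)]
  conv_lhs => simp only [sum_mul_sum_eq _ p q]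
  rw [lintegral_finsetSum _ fun s _ => by fun_prop]
  refine Eq.trans (Finset.sum_congr rfl fun s _ => ?_) (sum_pattern₂ _ p q _)
  rw [lintegral_finsetSum _ fun t _ => by fun_prop]
  refine Finset.sum_congr rfl fun t _ => ?_
  rw [lintegral_const_mul _ (by fun_prop), hP.lintegral_cell_mul hN (measurableSet_cell φ hW)
    (volume_cell_ne_top φ hW') (disjoint_cell φ)]

theorem lintegral_simpleFunc_mul_mul :
    ∫⁻ ω, (∫⁻ x in W, p (φ x) ∂(N ω)) * (∫⁻ x in W, q (φ x) ∂(N ω)) *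
        (∫⁻ x in W, r (φ x) ∂(N ω)) ∂P =
      (ν * ∫⁻ x in W, p (φ x)) * (ν * ∫⁻ x in W, q (φ x)) * (ν * ∫⁻ x in W, r (φ x)) +
      ((ν * ∫⁻ x in W, p (φ x) * q (φ x)) * (ν * ∫⁻ x in W, r (φ x)) +
        (ν * ∫⁻ x in W, p (φ x) * r (φ x)) * (ν * ∫⁻ x in W, q (φ x)) +
        (ν * ∫⁻ x in W, q (φ x) * r (φ x)) * (ν * ∫⁻ x in W, p (φ x))) +
      ν * ∫⁻ x in W, p (φ x) * q (φ x) * r (φ x) := by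
  classical
  have hm : ∀ s, Measurable fun ω => N ω (φ ⁻¹' {s} ∩ W) := fun s =>
    (Measure.measurable_coe (measurableSet_cell φ hW s)).comp hN
  simp_rw [setLIntegral_simpleFunc_comp φ p, setLIntegral_simpleFunc_comp φ q,
    setLIntegral_simpleFunc_comp φ r, setLIntegral_simpleFunc_comp φ (fun s => p s * q s),
    setLIntegral_simpleFunc_comp φ (fun s => p s * r s),
    setLIntegral_simpleFunc_comp φ (fun s => q s * r s),
    setLIntegral_simpleFunc_comp φ (fun s => p s * q s * r s), mul_sum_cells _ _ _ (ν : ℝ≥0∞)]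
  conv_lhs => simp only [sum_mul_sum_mul_sum_eq _ p q r]
  rw [lintegral_finsetSum _ fun s _ => by fun_prop]
  refine Eq.trans (Finset.sum_congr rfl fun s _ => ?_) (sum_pattern₃ _ p q r _)
  rw [lintegral_finsetSum _ fun t _ => by fun_prop]
  refine Finset.sum_congr rfl fun t _ => ?_
  rw [lintegral_finsetSum _ fun t _ => by fun_prop]
  refine Finset.sum_congr rfl fun u _ => ?_
  rw [lintegral_const_mul _ (by fun_prop), hP.lintegral_cell_mul_mul hN (measurableSet_cell φ hW)
    (volume_cell_ne_top φ hW') (disjoint_cell φ)]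

end SimpleFunctions

section Functions

variable {f g k : ℝ → ℝ≥0∞} (hf : Measurable f) (hg : Measurable g) (hk : Measurable k)
include hf

/-- Campbell's formula. -/
theorem lintegral_linear : ∫⁻ ω, ∫⁻ x, f x ∂(N ω) ∂P = ν * ∫⁻ x, f x := by
  simp_rw [lintegral_eq_iSup_window hf]
  rw [lintegral_iSup (fun n => measurable_setLIntegral_comp hN measurableSet_Icc
    (SimpleFunc.eapprox f n).measurable) (fun _ _ hab ω =>
      monotone_setLIntegral_window (SimpleFunc.monotone_eapprox f) (N ω) hab), ENNReal.mul_iSup]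
  exact iSup_congr fun n => hP.lintegral_simpleFunc hN (SimpleFunc.eapprox f n) id
    measurableSet_Icc (by simp)

include hg

theorem lintegral_mul : ∫⁻ ω, (∫⁻ x, f x ∂(N ω)) * (∫⁻ x, g x ∂(N ω)) ∂P =
    (ν * ∫⁻ x, f x) * (ν * ∫⁻ x, g x) + ν * ∫⁻ x, f x * g x := by
  have hfm : Monotone fun n x => SimpleFunc.eapprox f n x := SimpleFunc.monotone_eapprox f
  have hgm : Monotone fun n x => SimpleFunc.eapprox g n x := SimpleFunc.monotone_eapprox g
  have mf := monotone_setLIntegral_window hfm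
  have mg := monotone_setLIntegral_window hgm
  have mfg := monotone_setLIntegral_window (monotone_mul_fun hfm hgm)
  have c : ∀ {s : ℕ → ℝ≥0∞}, Monotone s → Monotone fun n => ν * s n := fun h _ _ hab =>
    mul_le_mul_right (h hab) _
  -- Pairing the two approximations makes both constant on one common family of disjoint cells.
  have key := fun n : ℕ => hP.lintegral_simpleFunc_mul hN
    ((SimpleFunc.eapprox f n).pair (SimpleFunc.eapprox g n)) Prod.fst Prod.snd
    (W := Icc (-(n : ℝ)) n) measurableSet_Icc (by simp)
  have Mf := fun n : ℕ => measurable_setLIntegral_comp hN (W := Icc (-(n : ℝ)) n) measurableSet_Icc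
    (SimpleFunc.eapprox f n).measurable
  have Mg := fun n : ℕ => measurable_setLIntegral_comp hN (W := Icc (-(n : ℝ)) n) measurableSet_Icc
    (SimpleFunc.eapprox g n).measurable
  simp only [SimpleFunc.pair_apply] at key
  simp_rw [lintegral_mul_eq_iSup_window hf hg, lintegral_eq_iSup_window hf,
    lintegral_eq_iSup_window hg, fun μ => iSup_mul_iSup_of_monotone (mf μ) (mg μ)]
  rw [lintegral_iSup (f := fun (n : ℕ) ω =>
    (∫⁻ x in Icc (-(n : ℝ)) n, SimpleFunc.eapprox f n x ∂(N ω)) *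
      ∫⁻ x in Icc (-(n : ℝ)) n, SimpleFunc.eapprox g n x ∂(N ω)) (fun n => (Mf n).mul (Mg n))
    (fun _ _ hab ω => mul_le_mul' (mf (N ω) hab) (mg (N ω) hab))]
  simp_rw [key, ENNReal.mul_iSup (ν : ℝ≥0∞)]
  rw [iSup_mul_iSup_of_monotone (c (mf _)) (c (mg _)), ENNReal.iSup_add_iSup_of_monotone
    (fun _ _ hab => mul_le_mul' (c (mf _) hab) (c (mg _) hab)) (c (mfg _))]

include hk

theorem lintegral_mul_mul :
    ∫⁻ ω, (∫⁻ x, f x ∂(N ω)) * (∫⁻ x, g x ∂(N ω)) * (∫⁻ x, k x ∂(N ω)) ∂P =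
    (ν * ∫⁻ x, f x) * (ν * ∫⁻ x, g x) * (ν * ∫⁻ x, k x) +
      ((ν * ∫⁻ x, f x * g x) * (ν * ∫⁻ x, k x) + (ν * ∫⁻ x, f x * k x) * (ν * ∫⁻ x, g x) +
        (ν * ∫⁻ x, g x * k x) * (ν * ∫⁻ x, f x)) + ν * ∫⁻ x, f x * g x * k x := by
  have hfm : Monotone fun n x => SimpleFunc.eapprox f n x := SimpleFunc.monotone_eapprox f
  have hgm : Monotone fun n x => SimpleFunc.eapprox g n x := SimpleFunc.monotone_eapprox g
  have hkm : Monotone fun n x => SimpleFunc.eapprox k n x := SimpleFunc.monotone_eapprox k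
  have mf := monotone_setLIntegral_window hfm
  have mg := monotone_setLIntegral_window hgm
  have mk := monotone_setLIntegral_window hkm
  have mfg := monotone_setLIntegral_window (monotone_mul_fun hfm hgm)
  have mfk := monotone_setLIntegral_window (monotone_mul_fun hfm hkm)
  have mgk := monotone_setLIntegral_window (monotone_mul_fun hgm hkm)
  have mfgk := monotone_setLIntegral_window (monotone_mul_fun (monotone_mul_fun hfm hgm) hkm)
  have c : ∀ {s : ℕ → ℝ≥0∞}, Monotone s → Monotone fun n => ν * s n := fun h _ _ hab =>
    mul_le_mul_right (h hab) _
  have cm : ∀ {s t : ℕ → ℝ≥0∞}, Monotone s → Monotone t → Monotone fun n => s n * t n :=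
    fun h h' _ _ hab => mul_le_mul' (h hab) (h' hab)
  have ca : ∀ {s t : ℕ → ℝ≥0∞}, Monotone s → Monotone t → Monotone fun n => s n + t n :=
    fun h h' _ _ hab => add_le_add (h hab) (h' hab)
  have key := fun n : ℕ => hP.lintegral_simpleFunc_mul_mul hN
    ((SimpleFunc.eapprox f n).pair ((SimpleFunc.eapprox g n).pair (SimpleFunc.eapprox k n)))
    Prod.fst (fun p => p.2.1) (fun p => p.2.2)
    (W := Icc (-(n : ℝ)) n) measurableSet_Icc (by simp)
  have Mf := fun n : ℕ => measurable_setLIntegral_comp hN (W := Icc (-(n : ℝ)) n) measurableSet_Icc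
    (SimpleFunc.eapprox f n).measurable
  have Mg := fun n : ℕ => measurable_setLIntegral_comp hN (W := Icc (-(n : ℝ)) n) measurableSet_Icc
    (SimpleFunc.eapprox g n).measurable
  have Mk := fun n : ℕ => measurable_setLIntegral_comp hN (W := Icc (-(n : ℝ)) n) measurableSet_Icc
    (SimpleFunc.eapprox k n).measurable
  simp only [SimpleFunc.pair_apply] at key
  simp_rw [lintegral_mul_mul_eq_iSup_window hf hg hk, lintegral_mul_eq_iSup_window hf hg,
    lintegral_mul_eq_iSup_window hf hk, lintegral_mul_eq_iSup_window hg hk,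
    lintegral_eq_iSup_window hf, lintegral_eq_iSup_window hg, lintegral_eq_iSup_window hk,
    fun μ => iSup_mul_iSup_of_monotone (mf μ) (mg μ),
    fun μ => iSup_mul_iSup_of_monotone (cm (mf μ) (mg μ)) (mk μ)]
  rw [lintegral_iSup (f := fun (n : ℕ) ω =>
    (∫⁻ x in Icc (-(n : ℝ)) n, SimpleFunc.eapprox f n x ∂(N ω)) *
      (∫⁻ x in Icc (-(n : ℝ)) n, SimpleFunc.eapprox g n x ∂(N ω)) *
      ∫⁻ x in Icc (-(n : ℝ)) n, SimpleFunc.eapprox k n x ∂(N ω))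
    (fun n => ((Mf n).mul (Mg n)).mul (Mk n))
    (fun _ _ hab ω => mul_le_mul' (mul_le_mul' (mf (N ω) hab) (mg (N ω) hab)) (mk (N ω) hab))]
  simp_rw [key, ENNReal.mul_iSup (ν : ℝ≥0∞)]
  have hf' := c (mf volume)
  have hg' := c (mg volume)
  have hk' := c (mk volume)
  have h1 := cm (c (mfg volume)) hk'
  have h2 := cm (c (mfk volume)) hg'
  have h3 := cm (c (mgk volume)) hf'
  rw [iSup_mul_iSup_of_monotone hf' hg', iSup_mul_iSup_of_monotone (cm hf' hg') hk',
    iSup_mul_iSup_of_monotone (c (mfg _)) hk', iSup_mul_iSup_of_monotone (c (mfk _)) hg',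
    iSup_mul_iSup_of_monotone (c (mgk _)) hf', ENNReal.iSup_add_iSup_of_monotone h1 h2,
    ENNReal.iSup_add_iSup_of_monotone (ca h1 h2) h3,
    ENNReal.iSup_add_iSup_of_monotone (cm (cm hf' hg') hk') (ca (ca h1 h2) h3),
    ENNReal.iSup_add_iSup_of_monotone (ca (cm (cm hf' hg') hk') (ca (ca h1 h2) h3)) (c (mfgk _))]

end Functions

end IsPoissonProcess

end Poisson

/-! ### Moments of a Poisson superposition of independent marks -/

theorem lintegral_sum_dirac (u : ℕ → ℝ) {f : ℝ → ℝ≥0∞} (hf : Measurable f) :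
    ∫⁻ x, f x ∂(Measure.sum fun j : ℕ => Measure.dirac (u j)) = ∑' j, f (u j) := by
  rw [lintegral_sum_measure]
  exact tsum_congr fun j => lintegral_dirac' _ hf

theorem measurable_sum_dirac {Ω : Type*} [MeasurableSpace Ω] {U : ℕ → Ω → ℝ}
    (hU : ∀ j, Measurable (U j)) :
    Measurable fun ω => Measure.sum fun j : ℕ => Measure.dirac (U j ω) := by
  refine Measure.measurable_of_measurable_coe _ fun s hs => ?_
  simp_rw [Measure.sum_apply _ hs]
  exact Measurable.tsum fun j =>
    (Measure.measurable_coe hs).comp (Measure.measurable_dirac.comp (hU j))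

section Superposition

variable {Ω : Type*} [MeasurableSpace Ω] {P : Measure Ω} {ν : ℝ≥0} {U : ℕ → Ω → ℝ}
  (hU : ∀ j, Measurable (U j))
  (hR : IsPoissonProcess P ν fun ω => Measure.sum fun j : ℕ => Measure.dirac (U j ω))
  {T : Type*} [MeasurableSpace T] {Q : Measure T} [IsProbabilityMeasure Q]
  {F G H : ℝ → T → ℝ≥0∞} (hF : Measurable (Function.uncurry F))
  (hG : Measurable (Function.uncurry G)) (hH : Measurable (Function.uncurry H))
include hU hR hF

theorem lintegral_superposition :
    ∫⁻ ω, ∫⁻ x, ∑' j, F (U j ω) (x j) ∂(Measure.infinitePi fun _ : ℕ => Q) ∂P =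
      ν * ∫⁻ u, ∫⁻ x, F u x ∂Q := by
  have hf : Measurable fun u => ∫⁻ x, F u x ∂Q := hF.lintegral_prod_right'
  simp_rw [fun ω => lintegral_tsum_eval Q (A := fun j => F (U j ω))
    (fun j => hF.comp measurable_prodMk_left)]
  rw [← hR.lintegral_linear (measurable_sum_dirac hU) hf]
  simp_rw [lintegral_sum_dirac _ hf]

include hG

/-- Integrating the marks first leaves sums over the immigrants, to which the Campbell formulas
apply. The diagonal term `ν ∫ f g` of the means occurs on both sides; `hfin` allows it to be
cancelled, and the mean of the product remains. -/
theorem lintegral_superposition_mul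
    (hfin : ∫⁻ u, (∫⁻ x, F u x ∂Q) * ∫⁻ x, G u x ∂Q ≠ ∞) :
    ∫⁻ ω, ∫⁻ x, (∑' j, F (U j ω) (x j)) * (∑' j, G (U j ω) (x j))
        ∂(Measure.infinitePi fun _ : ℕ => Q) ∂P =
      (ν * ∫⁻ u, ∫⁻ x, F u x ∂Q) * (ν * ∫⁻ u, ∫⁻ x, G u x ∂Q) +
        ν * ∫⁻ u, ∫⁻ x, F u x * G u x ∂Q := by
  have hN := measurable_sum_dirac hU
  have hf : Measurable fun u => ∫⁻ x, F u x ∂Q := hF.lintegral_prod_right'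
  have hg : Measurable fun u => ∫⁻ x, G u x ∂Q := hG.lintegral_prod_right'
  have hfg : Measurable fun u => ∫⁻ x, F u x * G u x ∂Q := (hF.mul hG).lintegral_prod_right'
  have key := lintegral_congr (μ := P) fun ω => lintegral_tsum_mul_tsum Q
    (A := fun j => F (U j ω)) (B := fun j => G (U j ω)) (fun j => hF.comp measurable_prodMk_left)
    (fun j => hG.comp measurable_prodMk_left)
  have s1 : ∀ (u : ℕ → ℝ) {a : ℝ → ℝ≥0∞}, Measurable a → ∑' j, a (u j) =
      ∫⁻ x, a x ∂(Measure.sum fun j : ℕ => Measure.dirac (u j)) := fun u a ha =>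
    (lintegral_sum_dirac u ha).symm
  simp_rw [fun u => s1 u hf, fun u => s1 u hg, fun u => s1 u hfg,
    fun u => s1 u (a := fun x => (∫⁻ y, F x y ∂Q) * ∫⁻ y, G x y ∂Q) (hf.mul hg)] at key
  rw [lintegral_add_right _ (measurable_lintegral_comp hN
      (f := fun x => (∫⁻ y, F x y ∂Q) * ∫⁻ y, G x y ∂Q) (hf.mul hg)),
    lintegral_add_right _ (measurable_lintegral_comp hN hfg), hR.lintegral_mul hN hf hg,
    hR.lintegral_linear hN hfg, hR.lintegral_linear hN (f := fun x => (∫⁻ y, F x y ∂Q) *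
      ∫⁻ y, G x y ∂Q) (hf.mul hg)] at key
  refine (ENNReal.add_left_inj (ENNReal.mul_ne_top ENNReal.coe_ne_top hfin)).1 (key.trans ?_)
  ring

include hH

/-- The same conditioning at third order. The integrability and boundedness hypotheses serve only to
make the terms which must be cancelled finite. -/
theorem lintegral_superposition_mul_mul {B : ℝ≥0∞} (hB : B ≠ ∞)
    (hf1 : ∫⁻ u, ∫⁻ x, F u x ∂Q ≠ ∞) (hg1 : ∫⁻ u, ∫⁻ x, G u x ∂Q ≠ ∞)
    (hh1 : ∫⁻ u, ∫⁻ x, H u x ∂Q ≠ ∞) (hg2 : ∀ u, ∫⁻ x, G u x ∂Q ≤ B)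
    (hh2 : ∀ u, ∫⁻ x, H u x ∂Q ≤ B) (hfg2 : ∀ u, ∫⁻ x, F u x * G u x ∂Q ≤ B)
    (hfh2 : ∀ u, ∫⁻ x, F u x * H u x ∂Q ≤ B) (hgh2 : ∀ u, ∫⁻ x, G u x * H u x ∂Q ≤ B) :
    ∫⁻ ω, ∫⁻ x, (∑' j, F (U j ω) (x j)) * (∑' j, G (U j ω) (x j)) * (∑' j, H (U j ω) (x j))
        ∂(Measure.infinitePi fun _ : ℕ => Q) ∂P =
      (ν * ∫⁻ u, ∫⁻ x, F u x ∂Q) * (ν * ∫⁻ u, ∫⁻ x, G u x ∂Q) * (ν * ∫⁻ u, ∫⁻ x, H u x ∂Q) +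
        ((ν * ∫⁻ u, ∫⁻ x, F u x * G u x ∂Q) * (ν * ∫⁻ u, ∫⁻ x, H u x ∂Q) +
        (ν * ∫⁻ u, ∫⁻ x, F u x * H u x ∂Q) * (ν * ∫⁻ u, ∫⁻ x, G u x ∂Q) +
        (ν * ∫⁻ u, ∫⁻ x, G u x * H u x ∂Q) * (ν * ∫⁻ u, ∫⁻ x, F u x ∂Q)) +
        ν * ∫⁻ u, ∫⁻ x, F u x * G u x * H u x ∂Q := by
  have hN := measurable_sum_dirac hU
  have key := lintegral_congr (μ := P) fun ω => lintegral_tsum_mul_tsum_mul_tsum Q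
    (A := fun j => F (U j ω)) (B := fun j => G (U j ω)) (C := fun j => H (U j ω))
    (fun j => hF.comp measurable_prodMk_left) (fun j => hG.comp measurable_prodMk_left)
    (fun j => hH.comp measurable_prodMk_left)
  obtain ⟨f, ef⟩ : ∃ f : ℝ → ℝ≥0∞, ∀ u, ∫⁻ x, F u x ∂Q = f u := ⟨_, fun _ => rfl⟩
  obtain ⟨g, eg⟩ : ∃ f : ℝ → ℝ≥0∞, ∀ u, ∫⁻ x, G u x ∂Q = f u := ⟨_, fun _ => rfl⟩
  obtain ⟨h, eh⟩ : ∃ f : ℝ → ℝ≥0∞, ∀ u, ∫⁻ x, H u x ∂Q = f u := ⟨_, fun _ => rfl⟩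
  obtain ⟨fg, efg⟩ : ∃ f : ℝ → ℝ≥0∞, ∀ u, ∫⁻ x, F u x * G u x ∂Q = f u := ⟨_, fun _ => rfl⟩
  obtain ⟨fh, efh⟩ : ∃ f : ℝ → ℝ≥0∞, ∀ u, ∫⁻ x, F u x * H u x ∂Q = f u := ⟨_, fun _ => rfl⟩
  obtain ⟨gh, egh⟩ : ∃ f : ℝ → ℝ≥0∞, ∀ u, ∫⁻ x, G u x * H u x ∂Q = f u := ⟨_, fun _ => rfl⟩
  obtain ⟨fgh, efgh⟩ : ∃ f : ℝ → ℝ≥0∞, ∀ u, ∫⁻ x, F u x * G u x * H u x ∂Q = f u :=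
    ⟨_, fun _ => rfl⟩
  have mf : Measurable f := by
    rw [← funext ef]; exact hF.lintegral_prod_right'
  have mg : Measurable g := by
    rw [← funext eg]; exact hG.lintegral_prod_right'
  have mh : Measurable h := by
    rw [← funext eh]; exact hH.lintegral_prod_right'
  have mfg : Measurable fg := by
    rw [← funext efg]; exact (hF.mul hG).lintegral_prod_right'
  have mfh : Measurable fh := by
    rw [← funext efh]; exact (hF.mul hH).lintegral_prod_right'
  have mgh : Measurable gh := by
    rw [← funext egh]; exact (hG.mul hH).lintegral_prod_right'
  have mfgh : Measurable fgh := by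
    rw [← funext efgh]; exact ((hF.mul hG).mul hH).lintegral_prod_right'
  simp_rw [ef, eg, eh, efg, efh, egh, efgh] at *
  have bd : ∀ {a b : ℝ → ℝ≥0∞}, ∫⁻ u, a u ≠ ∞ → (∀ u, b u ≤ B) → ∫⁻ u, a u * b u ≠ ∞ := by
    intro a b ha hb
    refine ne_top_of_le_ne_top (ENNReal.mul_ne_top ha hB) ?_
    rw [← lintegral_mul_const' _ _ hB]
    exact lintegral_mono fun u => mul_le_mul_right (hb u) _
  have swap : ∀ (a b : ℝ → ℝ≥0∞), ∫⁻ u, a u * b u = ∫⁻ u, b u * a u := fun a b =>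
    lintegral_congr fun u => mul_comm _ _
  have I1 := bd hf1 hg2
  have I2 := bd hf1 hh2
  have I3 := bd hg1 hh2
  have I4 := bd (a := fun u => f u * g u) I1 hh2
  have I5 := (swap fg h).trans_ne (bd hh1 hfg2)
  have I6 := (swap fh g).trans_ne (bd hg1 hfh2)
  have I7 := (swap gh f).trans_ne (bd hf1 hgh2)
  have s1 : ∀ (u : ℕ → ℝ) {a : ℝ → ℝ≥0∞}, Measurable a → ∑' j, a (u j) =
      ∫⁻ x, a x ∂(Measure.sum fun j : ℕ => Measure.dirac (u j)) := fun u a ha =>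
    (lintegral_sum_dirac u ha).symm
  simp_rw [s1 _ mf, s1 _ mg, s1 _ mh, s1 _ mfg, s1 _ mfh, s1 _ mgh,
    fun u => s1 u (a := fun x => f x * g x) (by fun_prop),
    fun u => s1 u (a := fun x => f x * h x) (by fun_prop),
    fun u => s1 u (a := fun x => g x * h x) (by fun_prop),
    fun u => s1 u (a := fun x => fg x * h x + fh x * g x + gh x * f x) (by fun_prop),
    fun u => s1 u (a := fun x => fgh x + 2 * (f x * g x * h x)) (by fun_prop)] at key
  have M : ∀ {a : ℝ → ℝ≥0∞}, Measurable a → Measurable fun ω =>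
      ∫⁻ x, a x ∂(Measure.sum fun j : ℕ => Measure.dirac (U j ω)) := fun ha =>
    measurable_lintegral_comp hN ha
  have Mfg := M (a := fun x => f x * g x) (by fun_prop)
  have Mfh := M (a := fun x => f x * h x) (by fun_prop)
  have Mgh := M (a := fun x => g x * h x) (by fun_prop)
  have M4 := M (a := fun x => fg x * h x + fh x * g x + gh x * f x) (by fun_prop)
  have M5 := M (a := fun x => fgh x + 2 * (f x * g x * h x)) (by fun_prop)
  have Mf := M mf
  have Mg := M mg
  have Mh := M mh
  have Mfg' := M mfg
  have Mfh' := M mfh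
  have Mgh' := M mgh
  rw [lintegral_add_right _ (by fun_prop), lintegral_add_right _ M4,
    lintegral_add_right _ (by fun_prop), lintegral_add_right _ (by fun_prop),
    lintegral_add_right _ M5, lintegral_add_right _ (by fun_prop),
    lintegral_add_right _ (by fun_prop), lintegral_add_right _ (by fun_prop),
    hR.lintegral_mul hN (f := fun x => f x * g x) (by fun_prop) mh,
    hR.lintegral_mul hN (f := fun x => f x * h x) (by fun_prop) mg,
    hR.lintegral_mul hN (f := fun x => g x * h x) (by fun_prop) mf,
    hR.lintegral_mul hN mfg mh, hR.lintegral_mul hN mfh mg, hR.lintegral_mul hN mgh mf,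
    hR.lintegral_mul_mul hN mf mg mh,
    hR.lintegral_linear hN (f := fun x => fg x * h x + fh x * g x + gh x * f x) (by fun_prop),
    hR.lintegral_linear hN (f := fun x => fgh x + 2 * (f x * g x * h x)) (by fun_prop),
    lintegral_add_right _ (by fun_prop), lintegral_add_right _ (by fun_prop),
    lintegral_add_right _ (by fun_prop), lintegral_const_mul _ (by fun_prop)] at key
  have p1 : ∫⁻ u, f u * h u * g u = ∫⁻ u, f u * g u * h u := lintegral_congr fun u => by ring
  have p2 : ∫⁻ u, g u * h u * f u = ∫⁻ u, f u * g u * h u := lintegral_congr fun u => by ring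
  rw [p1, p2] at key
  have c : ∀ {x : ℝ≥0∞}, x ≠ ∞ → ν * x ≠ ∞ := fun hx => ENNReal.mul_ne_top ENNReal.coe_ne_top hx
  -- All the terms common to both sides. The coefficient `3` arises because each of the three
  -- pairings produces `ν ∫ f g h` once through the second-order Campbell formula.
  have fin := ENNReal.add_ne_top.2 ⟨ENNReal.add_ne_top.2 ⟨ENNReal.add_ne_top.2
    ⟨ENNReal.mul_ne_top (c I1) (c hh1), ENNReal.mul_ne_top (c I2) (c hg1)⟩,
    ENNReal.mul_ne_top (c I3) (c hf1)⟩, ENNReal.add_ne_top.2 ⟨ENNReal.mul_ne_top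
    (show (3 : ℝ≥0∞) ≠ ∞ by simp) (c I4), ENNReal.add_ne_top.2 ⟨ENNReal.add_ne_top.2
    ⟨c I5, c I6⟩, c I7⟩⟩⟩
  refine (ENNReal.add_left_inj fin).1 (Eq.trans ?_ (key.trans ?_))
  · ring
  · ring

end Superposition

/-! ### The law of the marks of one cluster -/

/-- The marks (number of children, displacement) of all potential individuals of a cluster. -/
abbrev Marks : Type := List ℕ → ℕ × ℝ

/-- The displacement law. -/
noncomputable def delayLaw (h : ℝ → ℝ) : Measure ℝ :=
  volume.withDensity fun x => ENNReal.ofReal (h x)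

theorem IsDelayDensity.isProbabilityMeasure {h : ℝ → ℝ} (hh : IsDelayDensity h) :
    IsProbabilityMeasure (delayLaw h) :=
  ⟨by rw [delayLaw, withDensity_apply _ MeasurableSet.univ, setLIntegral_univ,
    hh.lintegral_eq_one]⟩

/-- The descendants of the `j`-th child of the root. -/
def subMarks (j : ℕ) (ξ : Marks) : Marks := fun w => ξ (j :: w)

/-- The marks of a cluster from those of the root and those of the families of its children. -/
def glueMarks (p : (ℕ × ℝ) × (ℕ → Marks)) : Marks
  | [] => p.1
  | j :: w => p.2 j w

theorem measurable_subMarks (j : ℕ) : Measurable (subMarks j) :=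
  measurable_pi_lambda _ fun w => measurable_pi_apply (j :: w)

theorem measurable_glueMarks : Measurable glueMarks :=
  measurable_pi_lambda _ fun w => match w with
    | [] => measurable_fst
    | j :: w => (measurable_pi_apply (X := fun _ : List ℕ => ℕ × ℝ) w).comp
        ((measurable_pi_apply (X := fun _ : ℕ => Marks) j).comp measurable_snd)

/-- The mark law, for a general displacement law `D`. -/
noncomputable def markLaw (m : ℝ≥0) (D : Measure ℝ) : Measure (ℕ × ℝ) := (poissonMeasure m).prod D

/-- The law of the marks of one cluster. -/
noncomputable def treeLaw (m : ℝ≥0) (D : Measure ℝ) : Measure Marks :=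
  Measure.infinitePi fun _ : List ℕ => markLaw m D

section TreeLaw

variable (m : ℝ≥0) (D : Measure ℝ) [IsProbabilityMeasure D]

instance : IsProbabilityMeasure (markLaw m D) := by unfold markLaw; infer_instance

instance : IsProbabilityMeasure (treeLaw m D) := by unfold treeLaw; infer_instance

/-- A finite set of words consists of possibly the root and of words `j :: w`, so the measure of a
cylinder splits accordingly; cylinders determine an infinite product. -/
theorem map_glueMarks :
    ((markLaw m D).prod (Measure.infinitePi fun _ : ℕ => treeLaw m D)).map glueMarks =
      treeLaw m D := by
  refine Measure.eq_infinitePi _ fun s t ht => ?_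
  rw [Measure.map_apply measurable_glueMarks
    (MeasurableSet.pi s.countable_toSet fun i _ => ht i)]
  have inj : Function.Injective fun p : ℕ × List ℕ => p.1 :: p.2 := fun p q hpq => by
    simpa [Prod.ext_iff] using hpq
  set s₁ : Finset (ℕ × List ℕ) := s.preimage (fun p => p.1 :: p.2) inj.injOn with hs₁
  have e : glueMarks ⁻¹' (s : Set (List ℕ)).pi t =
      {k | [] ∈ s → k ∈ t []} ×ˢ {x : ℕ → Marks | ∀ p ∈ s₁, x p.1 p.2 ∈ t (p.1 :: p.2)} := by
    ext ⟨k, x⟩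
    simp only [mem_preimage, Set.mem_pi, Finset.mem_coe, mem_prod, mem_ofPred_eq]
    constructor
    · intro H
      exact ⟨fun h0 => H [] h0, fun p hp => H (p.1 :: p.2) (by simpa [hs₁] using hp)⟩
    · rintro ⟨H1, H2⟩ w hw
      cases w with
      | nil => exact H1 hw
      | cons j w => exact H2 (j, w) (by simpa [hs₁] using hw)
  have e2 : (Measure.infinitePi fun _ : ℕ => treeLaw m D)
      {x : ℕ → Marks | ∀ p ∈ s₁, x p.1 p.2 ∈ t (p.1 :: p.2)} =
      ∏ p ∈ s₁, markLaw m D (t (p.1 :: p.2)) := by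
    -- Currying identifies the product of the family laws with one product over `ℕ × List ℕ`, where
    -- cylinders have an explicit measure.
    have h1 := Measure.infinitePi_map_curry (fun (_ : ℕ) (_ : List ℕ) => markLaw m D)
    unfold treeLaw
    rw [← h1, (MeasurableEquiv.curry ℕ (List ℕ) (ℕ × ℝ)).map_apply]
    exact Measure.infinitePi_pi (μ := fun _ : ℕ × List ℕ => markLaw m D) (s := s₁)
      (t := fun p => t (p.1 :: p.2)) fun p _ => ht _
  have e3 : markLaw m D {k | [] ∈ s → k ∈ t []} =
      if [] ∈ s then markLaw m D (t []) else 1 := by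
    split_ifs with h0 <;> simp [h0]
  rw [e, Measure.prod_prod, e2, e3]
  have e4 := Finset.prod_preimage (fun p : ℕ × List ℕ => p.1 :: p.2) s inj.injOn
    (fun w => if w = [] then 1 else markLaw m D (t w)) fun w _ hw => by
      cases w with
      | nil => simp
      | cons j w => exact absurd ⟨(j, w), rfl⟩ hw
  simp only [reduceCtorEq, if_false] at e4
  have e5 : ∏ w ∈ s, markLaw m D (t w) = ∏ w ∈ s, ((if w = [] then markLaw m D (t w) else 1) *
      if w = [] then 1 else markLaw m D (t w)) :=
    Finset.prod_congr rfl fun w _ => by by_cases hw : w = [] <;> simp [hw]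
  rw [e4, e5, Finset.prod_mul_distrib, Finset.prod_ite_eq' s [] fun w => markLaw m D (t w)]

/-- The branching property: the families of the children are independent copies of the whole,
independent of the root. Splitting undoes `glueMarks` definitionally. -/
theorem map_root_subMarks : (treeLaw m D).map (fun ξ => (ξ [], fun j => subMarks j ξ)) =
    (markLaw m D).prod (Measure.infinitePi fun _ : ℕ => treeLaw m D) := by
  conv_lhs => rw [← map_glueMarks, Measure.map_map ((measurable_pi_apply _).prodMk
    (measurable_pi_lambda _ measurable_subMarks)) measurable_glueMarks]
  exact Measure.map_id

variable {m D}

theorem measurePreserving_root_subMarks :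
    MeasurePreserving (fun ξ : Marks => (ξ [], fun j => subMarks j ξ)) (treeLaw m D)
      ((markLaw m D).prod (Measure.infinitePi fun _ : ℕ => treeLaw m D)) :=
  ⟨(measurable_pi_apply _).prodMk (measurable_pi_lambda _ measurable_subMarks),
    map_root_subMarks m D⟩

end TreeLaw

/-! ### Sums over the individuals of a cluster -/

/-- Sums over individuals split by the first letter of the word, which matches the branching
property. -/
theorem tsum_list (f : List ℕ → ℝ≥0∞) : ∑' v, f v = f [] + ∑' j, ∑' w, f (j :: w) := by
  classical
  have inj : Function.Injective fun p : ℕ × List ℕ => p.1 :: p.2 := fun p q hpq => by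
    simpa [Prod.ext_iff] using hpq
  have e : ∀ v, f v = (if v = [] then f [] else 0) + if v = [] then 0 else f v := fun v => by
    by_cases h : v = [] <;> simp [h]
  rw [tsum_congr e, ENNReal.tsum_add, tsum_ite_eq, ← ENNReal.tsum_prod]
  congr 1
  rw [← inj.tsum_eq (f := fun v => if v = [] then 0 else f v)]
  · simp
  · intro v hv
    cases v with
    | nil => simp at hv
    | cons j w => exact ⟨(j, w), rfl⟩

/-- The individual `v` belongs to the cluster with marks `ξ`. -/
def Alive (ξ : Marks) (v : List ℕ) : Prop := InTree (fun u => (ξ u).1) v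

/-- The position of the individual `v` relative to the root. -/
noncomputable def pos (ξ : Marks) (v : List ℕ) : ℝ := position (fun u => (ξ u).2) v

theorem alive_nil (ξ : Marks) : Alive ξ [] := trivial

theorem alive_cons (ξ : Marks) (j : ℕ) (w : List ℕ) :
    Alive ξ (j :: w) ↔ j < (ξ []).1 ∧ Alive (subMarks j ξ) w := Iff.rfl

@[simp] theorem pos_nil (ξ : Marks) : pos ξ [] = 0 := rfl

theorem pos_cons (ξ : Marks) (j : ℕ) (w : List ℕ) :
    pos ξ (j :: w) = (subMarks j ξ []).2 + pos (subMarks j ξ) w := rfl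

theorem measurableSet_alive (v : List ℕ) : MeasurableSet {ξ | Alive ξ v} := by
  induction v with
  | nil => simp [alive_nil]
  | cons j w ih =>
    have : {ξ : Marks | Alive ξ (j :: w)} =
        {ξ | j < (ξ []).1} ∩ subMarks j ⁻¹' {ξ | Alive ξ w} := rfl
    rw [this]
    refine MeasurableSet.inter ?_ (measurable_subMarks j ih)
    exact measurableSet_lt measurable_const (measurable_fst.comp (measurable_pi_apply []))

theorem measurable_pos (v : List ℕ) : Measurable fun ξ => pos ξ v := by
  induction v with
  | nil => exact measurable_const
  | cons j w ih =>
    simp_rw [pos_cons]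
    exact (measurable_snd.comp ((measurable_pi_apply []).comp (measurable_subMarks j))).add
      (ih.comp (measurable_subMarks j))

open Classical in
/-- The indicator that `v` belongs to the cluster. -/
noncomputable def aliveInd (ξ : Marks) (v : List ℕ) : ℝ≥0∞ := if Alive ξ v then 1 else 0

theorem measurable_aliveInd (v : List ℕ) : Measurable fun ξ => aliveInd ξ v :=
  Measurable.ite (measurableSet_alive v) measurable_const measurable_const

theorem aliveInd_nil (ξ : Marks) : aliveInd ξ [] = 1 := by simp [aliveInd, alive_nil]

theorem aliveInd_cons (ξ : Marks) (j : ℕ) (w : List ℕ) :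
    aliveInd ξ (j :: w) = if j < (ξ []).1 then aliveInd (subMarks j ξ) w else 0 := by
  by_cases h : j < (ξ []).1
  · by_cases h2 : Alive (subMarks j ξ) w
    · rw [if_pos h, aliveInd, aliveInd, if_pos h2, if_pos ((alive_cons ξ j w).2 ⟨h, h2⟩)]
    · rw [if_pos h, aliveInd, aliveInd, if_neg h2, if_neg fun h' => h2 ((alive_cons ξ j w).1 h').2]
  · rw [if_neg h, aliveInd, if_neg fun h' => h ((alive_cons ξ j w).1 h').1]

theorem lintegral_cluster (ξ : Marks) {f : ℝ → ℝ≥0∞} (hf : Measurable f) :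
    ∫⁻ x, f x ∂(cluster ξ) = ∑' v, aliveInd ξ v * f (pos ξ v) := by
  rw [cluster, lintegral_sum_measure]
  refine tsum_congr fun v => ?_
  by_cases h : InTree (fun u => (ξ u).1) v
  · rw [if_pos h, lintegral_dirac' _ hf, aliveInd, if_pos (show Alive ξ v from h), one_mul]
    rfl
  · rw [if_neg h, aliveInd, if_neg (show ¬Alive ξ v from h)]
    simp

/-- The total size of the cluster. -/
noncomputable def size (ξ : Marks) : ℝ≥0∞ := ∑' v, aliveInd ξ v

/-- The size of the first `n` generations of descendants. -/
noncomputable def sizeLE (n : ℕ) (ξ : Marks) : ℝ≥0∞ :=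
  ∑' v, if v.length ≤ n then aliveInd ξ v else 0

theorem measurable_size : Measurable size := Measurable.tsum measurable_aliveInd

theorem measurable_sizeLE (n : ℕ) : Measurable (sizeLE n) := Measurable.tsum fun v => by
  split_ifs
  · exact measurable_aliveInd v
  · exact measurable_const

theorem sizeLE_zero (ξ : Marks) : sizeLE 0 ξ = 1 := by
  rw [sizeLE, tsum_list]
  simp [aliveInd_nil]

theorem sizeLE_succ (n : ℕ) (ξ : Marks) :
    sizeLE (n + 1) ξ = 1 + ∑' j, if j < (ξ []).1 then sizeLE n (subMarks j ξ) else 0 := by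
  rw [sizeLE, tsum_list]
  congr 1
  · simp [aliveInd_nil]
  · refine tsum_congr fun j => ?_
    by_cases h : j < (ξ []).1 <;> simp [aliveInd_cons, h, sizeLE]

theorem monotone_sizeLE (ξ : Marks) : Monotone fun n => sizeLE n ξ := fun a b hab =>
  ENNReal.tsum_le_tsum fun v => by
    by_cases h : v.length ≤ a
    · simp [h, h.trans hab]
    · simp [h]

theorem iSup_sizeLE (ξ : Marks) : ⨆ n, sizeLE n ξ = size ξ := by
  refine le_antisymm (iSup_le fun n => ENNReal.tsum_le_tsum fun v => ?_) ?_
  · split_ifs <;> simp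
  · rw [size, ENNReal.tsum_eq_iSup_sum]
    refine iSup_le fun s => le_iSup_of_le (s.sup List.length) ?_
    refine le_trans (Finset.sum_le_sum fun v hv => ?_) (ENNReal.sum_le_tsum s)
    rw [if_pos (Finset.le_sup (f := List.length) hv)]

section Children

variable {m : ℝ≥0} {D : Measure ℝ} [IsProbabilityMeasure D] {a b c : Marks → ℝ≥0∞}

/-- The sum of `a` over the families of the children of the root. -/
noncomputable def childSum (a : Marks → ℝ≥0∞) (ξ : Marks) : ℝ≥0∞ :=
  ∑' j, if j < (ξ []).1 then a (subMarks j ξ) else 0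

theorem lintegral_root_subMarks {Φ : (ℕ × ℝ) × (ℕ → Marks) → ℝ≥0∞} (hΦ : Measurable Φ) :
    ∫⁻ ξ, Φ (ξ [], fun j => subMarks j ξ) ∂(treeLaw m D) =
      ∫⁻ k, ∫⁻ d, ∫⁻ x, Φ ((k, d), x) ∂(Measure.infinitePi fun _ : ℕ => treeLaw m D) ∂D
        ∂(poissonMeasure m) := by
  rw [measurePreserving_root_subMarks.lintegral_comp hΦ, lintegral_prod _ hΦ.aemeasurable, markLaw,
    lintegral_prod _ (Measurable.aemeasurable (by fun_prop))]

theorem measurable_ite_lt {a : Marks → ℝ≥0∞} (ha : Measurable a) (j : ℕ) :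
    Measurable fun p : (ℕ × ℝ) × (ℕ → Marks) => if j < p.1.1 then a (p.2 j) else 0 :=
  Measurable.ite (measurableSet_lt measurable_const (by fun_prop)) (by fun_prop) measurable_const

theorem measurable_childSum (ha : Measurable a) : Measurable (childSum a) :=
  (Measurable.tsum (measurable_ite_lt ha)).comp
    (measurePreserving_root_subMarks (m := 0) (D := Measure.dirac 0)).measurable

theorem tsum_ite_lt (k : ℕ) (x : ℝ≥0∞) : ∑' j, (if j < k then x else 0) = k * x := by
  rw [tsum_eq_sum (s := Finset.range k) fun j hj => if_neg (by simpa using hj)]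
  rw [Finset.sum_congr rfl fun j hj => if_pos (Finset.mem_range.1 hj)]
  simp

theorem lintegral_childSum (ha : Measurable a) :
    ∫⁻ ξ, childSum a ξ ∂(treeLaw m D) = m * ∫⁻ ξ, a ξ ∂(treeLaw m D) := by
  refine (lintegral_root_subMarks (Φ := fun p => ∑' j, if j < p.1.1 then a (p.2 j) else 0)
    (Measurable.tsum (measurable_ite_lt ha))).trans ?_
  simp only [lintegral_const, measure_univ, mul_one]
  rw [← lintegral_poisson_one m, ← lintegral_mul_const _ (by fun_prop)]
  refine lintegral_congr fun k => ?_
  rw [lintegral_tsum_eval (treeLaw m D) (A := fun j x => if j < k then a x else 0)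
    (fun j => by split_ifs <;> fun_prop), ← tsum_ite_lt]
  refine tsum_congr fun j => ?_
  split_ifs <;> simp

/-- Distinct children contribute through the Poisson factorial moment `E K(K-1) = m²`, equal ones
through `E K = m`. Finiteness of the mean is needed to cancel the diagonal correction. -/
theorem lintegral_childSum_sq (ha : Measurable a) (hfin : ∫⁻ ξ, a ξ ∂(treeLaw m D) ≠ ∞) :
    ∫⁻ ξ, childSum a ξ * childSum a ξ ∂(treeLaw m D) =
      m * m * ((∫⁻ ξ, a ξ ∂(treeLaw m D)) * ∫⁻ ξ, a ξ ∂(treeLaw m D)) +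
        m * ∫⁻ ξ, a ξ * a ξ ∂(treeLaw m D) := by
  have hM : Measurable fun p : (ℕ × ℝ) × (ℕ → Marks) => ∑' j, if j < p.1.1 then a (p.2 j) else 0 :=
    Measurable.tsum (measurable_ite_lt ha)
  rw [show ∫⁻ ξ, childSum a ξ * childSum a ξ ∂(treeLaw m D) = _ from
    lintegral_root_subMarks (Φ := fun p => (∑' j, if j < p.1.1 then a (p.2 j) else 0) *
    ∑' j, if j < p.1.1 then a (p.2 j) else 0) (hM.mul hM)]
  simp only [lintegral_const, measure_univ, mul_one]
  have key := lintegral_congr (μ := poissonMeasure m) fun k => lintegral_tsum_mul_tsum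
    (treeLaw m D) (A := fun j x => if j < k then a x else 0)
    (B := fun j x => if j < k then a x else 0) (fun j => by split_ifs <;> fun_prop)
    (fun j => by split_ifs <;> fun_prop)
  have i1 : ∀ (c : Marks → ℝ≥0∞) (k j : ℕ), ∫⁻ x, (if j < k then c x else 0) ∂(treeLaw m D) =
      if j < k then ∫⁻ x, c x ∂(treeLaw m D) else 0 := fun c k j => by split_ifs <;> simp
  have i2 : ∀ (k j : ℕ) (x y : ℝ≥0∞), (if j < k then x else 0) * (if j < k then y else 0) =
      if j < k then x * y else 0 := fun k j x y => by split_ifs <;> simp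
  simp only [i2, i1, tsum_ite_lt] at key
  rw [lintegral_add_right _ (by fun_prop), lintegral_add_right _ (by fun_prop),
    lintegral_mul_const _ (by fun_prop), lintegral_mul_const _ (by fun_prop)] at key
  simp_rw [mul_mul_mul_comm] at key
  rw [lintegral_mul_const _ (by fun_prop), lintegral_poisson_one, lintegral_poisson_sq] at key
  refine (ENNReal.add_left_inj (ENNReal.mul_ne_top ENNReal.coe_ne_top
    (ENNReal.mul_ne_top hfin hfin))).1 (key.trans ?_)
  ring

theorem lintegral_childSum_cube (ha : Measurable a) (hfin : ∫⁻ ξ, a ξ ∂(treeLaw m D) ≠ ∞)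
    (hfin2 : ∫⁻ ξ, a ξ * a ξ ∂(treeLaw m D) ≠ ∞) :
    ∫⁻ ξ, childSum a ξ * childSum a ξ * childSum a ξ ∂(treeLaw m D) =
      m * m * m * ((∫⁻ ξ, a ξ ∂(treeLaw m D)) * (∫⁻ ξ, a ξ ∂(treeLaw m D)) *
        ∫⁻ ξ, a ξ ∂(treeLaw m D)) + 3 * (m * m) *
        ((∫⁻ ξ, a ξ * a ξ ∂(treeLaw m D)) * ∫⁻ ξ, a ξ ∂(treeLaw m D)) +
        m * ∫⁻ ξ, a ξ * a ξ * a ξ ∂(treeLaw m D) := by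
  have hM : Measurable fun p : (ℕ × ℝ) × (ℕ → Marks) => ∑' j, if j < p.1.1 then a (p.2 j) else 0 :=
    Measurable.tsum (measurable_ite_lt ha)
  rw [show ∫⁻ ξ, childSum a ξ * childSum a ξ * childSum a ξ ∂(treeLaw m D) = _ from
    lintegral_root_subMarks (Φ := fun p => (∑' j, if j < p.1.1 then a (p.2 j) else 0) *
    (∑' j, if j < p.1.1 then a (p.2 j) else 0) * ∑' j, if j < p.1.1 then a (p.2 j) else 0)
    ((hM.mul hM).mul hM)]
  simp only [lintegral_const, measure_univ, mul_one]
  have key := lintegral_congr (μ := poissonMeasure m) fun k => lintegral_tsum_mul_tsum_mul_tsum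
    (treeLaw m D) (A := fun j x => if j < k then a x else 0)
    (B := fun j x => if j < k then a x else 0) (C := fun j x => if j < k then a x else 0)
    (fun j => by split_ifs <;> fun_prop) (fun j => by split_ifs <;> fun_prop)
    (fun j => by split_ifs <;> fun_prop)
  have i1 : ∀ (c : Marks → ℝ≥0∞) (k j : ℕ), ∫⁻ x, (if j < k then c x else 0) ∂(treeLaw m D) =
      if j < k then ∫⁻ x, c x ∂(treeLaw m D) else 0 := fun c k j => by split_ifs <;> simp
  have i2 : ∀ (k j : ℕ) (x y : ℝ≥0∞), (if j < k then x else 0) * (if j < k then y else 0) =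
      if j < k then x * y else 0 := fun k j x y => by split_ifs <;> simp
  simp only [i2, i1, ENNReal.tsum_add, ENNReal.tsum_mul_left, tsum_ite_lt] at key
  generalize ∫⁻ ξ, a ξ * a ξ * a ξ ∂(treeLaw m D) = γ at *
  generalize ∫⁻ ξ, a ξ * a ξ ∂(treeLaw m D) = β at *
  generalize ∫⁻ ξ, a ξ ∂(treeLaw m D) = α at *
  have r1 : ∀ k : ℝ≥0∞, k * (α * α) * (k * α) + k * (α * α) * (k * α) + k * (α * α) * (k * α) +
      (k * (β * α) + k * (β * α) + k * (β * α)) =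
      k * k * (3 * (α * α * α)) + k * (3 * (β * α)) := fun k => by ring
  have r2 : ∀ k : ℝ≥0∞, k * α * (k * α) * (k * α) +
      (k * β * (k * α) + k * β * (k * α) + k * β * (k * α)) +
      (k * γ + 2 * (k * (α * α * α))) =
      k * (k * k) * (α * α * α) + k * k * (3 * (β * α)) + k * (γ + 2 * (α * α * α)) :=
    fun k => by ring
  simp_rw [r1, r2] at key
  rw [lintegral_add_right _ (by fun_prop), lintegral_add_right _ (by fun_prop),
    lintegral_add_right _ (by fun_prop), lintegral_add_right _ (by fun_prop),
    lintegral_mul_const _ (by fun_prop), lintegral_mul_const _ (by fun_prop),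
    lintegral_mul_const _ (by fun_prop), lintegral_mul_const _ (by fun_prop),
    lintegral_mul_const _ (by fun_prop), lintegral_poisson_one, lintegral_poisson_sq,
    lintegral_poisson_cube] at key
  have fin : ((m : ℝ≥0∞) * m + m) * (3 * (α * α * α)) + m * (3 * (β * α)) ≠ ∞ := by
    finiteness
  refine (ENNReal.add_left_inj fin).1 (key.trans ?_)
  ring

end Children

/-! ### Moments of the cluster size -/

/-- The bound is the fixed point of `x ↦ A + m x`. -/
theorem le_of_affine_recursion {x : ℕ → ℝ≥0∞} {A m : ℝ≥0} (hm : m < 1) (h0 : x 0 ≤ A)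
    (h : ∀ n, x (n + 1) ≤ A + m * x n) (n : ℕ) : x n ≤ ((A / (1 - m) : ℝ≥0) : ℝ≥0∞) := by
  have hm' : (0 : ℝ) < 1 - m := by
    have : (m : ℝ) < 1 := by exact_mod_cast hm
    linarith
  have e : A + m * (A / (1 - m)) = A / (1 - m) := by
    rw [← NNReal.coe_inj]
    push_cast [NNReal.coe_sub hm.le]
    field_simp
    ring
  induction n with
  | zero =>
    refine h0.trans (ENNReal.coe_le_coe.2 ?_)
    rw [← e]
    exact le_self_add
  | succ n ih =>
    refine (h n).trans ?_
    rw [← e]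
    push_cast
    gcongr

section SizeMoments

variable {m : ℝ≥0} {D : Measure ℝ} [IsProbabilityMeasure D] (hm : m < 1)
include hm

/-- Expanding powers of `sizeLE (n + 1) = 1 + childSum (sizeLE n)`, the moment of a given order
reappears with coefficient `m` and everything else involves lower orders. The moments are therefore
bounded one order at a time. Working with truncated generations makes each bound available before
the next cancellation is made. -/
theorem exists_size_moment_bound : ∃ B : ℝ≥0, ∀ n,
    ∫⁻ ξ, sizeLE n ξ * sizeLE n ξ * sizeLE n ξ ∂(treeLaw m D) ≤ B := by
  have hm' : (m : ℝ≥0∞) ≤ 1 := by exact_mod_cast hm.le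
  have hS := fun n => measurable_sizeLE n
  have hY := fun n => measurable_childSum (hS n)
  have rec1 : ∀ n, ∀ ξ, sizeLE (n + 1) ξ = 1 + childSum (sizeLE n) ξ := sizeLE_succ
  obtain ⟨C₁, h1⟩ : ∃ C : ℝ≥0, ∀ n, ∫⁻ ξ, sizeLE n ξ ∂(treeLaw m D) ≤ C := by
    refine ⟨_, le_of_affine_recursion (A := 1) hm (by simp [sizeLE_zero]) fun n => ?_⟩
    simp_rw [rec1]
    rw [lintegral_add_left measurable_const, lintegral_childSum (hS n)]
    simp
  have f1 : ∀ n, ∫⁻ ξ, sizeLE n ξ ∂(treeLaw m D) ≠ ∞ := fun n =>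
    ne_top_of_le_ne_top ENNReal.coe_ne_top (h1 n)
  have hc1 : ∀ n, ∫⁻ ξ, childSum (sizeLE n) ξ ∂(treeLaw m D) ≤ C₁ := fun n => by
    rw [lintegral_childSum (hS n)]
    exact (mul_le_mul' hm' (h1 n)).trans (by rw [one_mul])
  obtain ⟨C₂, h2⟩ : ∃ C : ℝ≥0, ∀ n, ∫⁻ ξ, sizeLE n ξ * sizeLE n ξ ∂(treeLaw m D) ≤ C := by
    -- `A` bounds `1 + 2 E Y` and the off-diagonal part of `E Y²` for the child sum `Y`, with `m²`
    -- replaced by `1`.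
    refine ⟨_, le_of_affine_recursion (A := 1 + 2 * C₁ + C₁ * C₁) hm ?_ fun n => ?_⟩
    · simp [sizeLE_zero, add_assoc]
    · have : ∀ ξ, sizeLE (n + 1) ξ * sizeLE (n + 1) ξ = 1 + 2 * childSum (sizeLE n) ξ +
          childSum (sizeLE n) ξ * childSum (sizeLE n) ξ := fun ξ => by rw [rec1]; ring
      simp_rw [this]
      have := hY n
      rw [lintegral_add_left (by fun_prop), lintegral_add_left (by fun_prop),
        lintegral_const_mul _ (by fun_prop), lintegral_childSum_sq (hS n) (f1 n)]
      simp only [lintegral_const, measure_univ, mul_one]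
      rw [← add_assoc]
      push_cast
      have := h1 n
      have hmm : (m : ℝ≥0∞) * m ≤ 1 := mul_le_one' hm' hm'
      exact add_le_add (add_le_add (add_le_add le_rfl (mul_le_mul' le_rfl (hc1 n)))
        ((mul_le_mul' hmm (mul_le_mul' this this)).trans (by rw [one_mul]))) le_rfl
  have f2 : ∀ n, ∫⁻ ξ, sizeLE n ξ * sizeLE n ξ ∂(treeLaw m D) ≠ ∞ := fun n =>
    ne_top_of_le_ne_top ENNReal.coe_ne_top (h2 n)
  have hmm : (m : ℝ≥0∞) * m ≤ 1 := mul_le_one' hm' hm'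
  have hc2 : ∀ n, ∫⁻ ξ, childSum (sizeLE n) ξ * childSum (sizeLE n) ξ ∂(treeLaw m D) ≤
      C₁ * C₁ + C₂ := fun n => by
    rw [lintegral_childSum_sq (hS n) (f1 n)]
    exact add_le_add ((mul_le_mul' hmm (mul_le_mul' (h1 n) (h1 n))).trans (by rw [one_mul]))
      ((mul_le_mul' hm' (h2 n)).trans (by rw [one_mul]))
  refine ⟨_, le_of_affine_recursion
    (A := 1 + 3 * C₁ + 3 * (C₁ * C₁ + C₂) + (C₁ * C₁ * C₁ + 3 * (C₂ * C₁))) hm ?_ fun n => ?_⟩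
  · simp [sizeLE_zero, add_assoc]
  · have : ∀ ξ, sizeLE (n + 1) ξ * sizeLE (n + 1) ξ * sizeLE (n + 1) ξ =
        1 + 3 * childSum (sizeLE n) ξ + 3 * (childSum (sizeLE n) ξ * childSum (sizeLE n) ξ) +
        childSum (sizeLE n) ξ * childSum (sizeLE n) ξ * childSum (sizeLE n) ξ :=
      fun ξ => by rw [rec1]; ring
    simp_rw [this]
    have := hY n
    rw [lintegral_add_left (by fun_prop), lintegral_add_left (by fun_prop),
      lintegral_add_left (by fun_prop), lintegral_const_mul _ (by fun_prop),
      lintegral_const_mul _ (by fun_prop), lintegral_childSum_cube (hS n) (f1 n) (f2 n)]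
    simp only [lintegral_const, measure_univ, mul_one]
    rw [← add_assoc]
    push_cast
    refine add_le_add (add_le_add (add_le_add (add_le_add le_rfl (mul_le_mul' le_rfl (hc1 n)))
      (mul_le_mul' le_rfl (hc2 n))) (add_le_add ((mul_le_mul' (mul_le_one' hmm hm')
      (mul_le_mul' (mul_le_mul' (h1 n) (h1 n)) (h1 n))).trans (by rw [one_mul])) ?_)) le_rfl
    refine (mul_le_mul' (mul_le_mul' le_rfl hmm) (mul_le_mul' (h2 n) (h1 n))).trans ?_
    rw [mul_one]

theorem lintegral_size_cube_ne_top :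
    ∫⁻ ξ, size ξ * size ξ * size ξ ∂(treeLaw m D) ≠ ∞ := by
  obtain ⟨B, hB⟩ := exists_size_moment_bound (D := D) hm
  refine ne_top_of_le_ne_top (ENNReal.coe_ne_top (r := B)) ?_
  have hs := fun ξ => monotone_sizeLE ξ
  have e : ∀ ξ, size ξ * size ξ * size ξ = ⨆ n, sizeLE n ξ * sizeLE n ξ * sizeLE n ξ := fun ξ => by
    rw [← iSup_mul_iSup_of_monotone (fun _ _ h => mul_le_mul' (hs ξ h) (hs ξ h)) (hs ξ),
      ← iSup_mul_iSup_of_monotone (hs ξ) (hs ξ), iSup_sizeLE]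
  simp_rw [e]
  rw [lintegral_iSup (f := fun n ξ => sizeLE n ξ * sizeLE n ξ * sizeLE n ξ)
    (fun n => ((measurable_sizeLE n).mul (measurable_sizeLE n)).mul
    (measurable_sizeLE n)) fun a b h ξ => mul_le_mul' (mul_le_mul' (hs ξ h) (hs ξ h)) (hs ξ h)]
  exact iSup_le hB

omit hm in
theorem one_le_size (ξ : Marks) : 1 ≤ size ξ := by
  rw [size, ← aliveInd_nil ξ]
  exact ENNReal.le_tsum []

theorem lintegral_size_sq_ne_top : ∫⁻ ξ, size ξ * size ξ ∂(treeLaw m D) ≠ ∞ :=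
  ne_top_of_le_ne_top (lintegral_size_cube_ne_top hm) <| lintegral_mono fun ξ =>
    le_mul_of_one_le_right zero_le (one_le_size ξ)

theorem lintegral_size_ne_top : ∫⁻ ξ, size ξ ∂(treeLaw m D) ≠ ∞ :=
  ne_top_of_le_ne_top (lintegral_size_sq_ne_top hm) <| lintegral_mono fun ξ =>
    le_mul_of_one_le_right zero_le (one_le_size ξ)

end SizeMoments

/-! ### Sums over distinct individuals -/

section DistinctSums

variable {ι : Type*} [DecidableEq ι] (a b c : ι → ℝ≥0∞)

/-- The sum of `a v * b w` over ordered pairs of distinct indices. -/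
noncomputable def pairTsum : ℝ≥0∞ := ∑' v, ∑' w, if v ≠ w then a v * b w else 0

/-- The sum of `a v * b w * c r` over ordered triples of pairwise distinct indices. -/
noncomputable def tripleTsum : ℝ≥0∞ :=
  ∑' v, ∑' w, ∑' r, if v ≠ w ∧ v ≠ r ∧ w ≠ r then a v * b w * c r else 0

theorem tsum_mul_tsum_eq_pairTsum :
    (∑' v, a v) * (∑' v, b v) = pairTsum a b + ∑' v, a v * b v := by
  have e : ∑' v, a v * b v = ∑' v, ∑' w, if w = v then a v * b v else 0 :=
    tsum_congr fun v => by rw [tsum_ite_eq]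
  simp_rw [pairTsum, e, ← ENNReal.tsum_add, ← ENNReal.tsum_mul_left, ← ENNReal.tsum_mul_right]
  rw [ENNReal.tsum_comm]
  refine tsum_congr fun v => tsum_congr fun w => ?_
  by_cases h : w = v
  · subst h; simp
  · simp [h, Ne.symm h]

/-- Every triple of indices shows exactly one of the five coincidence patterns. -/
theorem tsum_mul_tsum_mul_tsum_eq_tripleTsum :
    (∑' v, a v) * (∑' v, b v) * (∑' v, c v) = tripleTsum a b c +
      (pairTsum (fun v => a v * b v) c + pairTsum (fun v => a v * c v) b +
        pairTsum (fun v => b v * c v) a) + ∑' v, a v * b v * c v := by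
  have e1 : pairTsum (fun v => a v * b v) c = ∑' v, ∑' w, ∑' r,
      if w = v then (if v ≠ r then a v * b v * c r else 0) else 0 := by
    refine tsum_congr fun v => ?_
    rw [ENNReal.tsum_comm]
    exact tsum_congr fun r => by rw [tsum_ite_eq]
  have e2 : pairTsum (fun v => a v * c v) b = ∑' v, ∑' w, ∑' r,
      if r = v then (if v ≠ w then a v * c v * b w else 0) else 0 :=
    tsum_congr fun v => tsum_congr fun w => by rw [tsum_ite_eq]
  have e3 : pairTsum (fun v => b v * c v) a = ∑' v, ∑' w, ∑' r,
      if r = w then (if w ≠ v then b w * c w * a v else 0) else 0 := by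
    rw [pairTsum, ENNReal.tsum_comm]
    exact tsum_congr fun v => tsum_congr fun w => by rw [tsum_ite_eq]
  have e4 : ∑' v, a v * b v * c v = ∑' v, ∑' w, ∑' r,
      if w = v then (if r = v then a v * b v * c v else 0) else 0 := by
    refine tsum_congr fun v => ?_
    rw [ENNReal.tsum_comm]
    simp_rw [tsum_ite_eq]
  have e5 : (∑' v, a v) * (∑' v, b v) * (∑' v, c v) = ∑' v, ∑' w, ∑' r, a v * b w * c r := by
    simp only [ENNReal.tsum_mul_left, ENNReal.tsum_mul_right]
  rw [e1, e2, e3, e4, e5, tripleTsum]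
  simp only [← ENNReal.tsum_add]
  refine tsum_congr fun v => tsum_congr fun w => tsum_congr fun r => ?_
  by_cases h1 : w = v
  · subst h1
    by_cases h2 : r = w
    · subst h2; simp
    · simp [h2, Ne.symm h2]
  · by_cases h2 : r = v
    · subst h2
      simp only [h1, Ne.symm h1, ne_eq, not_true_eq_false, not_false_eq_true, if_true, if_false,
        and_false, false_and, zero_add, add_zero]
      ring
    · by_cases h3 : r = w
      · subst h3
        simp only [h1, ne_eq, not_true_eq_false, not_false_eq_true, if_true, if_false,
          and_false, zero_add, add_zero]
        ring
      · simp [h1, h2, h3, Ne.symm h1, Ne.symm h2, Ne.symm h3]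

end DistinctSums

/-! ### Linear statistics of a cluster -/

/-- The sum of `f` over the points of the cluster translated by `u`. -/
noncomputable def clusterSum (f : ℝ → ℝ≥0∞) (u : ℝ) (ξ : Marks) : ℝ≥0∞ :=
  ∑' v, aliveInd ξ v * f (pos ξ v + u)

/-- The terms of `clusterSum`. -/
noncomputable def clusterTerm (f : ℝ → ℝ≥0∞) (u : ℝ) (ξ : Marks) (v : List ℕ) : ℝ≥0∞ :=
  aliveInd ξ v * f (pos ξ v + u)

theorem aliveInd_mul_self (ξ : Marks) (v : List ℕ) : aliveInd ξ v * aliveInd ξ v = aliveInd ξ v := by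
  unfold aliveInd
  split_ifs <;> simp

theorem clusterTerm_mul (f g : ℝ → ℝ≥0∞) (u : ℝ) (ξ : Marks) (v : List ℕ) :
    clusterTerm f u ξ v * clusterTerm g u ξ v = clusterTerm (fun x => f x * g x) u ξ v := by
  rw [clusterTerm, clusterTerm, mul_mul_mul_comm, aliveInd_mul_self]
  rfl

section Measurability

variable {f g k : ℝ → ℝ≥0∞} (hf : Measurable f) (hg : Measurable g) (hk : Measurable k)
include hf

theorem measurable_clusterTerm (v : List ℕ) :
    Measurable fun p : ℝ × Marks => clusterTerm f p.1 p.2 v :=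
  ((measurable_aliveInd v).comp measurable_snd).mul
    (hf.comp (((measurable_pos v).comp measurable_snd).add measurable_fst))

theorem measurable_clusterSum : Measurable fun p : ℝ × Marks => clusterSum f p.1 p.2 :=
  Measurable.tsum (measurable_clusterTerm hf)

include hg

theorem measurable_pairTsum_clusterTerm : Measurable fun p : ℝ × Marks =>
    pairTsum (clusterTerm f p.1 p.2) (clusterTerm g p.1 p.2) :=
  Measurable.tsum fun v => Measurable.tsum fun w => by
    split_ifs
    · exact (measurable_clusterTerm hf v).mul (measurable_clusterTerm hg w)
    · exact measurable_const

include hk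

theorem measurable_tripleTsum_clusterTerm : Measurable fun p : ℝ × Marks =>
    tripleTsum (clusterTerm f p.1 p.2) (clusterTerm g p.1 p.2) (clusterTerm k p.1 p.2) :=
  Measurable.tsum fun v => Measurable.tsum fun w => Measurable.tsum fun r => by
    split_ifs
    · exact ((measurable_clusterTerm hf v).mul (measurable_clusterTerm hg w)).mul
        (measurable_clusterTerm hk r)
    · exact measurable_const

end Measurability

theorem clusterSum_mul (f g : ℝ → ℝ≥0∞) (u : ℝ) (ξ : Marks) :
    clusterSum f u ξ * clusterSum g u ξ =
      pairTsum (clusterTerm f u ξ) (clusterTerm g u ξ) + clusterSum (fun x => f x * g x) u ξ := by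
  refine (tsum_mul_tsum_eq_pairTsum (clusterTerm f u ξ) (clusterTerm g u ξ)).trans ?_
  simp_rw [clusterTerm_mul]
  rfl

theorem clusterSum_mul_mul (f g k : ℝ → ℝ≥0∞) (u : ℝ) (ξ : Marks) :
    clusterSum f u ξ * clusterSum g u ξ * clusterSum k u ξ =
      tripleTsum (clusterTerm f u ξ) (clusterTerm g u ξ) (clusterTerm k u ξ) +
      (pairTsum (clusterTerm (fun x => f x * g x) u ξ) (clusterTerm k u ξ) +
        pairTsum (clusterTerm (fun x => f x * k x) u ξ) (clusterTerm g u ξ) +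
        pairTsum (clusterTerm (fun x => g x * k x) u ξ) (clusterTerm f u ξ)) +
      clusterSum (fun x => f x * g x * k x) u ξ := by
  refine (tsum_mul_tsum_mul_tsum_eq_tripleTsum (clusterTerm f u ξ) (clusterTerm g u ξ)
    (clusterTerm k u ξ)).trans ?_
  simp_rw [clusterTerm_mul]
  rfl

theorem clusterSum_le {f : ℝ → ℝ≥0∞} {B : ℝ≥0∞} (hB : ∀ x, f x ≤ B) (u : ℝ) (ξ : Marks) :
    clusterSum f u ξ ≤ B * size ξ := by
  rw [size, ← ENNReal.tsum_mul_left]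
  exact ENNReal.tsum_le_tsum fun v => (mul_le_mul' le_rfl (hB _)).trans (mul_comm _ _).le

/-- By translation invariance of Lebesgue measure each individual contributes `∫ f`, wherever it
sits relative to the root. Thus bounds on cluster sums reduce to moments of the size. -/
theorem lintegral_clusterSum {f : ℝ → ℝ≥0∞} (hf : Measurable f) (ξ : Marks) :
    ∫⁻ u, clusterSum f u ξ = size ξ * ∫⁻ u, f u := by
  have hm : ∀ v, Measurable fun u => aliveInd ξ v * f (pos ξ v + u) := fun v => by fun_prop
  simp_rw [clusterSum]
  rw [lintegral_tsum fun v => (hm v).aemeasurable, size, ← ENNReal.tsum_mul_right]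
  refine tsum_congr fun v => ?_
  rw [lintegral_const_mul _ (by fun_prop), lintegral_add_left_eq_self]

/-- Nonnegative bounded integrable functions. -/
structure IsNiceFunction (f : ℝ → ℝ≥0∞) : Prop where
  measurable : Measurable f
  bounded : ∃ B : ℝ≥0∞, B ≠ ∞ ∧ ∀ x, f x ≤ B
  lintegral_ne_top : ∫⁻ x, f x ≠ ∞

theorem IsNiceFunction.mul {f g : ℝ → ℝ≥0∞} (hf : IsNiceFunction f) (hg : IsNiceFunction g) :
    IsNiceFunction fun x => f x * g x := by
  obtain ⟨B, hB, hfB⟩ := hf.bounded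
  obtain ⟨C, hC, hgC⟩ := hg.bounded
  refine ⟨hf.measurable.mul hg.measurable, ⟨B * C, ENNReal.mul_ne_top hB hC, fun x =>
    mul_le_mul' (hfB x) (hgC x)⟩, ?_⟩
  refine ne_top_of_le_ne_top (ENNReal.mul_ne_top hf.lintegral_ne_top hC) ?_
  rw [← lintegral_mul_const _ hf.measurable]
  exact lintegral_mono fun x => mul_le_mul' le_rfl (hgC x)

section ClusterMoments

variable (ν m : ℝ≥0) (D : Measure ℝ) [IsProbabilityMeasure D]

/-- The first factorial cumulant of the cluster process. -/
noncomputable def intensity₁ (f : ℝ → ℝ≥0∞) : ℝ≥0∞ :=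
  ν * ∫⁻ u, ∫⁻ ξ, clusterSum f u ξ ∂(treeLaw m D)

/-- The second factorial cumulant of the cluster process. -/
noncomputable def intensity₂ (f g : ℝ → ℝ≥0∞) : ℝ≥0∞ :=
  ν * ∫⁻ u, ∫⁻ ξ, pairTsum (clusterTerm f u ξ) (clusterTerm g u ξ) ∂(treeLaw m D)

/-- The third factorial cumulant of the cluster process. -/
noncomputable def intensity₃ (f g k : ℝ → ℝ≥0∞) : ℝ≥0∞ :=
  ν * ∫⁻ u, ∫⁻ ξ, tripleTsum (clusterTerm f u ξ) (clusterTerm g u ξ) (clusterTerm k u ξ)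
    ∂(treeLaw m D)

variable {ν m D} {f g k : ℝ → ℝ≥0∞}

theorem lintegral_lintegral_clusterSum_mul {s : Marks → ℝ≥0∞} (hf : Measurable f)
    (hs : Measurable s) : ∫⁻ u, ∫⁻ ξ, clusterSum f u ξ * s ξ ∂(treeLaw m D) =
      (∫⁻ ξ, size ξ * s ξ ∂(treeLaw m D)) * ∫⁻ x, f x := by
  have hF := measurable_clusterSum hf
  rw [lintegral_lintegral_swap (hF.mul (hs.comp measurable_snd)).aemeasurable,
    ← lintegral_mul_const (f := fun ξ => size ξ * s ξ) _ (measurable_size.mul hs)]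
  refine lintegral_congr fun ξ => ?_
  rw [lintegral_mul_const (f := fun x => clusterSum f x ξ) _ (hF.comp measurable_prodMk_right),
    lintegral_clusterSum hf,
    mul_right_comm]

theorem lintegral_clusterSum_ne_top (hm : m < 1) (hf : IsNiceFunction f) :
    ∫⁻ u, ∫⁻ ξ, clusterSum f u ξ ∂(treeLaw m D) ≠ ∞ := by
  have := lintegral_lintegral_clusterSum_mul (m := m) (D := D) (s := fun _ => 1) hf.measurable
    measurable_const
  simp only [mul_one] at this
  rw [this]
  exact ENNReal.mul_ne_top (lintegral_size_ne_top hm) hf.lintegral_ne_top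

theorem intensity₁_ne_top (hm : m < 1) (hf : IsNiceFunction f) : intensity₁ ν m D f ≠ ∞ :=
  ENNReal.mul_ne_top ENNReal.coe_ne_top (lintegral_clusterSum_ne_top hm hf)

theorem lintegral_clusterSum_mul_ne_top (hm : m < 1) (hf : IsNiceFunction f)
    (hg : IsNiceFunction g) :
    ∫⁻ u, ∫⁻ ξ, clusterSum f u ξ * clusterSum g u ξ ∂(treeLaw m D) ≠ ∞ := by
  obtain ⟨B, hB, hgB⟩ := hg.bounded
  refine ne_top_of_le_ne_top ?_ (lintegral_mono fun u => lintegral_mono fun ξ =>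
    mul_le_mul' le_rfl (clusterSum_le hgB u ξ))
  rw [lintegral_lintegral_clusterSum_mul hf.measurable (measurable_size.const_mul B)]
  refine ENNReal.mul_ne_top ?_ hf.lintegral_ne_top
  simp_rw [mul_left_comm]
  rw [lintegral_const_mul (f := fun ξ => size ξ * size ξ) _ (measurable_size.mul measurable_size)]
  exact ENNReal.mul_ne_top hB (lintegral_size_sq_ne_top hm)

theorem lintegral_clusterSum_mul_mul_ne_top (hm : m < 1) (hf : IsNiceFunction f)
    (hg : IsNiceFunction g) (hk : IsNiceFunction k) :
    ∫⁻ u, ∫⁻ ξ, clusterSum f u ξ * clusterSum g u ξ * clusterSum k u ξ ∂(treeLaw m D) ≠ ∞ := by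
  obtain ⟨B, hB, hgB⟩ := hg.bounded
  obtain ⟨C, hC, hkC⟩ := hk.bounded
  have hss : Measurable fun ξ => size ξ * size ξ := measurable_size.mul measurable_size
  refine ne_top_of_le_ne_top ?_ (lintegral_mono fun u => lintegral_mono fun ξ =>
    (mul_assoc _ _ _).le.trans (mul_le_mul' le_rfl
      (mul_le_mul' (clusterSum_le hgB u ξ) (clusterSum_le hkC u ξ))))
  simp_rw [mul_mul_mul_comm]
  rw [lintegral_lintegral_clusterSum_mul (s := fun ξ => B * C * (size ξ * size ξ)) hf.measurable
    (hss.const_mul (B * C))]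
  refine ENNReal.mul_ne_top ?_ hf.lintegral_ne_top
  simp_rw [mul_left_comm _ (B * C)]
  rw [lintegral_const_mul (f := fun ξ => size ξ * (size ξ * size ξ)) _ (measurable_size.mul hss)]
  simp_rw [← mul_assoc]
  exact ENNReal.mul_ne_top (ENNReal.mul_ne_top hB hC) (lintegral_size_cube_ne_top hm)

theorem lintegral_clusterSum_mul (hf : Measurable f) (hg : Measurable g) :
    ν * ∫⁻ u, ∫⁻ ξ, clusterSum f u ξ * clusterSum g u ξ ∂(treeLaw m D) =
      intensity₂ ν m D f g + intensity₁ ν m D fun x => f x * g x := by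
  have hfg := measurable_clusterSum (hf.mul hg)
  have h2 := measurable_pairTsum_clusterTerm hf hg
  simp_rw [clusterSum_mul]
  rw [intensity₂, intensity₁, ← mul_add, ← lintegral_add_left h2.lintegral_prod_right']
  congr 1
  exact lintegral_congr fun u => lintegral_add_left (h2.comp measurable_prodMk_left) _

/-- The right-hand side separates the ordinary third moment of a cluster into sums over distinct
individuals. It also yields finiteness of `intensity₃`, which is one of the summands of a finite
quantity. -/
theorem lintegral_clusterSum_mul_mul (hf : Measurable f) (hg : Measurable g) (hk : Measurable k) :
    ν * ∫⁻ u, ∫⁻ ξ, clusterSum f u ξ * clusterSum g u ξ * clusterSum k u ξ ∂(treeLaw m D) =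
      intensity₃ ν m D f g k + (intensity₂ ν m D (fun x => f x * g x) k +
        intensity₂ ν m D (fun x => f x * k x) g + intensity₂ ν m D (fun x => g x * k x) f) +
        intensity₁ ν m D fun x => f x * g x * k x := by
  have h1 := measurable_clusterSum (f := fun x => f x * g x * k x) ((hf.mul hg).mul hk)
  have h21 := measurable_pairTsum_clusterTerm (f := fun x => f x * g x) (hf.mul hg) hk
  have h22 := measurable_pairTsum_clusterTerm (f := fun x => f x * k x) (hf.mul hk) hg
  have h23 := measurable_pairTsum_clusterTerm (f := fun x => g x * k x) (hg.mul hk) hf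
  have h3 := measurable_tripleTsum_clusterTerm hf hg hk
  simp_rw [clusterSum_mul_mul]
  rw [intensity₂, intensity₂, intensity₂, intensity₁, intensity₃, ← mul_add, ← mul_add, ← mul_add,
    ← mul_add]
  have h21' := h21.lintegral_prod_right' (ν := treeLaw m D)
  have h23' := h23.lintegral_prod_right' (ν := treeLaw m D)
  have h3' := h3.lintegral_prod_right' (ν := treeLaw m D)
  have h1' := h1.lintegral_prod_right' (ν := treeLaw m D)
  dsimp only at h21' h23' h3' h1'
  rw [← lintegral_add_left h21', ← lintegral_add_right _ h23', ← lintegral_add_left h3',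
    ← lintegral_add_right _ h1']
  congr 1
  refine lintegral_congr fun u => ?_
  have c : ∀ {φ : ℝ × Marks → ℝ≥0∞}, Measurable φ → Measurable fun ξ => φ (u, ξ) := fun h =>
    h.comp measurable_prodMk_left
  refine (lintegral_add_right _ (c h1)).trans (congrArg (· + _) ?_)
  refine (lintegral_add_left (c h3) _).trans (congrArg (_ + ·) ?_)
  refine (lintegral_add_right _ (c h23)).trans (congrArg (· + _) ?_)
  exact lintegral_add_left (c h21) _

theorem intensity₂_ne_top (hm : m < 1) (hf : IsNiceFunction f) (hg : IsNiceFunction g) :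
    intensity₂ ν m D f g ≠ ∞ := by
  have := ENNReal.mul_ne_top (ENNReal.coe_ne_top (r := ν))
    (lintegral_clusterSum_mul_ne_top (D := D) hm hf hg)
  rw [lintegral_clusterSum_mul hf.measurable hg.measurable] at this
  exact (ENNReal.add_ne_top.1 this).1

theorem intensity₃_ne_top (hm : m < 1) (hf : IsNiceFunction f) (hg : IsNiceFunction g)
    (hk : IsNiceFunction k) : intensity₃ ν m D f g k ≠ ∞ := by
  have := ENNReal.mul_ne_top (ENNReal.coe_ne_top (r := ν))
    (lintegral_clusterSum_mul_mul_ne_top (D := D) hm hf hg hk)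
  rw [lintegral_clusterSum_mul_mul hf.measurable hg.measurable hk.measurable] at this
  exact (ENNReal.add_ne_top.1 (ENNReal.add_ne_top.1 this).1).1

/-- A bound for the first moments of cluster sums and of their products. -/
theorem IsNiceFunction.exists_bound (hm : m < 1) (hf : IsNiceFunction f) (hg : IsNiceFunction g) :
    ∃ B : ℝ≥0∞, B ≠ ∞ ∧ (∀ u, ∫⁻ ξ, clusterSum g u ξ ∂(treeLaw m D) ≤ B) ∧
      ∀ u, ∫⁻ ξ, clusterSum f u ξ * clusterSum g u ξ ∂(treeLaw m D) ≤ B := by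
  obtain ⟨B, hB, hfB⟩ := hf.bounded
  obtain ⟨C, hC, hgC⟩ := hg.bounded
  have h1 := lintegral_size_ne_top (D := D) hm
  have h2 := lintegral_size_sq_ne_top (D := D) hm
  have hss : Measurable fun ξ => size ξ * size ξ := measurable_size.mul measurable_size
  refine ⟨C * (∫⁻ ξ, size ξ ∂(treeLaw m D)) + B * C * ∫⁻ ξ, size ξ * size ξ ∂(treeLaw m D),
    by finiteness, fun u => ?_, fun u => ?_⟩
  · refine le_add_right ?_
    rw [← lintegral_const_mul _ measurable_size]
    exact lintegral_mono fun ξ => clusterSum_le hgC u ξ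
  · refine le_add_left ?_
    rw [← lintegral_const_mul _ hss]
    refine lintegral_mono fun ξ => (mul_le_mul' (clusterSum_le hfB u ξ)
      (clusterSum_le hgC u ξ)).trans (mul_mul_mul_comm _ _ _ _).le

theorem lintegral_mul_lintegral_clusterSum_ne_top (hm : m < 1) (hf : IsNiceFunction f)
    (hg : IsNiceFunction g) :
    ∫⁻ u, (∫⁻ ξ, clusterSum f u ξ ∂(treeLaw m D)) * (∫⁻ ξ, clusterSum g u ξ ∂(treeLaw m D)) ≠ ∞ := by
  obtain ⟨B, hB, hgB, -⟩ := hf.exists_bound (D := D) hm hg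
  refine ne_top_of_le_ne_top ?_ (lintegral_mono fun u => mul_le_mul' le_rfl (hgB u))
  rw [lintegral_mul_const (f := fun u => ∫⁻ ξ, clusterSum f u ξ ∂(treeLaw m D)) _
    (measurable_clusterSum hf.measurable).lintegral_prod_right']
  exact ENNReal.mul_ne_top (lintegral_clusterSum_ne_top hm hf) hB

end ClusterMoments

/-! ### Moments of the cluster process -/

section ClusterProcess

variable {Ω : Type*} [MeasurableSpace Ω] {P : Measure Ω} {ν m : ℝ≥0} {h : ℝ → ℝ}
  {U : ℕ → Ω → ℝ} {ξ : ℕ × List ℕ → Ω → ℕ × ℝ}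

omit [MeasurableSpace Ω] in
theorem lintegral_clusterProcess {f : ℝ → ℝ≥0∞} (hf : Measurable f) (ω : Ω) :
    ∫⁻ x, f x ∂(clusterProcess U ξ ω) =
      ∑' j, clusterSum f (U j ω) fun v => ξ (j, v) ω := by
  rw [clusterProcess, lintegral_sum_measure]
  refine tsum_congr fun j => ?_
  rw [lintegral_map hf (by fun_prop), lintegral_cluster _ (by fun_prop)]
  rfl

variable [IsProbabilityMeasure P] (hh : IsDelayDensity h) (hmodel : IsBranchingModel P ν m h U ξ)
include hh hmodel

/-- Grouping the labels `(j, v)` by `j` turns the independent marks into independent clusters with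
law `treeLaw`. Independence from the immigrants then permits integrating over the clusters first. -/
theorem lintegral_immigrants_marks {Φ : (ℕ → ℝ) × (ℕ → Marks) → ℝ≥0∞} (hΦ : Measurable Φ) :
    ∫⁻ ω, Φ (fun j => U j ω, fun j v => ξ (j, v) ω) ∂P =
      ∫⁻ ω, ∫⁻ x, Φ (fun j => U j ω, x) ∂(Measure.infinitePi fun _ : ℕ =>
        treeLaw m (delayLaw h)) ∂P := by
  have := hh.isProbabilityMeasure
  have mU : Measurable fun ω j => U j ω := measurable_pi_lambda _ hmodel.measurable_immigrants
  have mξ : Measurable fun ω p => ξ p ω := measurable_pi_lambda _ hmodel.measurable_marks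
  let e := MeasurableEquiv.curry ℕ (List ℕ) (ℕ × ℝ)
  have mΞ : Measurable fun ω => e fun p => ξ p ω := e.measurable.comp mξ
  have law : P.map (fun ω => e fun p => ξ p ω) =
      Measure.infinitePi fun _ : ℕ => treeLaw m (delayLaw h) := by
    have h1 := (hmodel.marks_indep.hasLaw_infinitePi (μ := fun _ => markLaw m (delayLaw h))
      hmodel.marks_law mξ.aemeasurable).map_eq
    have h2 := Measure.infinitePi_map_curry (fun (_ : ℕ) (_ : List ℕ) => markLaw m (delayLaw h))
    rw [← h1, Measure.map_map e.measurable mξ] at h2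
    exact h2
  have ind := (indepFun_iff_map_prod_eq_prod_map_map mU.aemeasurable mΞ.aemeasurable).1
    (hmodel.indep.comp measurable_id e.measurable)
  have : IsProbabilityMeasure (P.map fun ω j => U j ω) :=
    Measure.isProbabilityMeasure_map mU.aemeasurable
  rw [law] at ind
  calc ∫⁻ ω, Φ (fun j => U j ω, fun j v => ξ (j, v) ω) ∂P
      = ∫⁻ p, Φ p ∂(P.map fun ω => (fun j => U j ω, e fun p => ξ p ω)) :=
        (lintegral_map hΦ (mU.prodMk mΞ)).symm
    _ = _ := by
        rw [ind, lintegral_prod _ hΦ.aemeasurable, lintegral_map hΦ.lintegral_prod_right' mU]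

variable {f g k : ℝ → ℝ≥0∞}

omit hh hmodel in
theorem measurable_tsum_clusterSum (hf : Measurable f) :
    Measurable fun p : (ℕ → ℝ) × (ℕ → Marks) => ∑' j, clusterSum f (p.1 j) (p.2 j) :=
  Measurable.tsum fun j => (measurable_clusterSum hf).comp (f := fun p : (ℕ → ℝ) × (ℕ → Marks) => (p.1 j, p.2 j))
    (((measurable_pi_apply j).comp measurable_fst).prodMk
      ((measurable_pi_apply (X := fun _ : ℕ => Marks) j).comp measurable_snd))

omit [IsProbabilityMeasure P] hh in
theorem measurable_clusterProcess : Measurable (clusterProcess U ξ) := by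
  refine Measure.measurable_of_measurable_coe _ fun s hs => ?_
  have : ∀ ω, clusterProcess U ξ ω s = ∑' j, clusterSum (s.indicator 1) (U j ω)
      fun v => ξ (j, v) ω := fun ω => by
    rw [← lintegral_clusterProcess (measurable_one.indicator hs), lintegral_indicator_one hs]
  simp_rw [this]
  refine Measurable.comp (f := fun ω => (fun j => U j ω, fun j v => ξ (j, v) ω))
    (measurable_tsum_clusterSum (measurable_one.indicator hs)) ?_
  exact (measurable_pi_lambda _ hmodel.measurable_immigrants).prodMk (measurable_pi_lambda _
    fun j => measurable_pi_lambda _ fun v => hmodel.measurable_marks (j, v))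

theorem lintegral_clusterProcess_linear (hf : Measurable f) :
    ∫⁻ ω, (∫⁻ x, f x ∂(clusterProcess U ξ ω)) ∂P = intensity₁ ν m (delayLaw h) f := by
  have := hh.isProbabilityMeasure
  simp_rw [lintegral_clusterProcess hf]
  rw [lintegral_immigrants_marks hh hmodel (Φ := fun p => ∑' j, clusterSum f (p.1 j) (p.2 j))
    (measurable_tsum_clusterSum hf)]
  exact lintegral_superposition hmodel.measurable_immigrants hmodel.immigrants
    (measurable_clusterSum hf)

theorem lintegral_clusterProcess_mul (hm : m < 1) (hf : IsNiceFunction f) (hg : IsNiceFunction g) :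
    ∫⁻ ω, (∫⁻ x, f x ∂(clusterProcess U ξ ω)) * (∫⁻ x, g x ∂(clusterProcess U ξ ω)) ∂P =
      intensity₁ ν m (delayLaw h) f * intensity₁ ν m (delayLaw h) g +
        (intensity₂ ν m (delayLaw h) f g + intensity₁ ν m (delayLaw h) fun x => f x * g x) := by
  have := hh.isProbabilityMeasure
  simp_rw [lintegral_clusterProcess hf.measurable, lintegral_clusterProcess hg.measurable]
  rw [lintegral_immigrants_marks hh hmodel (Φ := fun p => (∑' j, clusterSum f (p.1 j) (p.2 j)) *
    ∑' j, clusterSum g (p.1 j) (p.2 j)) ((measurable_tsum_clusterSum hf.measurable).mul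
      (measurable_tsum_clusterSum hg.measurable))]
  rw [← lintegral_clusterSum_mul hf.measurable hg.measurable]
  refine lintegral_superposition_mul hmodel.measurable_immigrants hmodel.immigrants
    (measurable_clusterSum hf.measurable) (measurable_clusterSum hg.measurable) ?_
  exact lintegral_mul_lintegral_clusterSum_ne_top hm hf hg

/-- The outer sum has the moment-cumulant shape: the cumulants of the linear statistics are the
cluster moments. Each is expanded into the factorial intensities, so that the factorial cumulants
can be read off. -/
theorem lintegral_clusterProcess_mul_mul (hm : m < 1) (hf : IsNiceFunction f)
    (hg : IsNiceFunction g) (hk : IsNiceFunction k) :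
    ∫⁻ ω, (∫⁻ x, f x ∂(clusterProcess U ξ ω)) * (∫⁻ x, g x ∂(clusterProcess U ξ ω)) *
        (∫⁻ x, k x ∂(clusterProcess U ξ ω)) ∂P =
      intensity₁ ν m (delayLaw h) f * intensity₁ ν m (delayLaw h) g *
        intensity₁ ν m (delayLaw h) k +
      ((intensity₂ ν m (delayLaw h) f g + intensity₁ ν m (delayLaw h) fun x => f x * g x) *
          intensity₁ ν m (delayLaw h) k +
        (intensity₂ ν m (delayLaw h) f k + intensity₁ ν m (delayLaw h) fun x => f x * k x) *
          intensity₁ ν m (delayLaw h) g +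
        (intensity₂ ν m (delayLaw h) g k + intensity₁ ν m (delayLaw h) fun x => g x * k x) *
          intensity₁ ν m (delayLaw h) f) +
      (intensity₃ ν m (delayLaw h) f g k + (intensity₂ ν m (delayLaw h) (fun x => f x * g x) k +
        intensity₂ ν m (delayLaw h) (fun x => f x * k x) g +
        intensity₂ ν m (delayLaw h) (fun x => g x * k x) f) +
        intensity₁ ν m (delayLaw h) fun x => f x * g x * k x) := by
  have := hh.isProbabilityMeasure
  simp_rw [lintegral_clusterProcess hf.measurable, lintegral_clusterProcess hg.measurable,
    lintegral_clusterProcess hk.measurable]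
  rw [lintegral_immigrants_marks hh hmodel (Φ := fun p => (∑' j, clusterSum f (p.1 j) (p.2 j)) *
    (∑' j, clusterSum g (p.1 j) (p.2 j)) * ∑' j, clusterSum k (p.1 j) (p.2 j))
    (((measurable_tsum_clusterSum hf.measurable).mul
      (measurable_tsum_clusterSum hg.measurable)).mul (measurable_tsum_clusterSum hk.measurable))]
  rw [← lintegral_clusterSum_mul hf.measurable hg.measurable,
    ← lintegral_clusterSum_mul hf.measurable hk.measurable,
    ← lintegral_clusterSum_mul hg.measurable hk.measurable,
    ← lintegral_clusterSum_mul_mul hf.measurable hg.measurable hk.measurable]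
  obtain ⟨B₁, hB₁, h1, h1'⟩ := hf.exists_bound (D := delayLaw h) hm hg
  obtain ⟨B₂, hB₂, h2, h2'⟩ := hf.exists_bound (D := delayLaw h) hm hk
  obtain ⟨B₃, hB₃, -, h3'⟩ := hg.exists_bound (D := delayLaw h) hm hk
  have b1 : B₁ ≤ B₁ + B₂ + B₃ := (le_add_right le_rfl).trans (le_add_right le_rfl)
  have b2 : B₂ ≤ B₁ + B₂ + B₃ := (le_add_left le_rfl).trans (le_add_right le_rfl)
  have b3 : B₃ ≤ B₁ + B₂ + B₃ := le_add_left le_rfl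
  exact lintegral_superposition_mul_mul hmodel.measurable_immigrants hmodel.immigrants
    (measurable_clusterSum hf.measurable) (measurable_clusterSum hg.measurable)
    (measurable_clusterSum hk.measurable) (B := B₁ + B₂ + B₃) (by finiteness)
    (lintegral_clusterSum_ne_top hm hf) (lintegral_clusterSum_ne_top hm hg)
    (lintegral_clusterSum_ne_top hm hk) (fun u => (h1 u).trans b1) (fun u => (h2 u).trans b2) (fun u => (h1' u).trans b1)
    (fun u => (h2' u).trans b2) (fun u => (h3' u).trans b3)

end ClusterProcess

/-! ### Test functions -/

namespace IsTestFunction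

variable {f g : ℝ → ℝ}

theorem mul (hf : IsTestFunction f) (hg : IsTestFunction g) : IsTestFunction fun x => f x * g x := by
  obtain ⟨B, hB⟩ := hf.bounded
  obtain ⟨C, hC⟩ := hg.bounded
  refine ⟨hf.measurable.mul hg.measurable, ⟨B * C, fun x => ?_⟩, hf.compactSupport.mul_right⟩
  rw [abs_mul]
  exact mul_le_mul (hB x) (hC x) (abs_nonneg _) ((abs_nonneg _).trans (hB x))

theorem neg (hf : IsTestFunction f) : IsTestFunction fun x => -f x := by
  obtain ⟨B, hB⟩ := hf.bounded
  exact ⟨hf.measurable.neg, ⟨B, fun x => by simpa using hB x⟩,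
    hf.compactSupport.comp_left (g := fun x => -x) neg_zero⟩

theorem posPart (hf : IsTestFunction f) : IsTestFunction fun x => max (f x) 0 := by
  obtain ⟨B, hB⟩ := hf.bounded
  refine ⟨hf.measurable.max measurable_const, ⟨B, fun x => ?_⟩,
    hf.compactSupport.comp_left (g := fun x => max x 0) (max_self 0)⟩
  rw [abs_of_nonneg (le_max_right _ _)]
  exact max_le ((le_abs_self _).trans (hB x)) ((abs_nonneg _).trans (hB x))

theorem sub (hf : IsTestFunction f) (hg : IsTestFunction g) : IsTestFunction fun x => f x - g x := by
  obtain ⟨B, hB⟩ := hf.bounded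
  obtain ⟨C, hC⟩ := hg.bounded
  refine ⟨hf.measurable.sub hg.measurable, ⟨B + C, fun x => (abs_sub _ _).trans
    (add_le_add (hB x) (hC x))⟩, ?_⟩
  simp_rw [sub_eq_add_neg]
  exact hf.compactSupport.add hg.neg.compactSupport

theorem comp_neg (hf : IsTestFunction f) : IsTestFunction fun x => f (-x) :=
  ⟨hf.measurable.comp measurable_neg, hf.bounded.imp fun _ h x => h (-x),
    hf.compactSupport.comp_homeomorph (Homeomorph.neg ℝ)⟩

theorem integrable (hf : IsTestFunction f) {μ : Measure ℝ} (hμ : μ (tsupport f) ≠ ∞) :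
    Integrable f μ := by
  obtain ⟨B, hB⟩ := hf.bounded
  have : IntegrableOn f (tsupport f) μ :=
    Measure.integrableOn_of_bounded hμ hf.measurable.aestronglyMeasurable
      (Eventually.of_forall hB)
  exact (integrableOn_iff_integrable_of_support_subset (subset_tsupport f)).1 this

theorem isNiceFunction (hf : IsTestFunction f) : IsNiceFunction fun x => ENNReal.ofReal (f x) := by
  obtain ⟨B, hB⟩ := hf.bounded
  refine ⟨hf.measurable.ennreal_ofReal, ⟨ENNReal.ofReal B, ENNReal.ofReal_ne_top, fun x =>
    ENNReal.ofReal_le_ofReal ((le_abs_self _).trans (hB x))⟩, ?_⟩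
  exact ((hf.integrable (IsCompact.measure_ne_top hf.compactSupport)).lintegral_lt_top).ne

end IsTestFunction

/-- Two functionals which are compatible with differences in each of three test functions agree as
soon as they agree on nonnegative test functions. -/
theorem eq_of_forall_nonneg {S T : (ℝ → ℝ) → (ℝ → ℝ) → (ℝ → ℝ) → ℝ}
    (hS₁ : ∀ f f' g k, IsTestFunction f → IsTestFunction f' → IsTestFunction g →
      IsTestFunction k → S (fun x => f x - f' x) g k = S f g k - S f' g k)
    (hS₂ : ∀ f g g' k, IsTestFunction f → IsTestFunction g → IsTestFunction g' →
      IsTestFunction k → S f (fun x => g x - g' x) k = S f g k - S f g' k)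
    (hS₃ : ∀ f g k k', IsTestFunction f → IsTestFunction g → IsTestFunction k →
      IsTestFunction k' → S f g (fun x => k x - k' x) = S f g k - S f g k')
    (hT₁ : ∀ f f' g k, IsTestFunction f → IsTestFunction f' → IsTestFunction g →
      IsTestFunction k → T (fun x => f x - f' x) g k = T f g k - T f' g k)
    (hT₂ : ∀ f g g' k, IsTestFunction f → IsTestFunction g → IsTestFunction g' →
      IsTestFunction k → T f (fun x => g x - g' x) k = T f g k - T f g' k)
    (hT₃ : ∀ f g k k', IsTestFunction f → IsTestFunction g → IsTestFunction k →
      IsTestFunction k' → T f g (fun x => k x - k' x) = T f g k - T f g k')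
    (h : ∀ f g k, IsTestFunction f → IsTestFunction g → IsTestFunction k →
      (∀ x, 0 ≤ f x) → (∀ x, 0 ≤ g x) → (∀ x, 0 ≤ k x) → S f g k = T f g k)
    {f g k : ℝ → ℝ} (hf : IsTestFunction f) (hg : IsTestFunction g) (hk : IsTestFunction k) :
    S f g k = T f g k := by
  have dec : ∀ f : ℝ → ℝ, (fun x => max (f x) 0 - max (-f x) 0) = f := fun f => by
    funext x
    exact max_zero_sub_max_neg_zero_eq_self (f x)
  have nn : ∀ (f : ℝ → ℝ) x, 0 ≤ max (f x) 0 := fun f x => le_max_right _ _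
  have h3 : ∀ f g k, IsTestFunction f → IsTestFunction g → IsTestFunction k →
      (∀ x, 0 ≤ f x) → (∀ x, 0 ≤ g x) → S f g k = T f g k := fun f g k hf hg hk pf pg => by
    rw [← dec k, hS₃ _ _ _ _ hf hg hk.posPart hk.neg.posPart,
      hT₃ _ _ _ _ hf hg hk.posPart hk.neg.posPart, h _ _ _ hf hg hk.posPart pf pg (nn k),
      h _ _ _ hf hg hk.neg.posPart pf pg (nn fun x => -k x)]
  have h2 : ∀ f g k, IsTestFunction f → IsTestFunction g → IsTestFunction k →
      (∀ x, 0 ≤ f x) → S f g k = T f g k := fun f g k hf hg hk pf => by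
    rw [← dec g, hS₂ _ _ _ _ hf hg.posPart hg.neg.posPart hk,
      hT₂ _ _ _ _ hf hg.posPart hg.neg.posPart hk, h3 _ _ _ hf hg.posPart hk pf (nn g),
      h3 _ _ _ hf hg.neg.posPart hk pf (nn fun x => -g x)]
  rw [← dec f, hS₁ _ _ _ _ hf.posPart hf.neg.posPart hg hk,
    hT₁ _ _ _ _ hf.posPart hf.neg.posPart hg hk, h2 _ _ _ hf.posPart hg hk (nn f),
    h2 _ _ _ hf.neg.posPart hg hk (nn fun x => -f x)]

/-! ### Factorial cumulants as trilinear functionals -/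

section Cumulant

variable {Ω : Type*} [MeasurableSpace Ω] {P : Measure Ω} {N : Ω → Measure ℝ}
  {f f' g k : ℝ → ℝ}

theorem linStat_eq_toReal_sub (μ : Measure ℝ) (hf : Integrable f μ) :
    linStat μ f = (∫⁻ x, ENNReal.ofReal (f x) ∂μ).toReal -
      (∫⁻ x, ENNReal.ofReal (-f x) ∂μ).toReal :=
  integral_eq_lintegral_pos_part_sub_lintegral_neg_part hf

theorem memLp_three_toReal {X : Ω → ℝ≥0∞} (hX : Measurable X) (h : ∫⁻ ω, X ω ^ 3 ∂P < ∞) :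
    MemLp (fun ω => (X ω).toReal) 3 P := by
  refine ⟨hX.ennreal_toReal.aestronglyMeasurable, ?_⟩
  rw [eLpNorm_lt_top_iff_lintegral_rpow_enorm_lt_top (by simp) (by simp)]
  refine lt_of_le_of_lt (lintegral_mono fun ω => ?_) h
  simp only [ENNReal.toReal_ofNat, ENNReal.rpow_ofNat]
  gcongr
  rw [Real.enorm_eq_ofReal ENNReal.toReal_nonneg]
  exact ENNReal.ofReal_toReal_le

variable (hN : Measurable N) (hmom : ∀ K : Set ℝ, IsCompact K → ∫⁻ ω, (N ω K) ^ 3 ∂P < ∞)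
include hN hmom

theorem ae_measure_ne_top {K : Set ℝ} (hK : IsCompact K) : ∀ᵐ ω ∂P, N ω K ≠ ∞ := by
  have hm : Measurable fun ω => N ω K := (Measure.measurable_coe hK.measurableSet).comp hN
  filter_upwards [ae_lt_top (hm.pow_const 3) (hmom K hK).ne] with ω hω h
  simp [h] at hω

theorem ae_integrable (hf : IsTestFunction f) : ∀ᵐ ω ∂P, Integrable f (N ω) :=
  (ae_measure_ne_top hN hmom hf.compactSupport).mono fun _ h => hf.integrable h

theorem memLp_linStat (hf : IsTestFunction f) : MemLp (fun ω => linStat (N ω) f) 3 P := by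
  have hK : IsCompact (tsupport f) := hf.compactSupport
  obtain ⟨B, hB⟩ := hf.bounded
  have hm : Measurable fun ω => N ω (tsupport f) :=
    (Measure.measurable_coe hK.measurableSet).comp hN
  have mL : ∀ φ : ℝ → ℝ, Measurable φ →
      Measurable fun ω => (∫⁻ x, ENNReal.ofReal (φ x) ∂(N ω)).toReal := fun φ hφ =>
    ((Measure.measurable_lintegral hφ.ennreal_ofReal).comp hN).ennreal_toReal
  refine MemLp.of_le_mul (c := B) (memLp_three_toReal hm (hmom _ hK)) ?_ ?_
  · refine AEMeasurable.aestronglyMeasurable (AEMeasurable.congr (((mL _ hf.measurable).sub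
      (mL _ hf.measurable.neg)).aemeasurable) ?_)
    filter_upwards [ae_integrable hN hmom hf] with ω hω
    exact (linStat_eq_toReal_sub _ hω).symm
  · filter_upwards [ae_measure_ne_top hN hmom hK] with ω hω
    rw [linStat, ← setIntegral_eq_integral_of_forall_compl_eq_zero (s := tsupport f)
      (fun x hx => image_eq_zero_of_notMem_tsupport hx), Real.norm_of_nonneg ENNReal.toReal_nonneg]
    exact norm_setIntegral_le_of_norm_le_const (lt_top_iff_ne_top.2 hω) fun x _ => hB x

-- Hölder's inequality is replaced by the elementary bound of `xyz` by `x³ + y³ + z³`.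
omit hN hmom in
theorem integrable_mul_mul_of_memLp {𝕜 : Type*} [RCLike 𝕜] {X Y Z : Ω → 𝕜} (hX : MemLp X 3 P) (hY : MemLp Y 3 P)
    (hZ : MemLp Z 3 P) : Integrable (fun ω => X ω * Y ω * Z ω) P := by
  refine Integrable.mono' (((hX.integrable_norm_pow (p := 3) (by simp)).add
    (hY.integrable_norm_pow (p := 3) (by simp))).add (hZ.integrable_norm_pow (p := 3) (by simp)))
    ((hX.1.mul hY.1).mul hZ.1) (Eventually.of_forall fun ω => ?_)
  simp only [Pi.add_apply, norm_mul]
  have a := norm_nonneg (X ω)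
  have b := norm_nonneg (Y ω)
  have c := norm_nonneg (Z ω)
  have s := add_nonneg (add_nonneg a b) c
  -- Twice `x³ + y³ + z³ - 3xyz` is `(x + y + z)` times the sum of the three squared differences.
  nlinarith [mul_nonneg s (sq_nonneg (‖X ω‖ - ‖Y ω‖)), mul_nonneg s (sq_nonneg (‖Y ω‖ - ‖Z ω‖)),
    mul_nonneg s (sq_nonneg (‖X ω‖ - ‖Z ω‖)), mul_nonneg (mul_nonneg a b) c]

variable [IsProbabilityMeasure P]

theorem integrable_linStat (hf : IsTestFunction f) : Integrable (fun ω => linStat (N ω) f) P :=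
  (memLp_linStat hN hmom hf).integrable (by norm_num)

theorem integrable_linStat_mul (hf : IsTestFunction f) (hg : IsTestFunction g) :
    Integrable (fun ω => linStat (N ω) f * linStat (N ω) g) P := by
  simpa using integrable_mul_mul_of_memLp (memLp_linStat hN hmom hf) (memLp_linStat hN hmom hg)
    (memLp_const (1 : ℝ))

omit [IsProbabilityMeasure P] in
theorem integrable_linStat_mul_mul (hf : IsTestFunction f) (hg : IsTestFunction g)
    (hk : IsTestFunction k) :
    Integrable (fun ω => linStat (N ω) f * linStat (N ω) g * linStat (N ω) k) P :=
  integrable_mul_mul_of_memLp (memLp_linStat hN hmom hf) (memLp_linStat hN hmom hg)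
    (memLp_linStat hN hmom hk)

theorem integrable_pairSum (hf : IsTestFunction f) (hg : IsTestFunction g) :
    Integrable (fun ω => pairSum (N ω) f g) P :=
  (integrable_linStat_mul hN hmom hf hg).sub (integrable_linStat hN hmom (hf.mul hg))

theorem integrable_tripleSum (hf : IsTestFunction f) (hg : IsTestFunction g)
    (hk : IsTestFunction k) : Integrable (fun ω => tripleSum (N ω) f g k) P :=
  ((((integrable_linStat_mul_mul hN hmom hf hg hk).sub
    (integrable_linStat_mul hN hmom (hf.mul hg) hk)).sub
    (integrable_linStat_mul hN hmom (hf.mul hk) hg)).sub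
    (integrable_linStat_mul hN hmom (hg.mul hk) hf)).add
    ((integrable_linStat hN hmom ((hf.mul hg).mul hk)).const_mul 2)

theorem factorialMoment₁_sub (hf : IsTestFunction f) (hf' : IsTestFunction f') :
    factorialMoment₁ P N (fun x => f x - f' x) = factorialMoment₁ P N f - factorialMoment₁ P N f' := by
  rw [factorialMoment₁, factorialMoment₁, factorialMoment₁, ← integral_sub
    (integrable_linStat hN hmom hf) (integrable_linStat hN hmom hf')]
  refine integral_congr_ae ?_
  filter_upwards [ae_integrable hN hmom hf, ae_integrable hN hmom hf'] with ω h1 h2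
  exact integral_sub h1 h2

theorem factorialMoment₂_sub (hf : IsTestFunction f) (hf' : IsTestFunction f')
    (hg : IsTestFunction g) : factorialMoment₂ P N (fun x => f x - f' x) g =
      factorialMoment₂ P N f g - factorialMoment₂ P N f' g := by
  rw [factorialMoment₂, factorialMoment₂, factorialMoment₂, ← integral_sub
    (integrable_pairSum hN hmom hf hg) (integrable_pairSum hN hmom hf' hg)]
  refine integral_congr_ae ?_
  filter_upwards [ae_integrable hN hmom hf, ae_integrable hN hmom hf',
    ae_integrable hN hmom (hf.mul hg), ae_integrable hN hmom (hf'.mul hg)] with ω h1 h2 h3 h4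
  simp only [pairSum, linStat, sub_mul]
  rw [integral_sub h1 h2, integral_sub h3 h4]
  ring

theorem factorialMoment₃_sub (hf : IsTestFunction f) (hf' : IsTestFunction f')
    (hg : IsTestFunction g) (hk : IsTestFunction k) :
    factorialMoment₃ P N (fun x => f x - f' x) g k =
      factorialMoment₃ P N f g k - factorialMoment₃ P N f' g k := by
  rw [factorialMoment₃, factorialMoment₃, factorialMoment₃, ← integral_sub
    (integrable_tripleSum hN hmom hf hg hk) (integrable_tripleSum hN hmom hf' hg hk)]
  refine integral_congr_ae ?_
  filter_upwards [ae_integrable hN hmom hf, ae_integrable hN hmom hf',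
    ae_integrable hN hmom (hf.mul hg), ae_integrable hN hmom (hf'.mul hg),
    ae_integrable hN hmom (hf.mul hk), ae_integrable hN hmom (hf'.mul hk),
    ae_integrable hN hmom ((hf.mul hg).mul hk), ae_integrable hN hmom ((hf'.mul hg).mul hk)]
    with ω h1 h2 h3 h4 h5 h6 h7 h8
  simp only [tripleSum, linStat, sub_mul]
  rw [integral_sub h1 h2, integral_sub h3 h4, integral_sub h5 h6, integral_sub h7 h8]
  ring

/-- Linearity in the other two arguments follows from this by symmetry, so the density formula need
only be checked on nonnegative test functions. -/
theorem factorialCumulant₃_sub (hf : IsTestFunction f) (hf' : IsTestFunction f')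
    (hg : IsTestFunction g) (hk : IsTestFunction k) :
    factorialCumulant₃ P N (fun x => f x - f' x) g k =
      factorialCumulant₃ P N f g k - factorialCumulant₃ P N f' g k := by
  simp only [factorialCumulant₃, factorialCumulant₂]
  rw [factorialMoment₃_sub hN hmom hf hf' hg hk, factorialMoment₂_sub hN hmom hf hf' hg,
    factorialMoment₂_sub hN hmom hf hf' hk, factorialMoment₁_sub hN hmom hf hf']
  ring

end Cumulant

/-! ### Symmetry of the factorial cumulants. -/

section Symmetry

variable {Ω : Type*} [MeasurableSpace Ω] (P : Measure Ω) (N : Ω → Measure ℝ) (f g k : ℝ → ℝ)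

theorem factorialCumulant₂_comm : factorialCumulant₂ P N f g = factorialCumulant₂ P N g f := by
  simp only [factorialCumulant₂, factorialMoment₂, pairSum, mul_comm]

theorem factorialCumulant₃_swap_left :
    factorialCumulant₃ P N f g k = factorialCumulant₃ P N g f k := by
  have h : factorialMoment₃ P N f g k = factorialMoment₃ P N g f k := by
    refine integral_congr_ae (Eventually.of_forall fun ω => ?_)
    simp only [tripleSum, mul_comm (g _) (f _)]
    ring
  rw [factorialCumulant₃, factorialCumulant₃, h, factorialCumulant₂_comm P N f g]
  ring

theorem factorialCumulant₃_swap_right :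
    factorialCumulant₃ P N f g k = factorialCumulant₃ P N f k g := by
  have h : factorialMoment₃ P N f g k = factorialMoment₃ P N f k g := by
    refine integral_congr_ae (Eventually.of_forall fun ω => ?_)
    simp only [tripleSum, mul_comm (k _) (g _), mul_right_comm (f _) (k _) (g _)]
    ring
  rw [factorialCumulant₃, factorialCumulant₃, h, factorialCumulant₂_comm P N g k]
  ring

end Symmetry

/-! ### Cumulants of the cluster process -/

section ClusterCumulant

variable {Ω : Type*} [MeasurableSpace Ω] {P : Measure Ω} {ν m : ℝ≥0} {h : ℝ → ℝ}
  {U : ℕ → Ω → ℝ} {ξ : ℕ × List ℕ → Ω → ℕ × ℝ} {f g k : ℝ → ℝ}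
  [IsProbabilityMeasure P] (hh : IsDelayDensity h) (hmodel : IsBranchingModel P ν m h U ξ)
  (hm : m < 1)
include hh hmodel hm

theorem lintegral_clusterProcess_cube_lt_top {K : Set ℝ} (hK : IsCompact K) :
    ∫⁻ ω, (clusterProcess U ξ ω K) ^ 3 ∂P < ∞ := by
  have := hh.isProbabilityMeasure
  have hf : IsNiceFunction (K.indicator 1) := by
    refine ⟨measurable_one.indicator hK.measurableSet, ⟨1, ENNReal.one_ne_top, fun x =>
      indicator_le_self' (by simp) x⟩, ?_⟩
    rw [lintegral_indicator_one hK.measurableSet]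
    exact hK.measure_ne_top
  have key := lintegral_clusterProcess_mul_mul hh hmodel hm hf hf hf
  simp only [lintegral_indicator_one hK.measurableSet] at key
  have e : ∀ x : ℝ≥0∞, x ^ 3 = x * x * x := fun x => by ring
  simp_rw [e]
  rw [key, lt_top_iff_ne_top]
  have i1 := intensity₁_ne_top (ν := ν) (D := delayLaw h) hm hf
  have i2 := intensity₁_ne_top (ν := ν) (D := delayLaw h) hm (hf.mul hf)
  have i3 := intensity₁_ne_top (ν := ν) (D := delayLaw h) hm ((hf.mul hf).mul hf)
  have i4 := intensity₂_ne_top (ν := ν) (D := delayLaw h) hm hf hf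
  have i5 := intensity₂_ne_top (ν := ν) (D := delayLaw h) hm (hf.mul hf) hf
  have i6 := intensity₃_ne_top (ν := ν) (D := delayLaw h) hm hf hf hf
  finiteness

omit hh hmodel hm [IsProbabilityMeasure P] [MeasurableSpace Ω] in
theorem linStat_eq_toReal (μ : Measure ℝ) (hf : Measurable f) (pf : ∀ x, 0 ≤ f x) :
    linStat μ f = (∫⁻ x, ENNReal.ofReal (f x) ∂μ).toReal :=
  integral_eq_lintegral_of_nonneg_ae (Eventually.of_forall pf) hf.aestronglyMeasurable

omit hh hmodel hm [IsProbabilityMeasure P] in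
theorem integrable_and_integral_toReal {X : Ω → ℝ≥0∞} {x : ℝ≥0∞} (hX : Measurable X)
    (hx : ∫⁻ ω, X ω ∂P = x) (hfin : x ≠ ∞) :
    Integrable (fun ω => (X ω).toReal) P ∧ ∫ ω, (X ω).toReal ∂P = x.toReal := by
  have h1 : ∫⁻ ω, X ω ∂P ≠ ∞ := hx ▸ hfin
  exact ⟨integrable_toReal_of_lintegral_ne_top hX.aemeasurable h1, by
    rw [integral_toReal hX.aemeasurable (ae_lt_top hX h1), hx]⟩

/-- The corrections in `tripleSum` remove the terms in which points coincide, and those in the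
cumulant remove the products of lower intensities; only triples inside one cluster survive.
Nonnegativity lets the real integrals be computed in `ℝ≥0∞`. -/
theorem factorialCumulant₃_clusterProcess_eq_toReal (hf : IsTestFunction f) (hg : IsTestFunction g)
    (hk : IsTestFunction k) (pf : ∀ x, 0 ≤ f x) (pg : ∀ x, 0 ≤ g x) (pk : ∀ x, 0 ≤ k x) :
    factorialCumulant₃ P (clusterProcess U ξ) f g k =
      (intensity₃ ν m (delayLaw h) (fun x => ENNReal.ofReal (f x)) (fun x => ENNReal.ofReal (g x))
        fun x => ENNReal.ofReal (k x)).toReal := by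
  have := hh.isProbabilityMeasure
  have hN := measurable_clusterProcess hmodel
  set D := delayLaw h
  set N := clusterProcess U ξ
  have mL : ∀ {φ : ℝ → ℝ}, Measurable φ → Measurable fun ω => ∫⁻ x, ENNReal.ofReal (φ x) ∂(N ω) :=
    fun hφ => (Measure.measurable_lintegral hφ.ennreal_ofReal).comp hN
  have M1 : ∀ {φ : ℝ → ℝ}, IsTestFunction φ → (∀ x, 0 ≤ φ x) →
      Integrable (fun ω => linStat (N ω) φ) P ∧ ∫ ω, linStat (N ω) φ ∂P =
        (intensity₁ ν m D fun x => ENNReal.ofReal (φ x)).toReal := fun hφ pφ => by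
    simp_rw [linStat_eq_toReal _ hφ.measurable pφ]
    exact integrable_and_integral_toReal (mL hφ.measurable)
      (lintegral_clusterProcess_linear hh hmodel hφ.isNiceFunction.measurable)
      (intensity₁_ne_top hm hφ.isNiceFunction)
  have M2 : ∀ {φ ψ : ℝ → ℝ}, IsTestFunction φ → IsTestFunction ψ → (∀ x, 0 ≤ φ x) →
      (∀ x, 0 ≤ ψ x) → Integrable (fun ω => linStat (N ω) φ * linStat (N ω) ψ) P ∧
        ∫ ω, linStat (N ω) φ * linStat (N ω) ψ ∂P =
        (intensity₁ ν m D fun x => ENNReal.ofReal (φ x)).toReal *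
          (intensity₁ ν m D fun x => ENNReal.ofReal (ψ x)).toReal +
        ((intensity₂ ν m D (fun x => ENNReal.ofReal (φ x)) fun x => ENNReal.ofReal (ψ x)).toReal +
          (intensity₁ ν m D fun x => ENNReal.ofReal (φ x * ψ x)).toReal) := fun hφ hψ pφ pψ => by
    have nφ := hφ.isNiceFunction
    have nψ := hψ.isNiceFunction
    have i1 := intensity₁_ne_top (ν := ν) (D := D) hm nφ
    have i2 := intensity₁_ne_top (ν := ν) (D := D) hm nψ
    have i3 := intensity₁_ne_top (ν := ν) (D := D) hm (nφ.mul nψ)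
    have i4 := intensity₂_ne_top (ν := ν) (D := D) hm nφ nψ
    simp_rw [linStat_eq_toReal _ hφ.measurable pφ, linStat_eq_toReal _ hψ.measurable pψ,
      ENNReal.ofReal_mul (pφ _), ← ENNReal.toReal_mul]
    have := integrable_and_integral_toReal ((mL hφ.measurable).mul (mL hψ.measurable))
      (lintegral_clusterProcess_mul hh hmodel hm nφ nψ) (by finiteness)
    rw [ENNReal.toReal_add (by finiteness) (by finiteness), ENNReal.toReal_add i4 i3] at this
    exact this
  have nf := hf.isNiceFunction
  have ng := hg.isNiceFunction
  have nk := hk.isNiceFunction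
  have i1 := intensity₁_ne_top (ν := ν) (D := D) hm nf
  have i2 := intensity₁_ne_top (ν := ν) (D := D) hm ng
  have i3 := intensity₁_ne_top (ν := ν) (D := D) hm nk
  have i12 := intensity₁_ne_top (ν := ν) (D := D) hm (nf.mul ng)
  have i13 := intensity₁_ne_top (ν := ν) (D := D) hm (nf.mul nk)
  have i23 := intensity₁_ne_top (ν := ν) (D := D) hm (ng.mul nk)
  have i123 := intensity₁_ne_top (ν := ν) (D := D) hm ((nf.mul ng).mul nk)
  have j12 := intensity₂_ne_top (ν := ν) (D := D) hm nf ng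
  have j13 := intensity₂_ne_top (ν := ν) (D := D) hm nf nk
  have j23 := intensity₂_ne_top (ν := ν) (D := D) hm ng nk
  have k1 := intensity₂_ne_top (ν := ν) (D := D) hm (nf.mul ng) nk
  have k2 := intensity₂_ne_top (ν := ν) (D := D) hm (nf.mul nk) ng
  have k3 := intensity₂_ne_top (ν := ν) (D := D) hm (ng.mul nk) nf
  have l := intensity₃_ne_top (ν := ν) (D := D) hm nf ng nk
  have M3 := integrable_and_integral_toReal (X := fun ω => (∫⁻ x, ENNReal.ofReal (f x) ∂(N ω)) *
    (∫⁻ x, ENNReal.ofReal (g x) ∂(N ω)) * ∫⁻ x, ENNReal.ofReal (k x) ∂(N ω))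
    (((mL hf.measurable).mul (mL hg.measurable)).mul (mL hk.measurable))
    (lintegral_clusterProcess_mul_mul hh hmodel hm nf ng nk) (by finiteness)
  rw [ENNReal.toReal_add (by finiteness) (by finiteness),
    ENNReal.toReal_add (by finiteness) (by finiteness),
    ENNReal.toReal_add (by finiteness) (by finiteness),
    ENNReal.toReal_add (by finiteness) (by finiteness),
    ENNReal.toReal_add (by finiteness) (by finiteness),
    ENNReal.toReal_add (by finiteness) (by finiteness),
    ENNReal.toReal_add (by finiteness) (by finiteness),
    ENNReal.toReal_add (by finiteness) (by finiteness)] at M3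
  simp only [ENNReal.toReal_mul] at M3
  rw [ENNReal.toReal_add (by finiteness) (by finiteness),
    ENNReal.toReal_add (by finiteness) (by finiteness),
    ENNReal.toReal_add (by finiteness) (by finiteness)] at M3
  simp only [← linStat_eq_toReal _ hf.measurable pf, ← linStat_eq_toReal _ hg.measurable pg,
    ← linStat_eq_toReal _ hk.measurable pk] at M3
  have pfg : ∀ x, 0 ≤ f x * g x := fun x => mul_nonneg (pf x) (pg x)
  have pfk : ∀ x, 0 ≤ f x * k x := fun x => mul_nonneg (pf x) (pk x)
  have pgk : ∀ x, 0 ≤ g x * k x := fun x => mul_nonneg (pg x) (pk x)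
  have hfg := hf.mul hg
  have hfk := hf.mul hk
  have hgk := hg.mul hk
  have pfgk : ∀ x, 0 ≤ f x * g x * k x := fun x => mul_nonneg (pfg x) (pk x)
  have T : factorialMoment₃ P N f g k =
      ∫ ω, linStat (N ω) f * linStat (N ω) g * linStat (N ω) k ∂P
        - ∫ ω, linStat (N ω) (fun x => f x * g x) * linStat (N ω) k ∂P
        - ∫ ω, linStat (N ω) (fun x => f x * k x) * linStat (N ω) g ∂P
        - ∫ ω, linStat (N ω) (fun x => g x * k x) * linStat (N ω) f ∂P
        + 2 * ∫ ω, linStat (N ω) (fun x => f x * g x * k x) ∂P := by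
    rw [factorialMoment₃, ← integral_const_mul, ← integral_sub M3.1 (M2 hfg hk pfg pk).1,
      ← integral_sub ?_ (M2 hfk hg pfk pg).1, ← integral_sub ?_ (M2 hgk hf pgk pf).1,
      ← integral_add ?_ ((M1 (hfg.mul hk) pfgk).1.const_mul 2)]
    · rfl
    · exact ((M3.1.sub (M2 hfg hk pfg pk).1).sub (M2 hfk hg pfk pg).1).sub (M2 hgk hf pgk pf).1
    · exact (M3.1.sub (M2 hfg hk pfg pk).1).sub (M2 hfk hg pfk pg).1
    · exact M3.1.sub (M2 hfg hk pfg pk).1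
  have T2 : ∀ {φ ψ : ℝ → ℝ}, IsTestFunction φ → IsTestFunction ψ → (∀ x, 0 ≤ φ x) →
      (∀ x, 0 ≤ ψ x) → factorialCumulant₂ P N φ ψ = (intensity₂ ν m D
        (fun x => ENNReal.ofReal (φ x)) fun x => ENNReal.ofReal (ψ x)).toReal :=
    fun {φ ψ} hφ hψ pφ pψ => by
      have pφψ : ∀ x, 0 ≤ φ x * ψ x := fun x => mul_nonneg (pφ x) (pψ x)
      simp only [factorialCumulant₂, factorialMoment₂, factorialMoment₁, pairSum]
      rw [integral_sub (M2 hφ hψ pφ pψ).1 (M1 (hφ.mul hψ) pφψ).1, (M2 hφ hψ pφ pψ).2,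
        (M1 (hφ.mul hψ) pφψ).2, (M1 hφ pφ).2, (M1 hψ pψ).2]
      ring
  rw [factorialCumulant₃, T, M3.2, (M2 hfg hk pfg pk).2,
    (M2 hfk hg pfk pg).2, (M2 hgk hf pgk pf).2, (M1 (hfg.mul hk) pfgk).2, T2 hf hg pf pg, T2 hf hk pf pk, T2 hg hk pg pk, factorialMoment₁,
    factorialMoment₁, factorialMoment₁, (M1 hf pf).2, (M1 hg pg).2, (M1 hk pk).2]
  simp only [ENNReal.ofReal_mul (pf _), ENNReal.ofReal_mul (pg _), ENNReal.ofReal_mul (pfg _)]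
  have e1 : ∀ x, ENNReal.ofReal (g x) * ENNReal.ofReal (k x) * ENNReal.ofReal (f x) =
    ENNReal.ofReal (f x) * ENNReal.ofReal (g x) * ENNReal.ofReal (k x) := fun x => by ring
  have e2 : ∀ x, ENNReal.ofReal (f x) * ENNReal.ofReal (k x) * ENNReal.ofReal (g x) =
    ENNReal.ofReal (f x) * ENNReal.ofReal (g x) * ENNReal.ofReal (k x) := fun x => by ring
  simp only [ENNReal.ofReal_mul (pfk _), ENNReal.ofReal_mul (pgk _), e1, e2,
    ENNReal.ofReal_mul (pf _), ENNReal.ofReal_mul (pg _)]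
  ring

end ClusterCumulant

/-! ### Absolute continuity of the lags between individuals -/

/-- Changing the mark at `x` can move only `x` and its descendants, and a different word that is no
longer than `x` is not a descendant. -/
theorem pos_update_of_length_le {x v : List ℕ} (hxv : v ≠ x) (hl : v.length ≤ x.length) (ξ : Marks)
    (e : ℕ × ℝ) : pos (Function.update ξ x e) v = pos ξ v := by
  induction v generalizing x ξ with
  | nil => rfl
  | cons j w ih =>
    cases x with
    | nil => simp at hl
    | cons i y =>
      rw [pos_cons, pos_cons]
      by_cases hij : i = j
      · subst hij
        have hwy : w ≠ y := fun h => hxv (h ▸ rfl)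
        have e1 : subMarks i (Function.update ξ (i :: y) e) =
            Function.update (subMarks i ξ) y e := by
          funext u
          by_cases hu : u = y <;> simp [subMarks, hu]
        have hy : [] ≠ y := fun h => by
          subst h
          simp at hl
          exact hwy hl
        rw [e1, ih hwy (by simpa using hl), Function.update_of_ne hy]
      · have e1 : subMarks j (Function.update ξ (i :: y) e) = subMarks j ξ := by
          funext u
          exact Function.update_of_ne (fun h => hij (List.cons.inj h).1.symm) _ _
        rw [e1]

theorem pos_update_self {x : List ℕ} (hx : x ≠ []) (ξ : Marks) (e : ℕ × ℝ) :
    pos (Function.update ξ x e) x = pos ξ x - (ξ x).2 + e.2 := by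
  induction x generalizing ξ with
  | nil => exact absurd rfl hx
  | cons j w ih =>
    have e1 : subMarks j (Function.update ξ (j :: w) e) = Function.update (subMarks j ξ) w e := by
      funext u
      by_cases hu : u = w <;> simp [subMarks, hu]
    rw [pos_cons, pos_cons, e1]
    by_cases hw : w = []
    · subst hw
      simp [subMarks]
    · rw [ih hw, Function.update_of_ne (Ne.symm hw)]
      simp only [subMarks]
      ring

section AbsolutelyContinuous

variable {m : ℝ≥0} {D : Measure ℝ} [IsProbabilityMeasure D]

/-- Resampling one mark keeps the law, so a single displacement can be integrated out with all the
others frozen. -/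
theorem measurePreserving_update (x : List ℕ) :
    MeasurePreserving (fun p : Marks × (ℕ × ℝ) => Function.update p.1 x p.2)
      ((treeLaw m D).prod (markLaw m D)) (treeLaw m D) := by
  have hm : Measurable fun p : Marks × (ℕ × ℝ) => Function.update p.1 x p.2 := by
    refine measurable_pi_lambda _ fun v => ?_
    by_cases hv : v = x
    · subst hv
      simpa using measurable_snd
    · simp only [Function.update_of_ne hv]
      exact (measurable_pi_apply v).comp measurable_fst
  refine ⟨hm, Measure.eq_infinitePi _ fun s t ht => ?_⟩
  rw [Measure.map_apply hm (MeasurableSet.pi s.countable_toSet fun i _ => ht i)]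
  have e1 : (fun p : Marks × (ℕ × ℝ) => Function.update p.1 x p.2) ⁻¹' Set.pi s t =
      (Set.pi (s.erase x : Finset (List ℕ)) t) ×ˢ (if x ∈ s then t x else univ) := by
    ext p
    simp only [mem_preimage, Set.mem_pi, Finset.mem_coe, mem_prod, Finset.mem_erase]
    constructor
    · intro h
      refine ⟨fun i hi => by simpa [hi.1] using h i hi.2, ?_⟩
      split_ifs with hx
      · simpa using h x hx
      · trivial
    · rintro ⟨h1, h2⟩ i hi
      by_cases hix : i = x
      · subst hix
        simpa [hi] using h2
      · simpa [hix] using h1 i ⟨hix, hi⟩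
  rw [e1, Measure.prod_prod, treeLaw, Measure.infinitePi_pi _ fun i _ => ht i]
  split_ifs with hx
  · rw [Finset.prod_erase_mul _ _ hx]
  · rw [measure_univ, mul_one, Finset.erase_eq_of_notMem hx]

variable (hD : D ≪ volume)
include hD

theorem markLaw_preimage_eq_zero {s : ℝ} (hs : s ≠ 0) (b : ℝ) {A : Set ℝ}
    (h0 : volume A = 0) : markLaw m D {e | b + s * e.2 ∈ A} = 0 := by
  have h1 : volume ((fun x => s * x) ⁻¹' ((fun x => b + x) ⁻¹' A)) = 0 := by
    rw [Real.volume_preimage_mul_left hs, measure_preimage_add, h0, mul_zero]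
  have h2 : {e : ℕ × ℝ | b + s * e.2 ∈ A} = univ ×ˢ ((fun x => s * x) ⁻¹' ((fun x => b + x) ⁻¹' A)) := by
    ext e
    simp
  rw [h2, markLaw, Measure.prod_prod, hD h1, mul_zero]

/-- With the other marks frozen, `Y` is a nonconstant affine function of one displacement and
charges no null set; Fubini concludes. -/
theorem map_absolutelyContinuous_of_update {Y B : Marks → ℝ} (hY : Measurable Y) (x : List ℕ) {s : ℝ}
    (hs : s ≠ 0) (h : ∀ ξ e, Y (Function.update ξ x e) = B ξ + s * e.2) :
    (treeLaw m D).map Y ≪ volume := by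
  refine Measure.AbsolutelyContinuous.mk fun A hA h0 => ?_
  rw [Measure.map_apply hY hA, ← (measurePreserving_update x).measure_preimage
    (hY hA).nullMeasurableSet, Measure.measure_prod_null
    ((measurePreserving_update (m := m) (D := D) x).measurable (hY hA))]
  refine Eventually.of_forall fun ξ => ?_
  have : Prod.mk ξ ⁻¹' ((fun p : Marks × (ℕ × ℝ) => Function.update p.1 x p.2) ⁻¹' (Y ⁻¹' A)) =
      {e | B ξ + s * e.2 ∈ A} := by
    ext e
    simp [h]
  refine (congrArg _ this).trans ?_
  exact markLaw_preimage_eq_zero hD hs _ h0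

/-- Almost every section of a planar null set is null. The law of `X` avoids the exceptional
sections, and resampling the mark at `x` moves `Y` alone, inside a null section. -/
theorem map_prodMk_absolutelyContinuous_of_update {X Y B : Marks → ℝ} (hX : Measurable X)
    (hY : Measurable Y) (hXa : (treeLaw m D).map X ≪ volume) (x : List ℕ) {s : ℝ} (hs : s ≠ 0)
    (hXu : ∀ ξ e, X (Function.update ξ x e) = X ξ)
    (h : ∀ ξ e, Y (Function.update ξ x e) = B ξ + s * e.2) :
    (treeLaw m D).map (fun ξ => (X ξ, Y ξ)) ≪ volume := by
  refine Measure.AbsolutelyContinuous.mk fun A hA h0 => ?_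
  have hXY := hX.prodMk hY
  rw [Measure.map_apply hXY hA, ← (measurePreserving_update x).measure_preimage
    (hXY hA).nullMeasurableSet, Measure.measure_prod_null
    ((measurePreserving_update (m := m) (D := D) x).measurable (hXY hA))]
  rw [Measure.volume_eq_prod, Measure.measure_prod_null hA] at h0
  filter_upwards [ae_of_ae_map hX.aemeasurable (hXa.ae_le h0)] with ξ hξ
  have : Prod.mk ξ ⁻¹' ((fun p : Marks × (ℕ × ℝ) => Function.update p.1 x p.2) ⁻¹'
      ((fun ξ => (X ξ, Y ξ)) ⁻¹' A)) = {e | B ξ + s * e.2 ∈ Prod.mk (X ξ) ⁻¹' A} := by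
    ext e
    simp [h, hXu]
  refine (congrArg _ this).trans ?_
  exact markLaw_preimage_eq_zero hD hs _ hξ

/-- The longer of the two words is resampled; it is not the root, and its displacement does not
affect the other word. -/
theorem map_pos_sub_pos_absolutelyContinuous {v w : List ℕ} (hvw : v ≠ w) :
    (treeLaw m D).map (fun ξ => pos ξ w - pos ξ v) ≪ volume := by
  have hY : Measurable fun ξ => pos ξ w - pos ξ v := (measurable_pos w).sub (measurable_pos v)
  rcases le_total v.length w.length with hl | hl
  · have hw : w ≠ [] := fun h => hvw (by subst h; simpa using hl)
    refine map_absolutelyContinuous_of_update hD hY w one_ne_zero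
      (B := fun ξ => pos ξ w - (ξ w).2 - pos ξ v) fun ξ e => ?_
    rw [pos_update_self hw, pos_update_of_length_le hvw hl]
    ring
  · have hv : v ≠ [] := fun h => hvw (by subst h; exact (by simpa using hl : w = []).symm)
    refine map_absolutelyContinuous_of_update hD hY v (s := -1) (by norm_num)
      (B := fun ξ => pos ξ w - (pos ξ v - (ξ v).2)) fun ξ e => ?_
    rw [pos_update_self hv, pos_update_of_length_le hvw.symm hl]
    ring

/-- The lags of the individuals `w` and `r` with respect to the individual `v`. -/
noncomputable def lag (v w r : List ℕ) (ξ : Marks) : ℝ × ℝ := (pos ξ w - pos ξ v, pos ξ r - pos ξ v)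

omit hD in
theorem measurable_lag (v w r : List ℕ) : Measurable (lag v w r) :=
  ((measurable_pos w).sub (measurable_pos v)).prodMk ((measurable_pos r).sub (measurable_pos v))

theorem map_lag_absolutelyContinuous_of_length_le {v w r : List ℕ} (hvw : v ≠ w) (hvr : v ≠ r)
    (hwr : w ≠ r) (hv : v.length ≤ r.length) (hw : w.length ≤ r.length) :
    (treeLaw m D).map (lag v w r) ≪ volume := by
  have hr : r ≠ [] := fun h => hvr (by subst h; simpa using hv)
  refine map_prodMk_absolutelyContinuous_of_update hD ((measurable_pos w).sub (measurable_pos v))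
    ((measurable_pos r).sub (measurable_pos v)) (map_pos_sub_pos_absolutelyContinuous hD hvw) r
    one_ne_zero (B := fun ξ => pos ξ r - (ξ r).2 - pos ξ v) (fun ξ e => ?_) fun ξ e => ?_
  · rw [pos_update_of_length_le hwr hw, pos_update_of_length_le hvr hv]
  · rw [pos_update_self hr, pos_update_of_length_le hvr hv]
    ring

theorem map_lag_absolutelyContinuous {v w r : List ℕ} (hvw : v ≠ w) (hvr : v ≠ r) (hwr : w ≠ r) :
    (treeLaw m D).map (lag v w r) ≪ volume := by
  by_cases h1 : v.length ≤ r.length ∧ w.length ≤ r.length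
  · exact map_lag_absolutelyContinuous_of_length_le hD hvw hvr hwr h1.1 h1.2
  by_cases h2 : v.length ≤ w.length ∧ r.length ≤ w.length
  · have h := (map_lag_absolutelyContinuous_of_length_le (m := m) hD hvr hvw hwr.symm h2.1 h2.2).map
      measurable_swap
    rw [Measure.map_map measurable_swap (measurable_lag v r w), Measure.volume_eq_prod,
      Measure.prod_swap] at h
    exact h
  -- When the reference individual `v` is the longest word, resampling it moves both lags. The pair
  -- `(r - w, w - v)` has only one moving coordinate and is related to the lags by a shear.
  · have hv : r.length ≤ v.length ∧ w.length ≤ v.length := by omega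
    have hv0 : v ≠ [] := fun h => hvr (by subst h; exact (by simpa using hv.1 : r = []).symm)
    have h : (treeLaw m D).map (fun ξ => (pos ξ r - pos ξ w, pos ξ w - pos ξ v)) ≪ volume := by
      refine map_prodMk_absolutelyContinuous_of_update hD ((measurable_pos r).sub (measurable_pos w))
        ((measurable_pos w).sub (measurable_pos v)) (map_pos_sub_pos_absolutelyContinuous hD hwr) v
        (s := -1) (by norm_num) (B := fun ξ => pos ξ w - (pos ξ v - (ξ v).2)) (fun ξ e => ?_)
        fun ξ e => ?_
      · rw [pos_update_of_length_le hvr.symm hv.1,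
          pos_update_of_length_le hvw.symm hv.2]
      · rw [pos_update_self hv0, pos_update_of_length_le hvw.symm hv.2]
        ring
    have hm : Measurable fun ξ => (pos ξ r - pos ξ w, pos ξ w - pos ξ v) :=
      ((measurable_pos r).sub (measurable_pos w)).prodMk ((measurable_pos w).sub (measurable_pos v))
    -- The shear `(x, y) ↦ (y, y + x)` takes that pair back to the lags.
    have hT := measurePreserving_prod_add_swap (volume : Measure ℝ) (volume : Measure ℝ)
    have h' := h.map hT.measurable
    rw [Measure.volume_eq_prod, hT.map_eq, Measure.map_map hT.measurable hm] at h'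
    refine (Measure.map_congr (Eventually.of_forall fun ξ => ?_)).absolutelyContinuous.trans h'
    simp [lag]

end AbsolutelyContinuous

/-! ### The measure of the lags in a cluster, and its density -/

section LagMeasure

variable (m : ℝ≥0) (D : Measure ℝ) [IsProbabilityMeasure D]

/-- The expected number of triples of distinct individuals of a cluster with given lags. -/
noncomputable def lagMeasure : Measure (ℝ × ℝ) :=
  Measure.sum fun q : List ℕ × List ℕ × List ℕ =>
    if q.1 ≠ q.2.1 ∧ q.1 ≠ q.2.2 ∧ q.2.1 ≠ q.2.2 then
      ((treeLaw m D).withDensity fun ξ => aliveInd ξ q.1 * aliveInd ξ q.2.1 * aliveInd ξ q.2.2).map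
        (lag q.1 q.2.1 q.2.2)
    else 0

variable {m D}

theorem lintegral_lagMeasure {F : ℝ × ℝ → ℝ≥0∞} (hF : Measurable F) :
    ∫⁻ τ, F τ ∂(lagMeasure m D) = ∫⁻ ξ, ∑' v, ∑' w, ∑' r, (if v ≠ w ∧ v ≠ r ∧ w ≠ r then
      aliveInd ξ v * aliveInd ξ w * aliveInd ξ r * F (lag v w r ξ) else 0) ∂(treeLaw m D) := by
  have ha : ∀ v w r, Measurable fun ξ => aliveInd ξ v * aliveInd ξ w * aliveInd ξ r := fun v w r =>
    ((measurable_aliveInd v).mul (measurable_aliveInd w)).mul (measurable_aliveInd r)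
  have hm : ∀ v w r, Measurable fun ξ => if v ≠ w ∧ v ≠ r ∧ w ≠ r then
      aliveInd ξ v * aliveInd ξ w * aliveInd ξ r * F (lag v w r ξ) else 0 := fun v w r => by
    split_ifs
    · exact (ha v w r).mul (hF.comp (measurable_lag v w r))
    · exact measurable_const
  rw [lagMeasure, lintegral_sum_measure, ENNReal.tsum_prod', lintegral_tsum fun v =>
    (Measurable.tsum fun w => Measurable.tsum fun r => hm v w r).aemeasurable]
  refine tsum_congr fun v => ?_
  rw [ENNReal.tsum_prod', lintegral_tsum fun w => (Measurable.tsum fun r => hm v w r).aemeasurable]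
  refine tsum_congr fun w => ?_
  rw [lintegral_tsum fun r => (hm v w r).aemeasurable]
  refine tsum_congr fun r => ?_
  dsimp only
  split_ifs
  · rw [lintegral_map hF (measurable_lag v w r)]
    exact lintegral_withDensity_eq_lintegral_mul _ (ha v w r) (hF.comp (measurable_lag v w r))
  · simp

/-- The total mass is the mean number of ordered triples of distinct individuals, at most the third
moment of the size. -/
theorem lagMeasure_univ_ne_top (hm : m < 1) : lagMeasure m D univ ≠ ∞ := by
  rw [← setLIntegral_one, setLIntegral_univ, lintegral_lagMeasure measurable_const]
  refine ne_top_of_le_ne_top (lintegral_size_cube_ne_top (D := D) hm) (lintegral_mono fun ξ => ?_)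
  have h := tsum_mul_tsum_mul_tsum_eq_tripleTsum (aliveInd ξ) (aliveInd ξ) (aliveInd ξ)
  simp only [size, h, mul_one]
  exact (le_add_right le_rfl).trans (le_add_right le_rfl)

theorem isFiniteMeasure_lagMeasure (hm : m < 1) : IsFiniteMeasure (lagMeasure m D) :=
  ⟨lt_top_iff_ne_top.2 (lagMeasure_univ_ne_top hm)⟩

theorem lagMeasure_absolutelyContinuous (hD : D ≪ volume) : lagMeasure m D ≪ volume := by
  refine Measure.absolutelyContinuous_sum_left fun q => ?_
  split_ifs with h
  · exact ((withDensity_absolutelyContinuous _ _).map (measurable_lag _ _ _)).trans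
      (map_lag_absolutelyContinuous hD h.1 h.2.1 h.2.2)
  · exact Measure.AbsolutelyContinuous.zero _

/-- For each triple, the root position is translated so that `t` becomes the position of the first
individual; the other two then enter only through their lags. -/
theorem intensity₃_eq_lintegral_lagMeasure (hm : m < 1) {ν : ℝ≥0} {f g k : ℝ → ℝ≥0∞}
    (hf : Measurable f) (hg : Measurable g) (hk : Measurable k) :
    intensity₃ ν m D f g k =
      ν * ∫⁻ t, ∫⁻ τ, f t * g (t + τ.1) * k (t + τ.2) ∂(lagMeasure m D) := by
  have := isFiniteMeasure_lagMeasure (D := D) hm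
  have hF : Measurable fun p : (ℝ × ℝ) × ℝ => f p.2 * g (p.2 + p.1.1) * k (p.2 + p.1.2) := by
    fun_prop
  rw [intensity₃, lintegral_lintegral_swap (measurable_tripleTsum_clusterTerm hf hg hk).aemeasurable,
    lintegral_lintegral_swap (f := fun t (τ : ℝ × ℝ) => f t * g (t + τ.1) * k (t + τ.2))
      (Measurable.aemeasurable (by fun_prop)), lintegral_lagMeasure hF.lintegral_prod_right']
  congr 1
  refine lintegral_congr fun ξ => ?_
  have hF' : ∀ τ : ℝ × ℝ, Measurable fun t => f t * g (t + τ.1) * k (t + τ.2) := fun τ => by fun_prop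
  have hm : ∀ v w r, Measurable fun u => if v ≠ w ∧ v ≠ r ∧ w ≠ r then
      clusterTerm f u ξ v * clusterTerm g u ξ w * clusterTerm k u ξ r else 0 := fun v w r => by
    unfold clusterTerm
    split_ifs <;> fun_prop
  simp only [tripleTsum]
  rw [lintegral_tsum fun v =>
    (Measurable.tsum fun w => Measurable.tsum fun r => hm v w r).aemeasurable]
  refine tsum_congr fun v => ?_
  rw [lintegral_tsum fun w => (Measurable.tsum fun r => hm v w r).aemeasurable]
  refine tsum_congr fun w => ?_
  rw [lintegral_tsum fun r => (hm v w r).aemeasurable]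
  refine tsum_congr fun r => ?_
  split_ifs
  · rw [← lintegral_const_mul _ (hF' _), ← lintegral_add_left_eq_self (fun t => aliveInd ξ v *
      aliveInd ξ w * aliveInd ξ r * (f t * g (t + (lag v w r ξ).1) * k (t + (lag v w r ξ).2)))
      (pos ξ v)]
    refine lintegral_congr fun u => ?_
    simp only [clusterTerm, lag]
    rw [show pos ξ v + u + (pos ξ w - pos ξ v) = pos ξ w + u by ring,
      show pos ξ v + u + (pos ξ r - pos ξ v) = pos ξ r + u by ring]
    ring
  · simp

end LagMeasure

/-! ### The cumulant kernel, integrated over a position and two lags. -/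

section Kernel

variable {f f' g g' k k' : ℝ → ℝ} {c : ℝ × ℝ → ℝ}

/-- Only the factor in `t` needs compact support, because `c` already controls the lags. This is
what later admits trigonometric functions for `g` and `k`. -/
theorem integrable_kernel_of_bounded (hf : IsTestFunction f) (mg : Measurable g) (mk : Measurable k)
    {B C : ℝ} (hB : ∀ x, |g x| ≤ B) (hC : ∀ x, |k x| ≤ C) (hc : Integrable c) :
    Integrable (fun p : ℝ × ℝ × ℝ => f p.1 * g (p.1 + p.2.1) * k (p.1 + p.2.2) * c p.2)
      (volume.prod volume) ∧ ∀ p : ℝ × ℝ × ℝ,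
        ‖f p.1 * g (p.1 + p.2.1) * k (p.1 + p.2.2) * c p.2‖ ≤ B * C * ‖f p.1 * c p.2‖ := by
  have h1 : Integrable f volume := hf.integrable hf.compactSupport.isCompact.measure_ne_top
  have mf := hf.measurable
  have bound : ∀ p : ℝ × ℝ × ℝ,
      ‖f p.1 * g (p.1 + p.2.1) * k (p.1 + p.2.2) * c p.2‖ ≤ B * C * ‖f p.1 * c p.2‖ := fun p => by
    have hB0 := (abs_nonneg _).trans (hB 0)
    rw [norm_mul, norm_mul, norm_mul, norm_mul, Real.norm_eq_abs (g _), Real.norm_eq_abs (k _)]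
    calc ‖f p.1‖ * |g (p.1 + p.2.1)| * |k (p.1 + p.2.2)| * ‖c p.2‖
        ≤ ‖f p.1‖ * B * C * ‖c p.2‖ := by
          gcongr
          · exact hB _
          · exact hC _
      _ = B * C * (‖f p.1‖ * ‖c p.2‖) := by ring
  refine ⟨Integrable.mono' ((h1.mul_prod hc).norm.const_mul (B * C)) ?_
    (Eventually.of_forall bound), bound⟩
  refine AEStronglyMeasurable.mul ?_ hc.1.comp_snd
  exact Measurable.aestronglyMeasurable (by fun_prop)

theorem integrable_cumulant_kernel (hf : IsTestFunction f) (hg : IsTestFunction g)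
    (hk : IsTestFunction k) (hc : Integrable c) : Integrable (fun p : ℝ × ℝ × ℝ =>
      f p.1 * g (p.1 + p.2.1) * k (p.1 + p.2.2) * c p.2) (volume.prod volume) := by
  obtain ⟨B, hB⟩ := hg.bounded
  obtain ⟨C, hC⟩ := hk.bounded
  exact (integrable_kernel_of_bounded hf hg.measurable hk.measurable hB hC hc).1

theorem integral_cumulant_kernel (hf : IsTestFunction f) (hg : IsTestFunction g)
    (hk : IsTestFunction k) (hc : Integrable c) :
    ∫ t, ∫ τ : ℝ × ℝ, f t * g (t + τ.1) * k (t + τ.2) * c τ =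
      ∫ p : ℝ × ℝ × ℝ, f p.1 * g (p.1 + p.2.1) * k (p.1 + p.2.2) * c p.2 ∂(volume.prod volume) :=
  (integral_prod _ (integrable_cumulant_kernel hf hg hk hc)).symm

theorem HasThirdCumulantDensity.of_forall_nonneg {Ω : Type*} [MeasurableSpace Ω] {P : Measure Ω}
    [IsProbabilityMeasure P] {N : Ω → Measure ℝ} (hN : Measurable N)
    (hmom : ∀ K : Set ℝ, IsCompact K → ∫⁻ ω, (N ω K) ^ 3 ∂P < ∞) (hc : Integrable c)
    (h : ∀ f g k, IsTestFunction f → IsTestFunction g → IsTestFunction k →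
      (∀ x, 0 ≤ f x) → (∀ x, 0 ≤ g x) → (∀ x, 0 ≤ k x) → factorialCumulant₃ P N f g k =
        ∫ t, ∫ τ : ℝ × ℝ, f t * g (t + τ.1) * k (t + τ.2) * c τ) :
    HasThirdCumulantDensity P N c := by
  refine ⟨hmom, hc, fun f g k hf hg hk => eq_of_forall_nonneg (S := factorialCumulant₃ P N)
    (T := fun f g k => ∫ t, ∫ τ : ℝ × ℝ, f t * g (t + τ.1) * k (t + τ.2) * c τ)
    (fun f f' g k hf hf' hg hk => factorialCumulant₃_sub hN hmom hf hf' hg hk)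
    (fun f g g' k hf hg hg' hk => ?_) (fun f g k k' hf hg hk hk' => ?_)
    (fun f f' g k hf hf' hg hk => ?_) (fun f g g' k hf hg hg' hk => ?_)
    (fun f g k k' hf hg hk hk' => ?_) h hf hg hk⟩
  · rw [factorialCumulant₃_swap_left, factorialCumulant₃_sub hN hmom hg hg' hf hk,
      factorialCumulant₃_swap_left, factorialCumulant₃_swap_left P N g' f k]
  · rw [factorialCumulant₃_swap_right, factorialCumulant₃_swap_left,
      factorialCumulant₃_sub hN hmom hk hk' hf hg, factorialCumulant₃_swap_left,
      factorialCumulant₃_swap_right, factorialCumulant₃_swap_left P N k' f g,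
      factorialCumulant₃_swap_right P N f k' g]
  · rw [integral_cumulant_kernel (hf.sub hf') hg hk hc, integral_cumulant_kernel hf hg hk hc,
      integral_cumulant_kernel hf' hg hk hc, ← integral_sub
      (integrable_cumulant_kernel hf hg hk hc) (integrable_cumulant_kernel hf' hg hk hc)]
    simp only [sub_mul]
  · rw [integral_cumulant_kernel hf (hg.sub hg') hk hc, integral_cumulant_kernel hf hg hk hc,
      integral_cumulant_kernel hf hg' hk hc, ← integral_sub
      (integrable_cumulant_kernel hf hg hk hc) (integrable_cumulant_kernel hf hg' hk hc)]
    simp only [mul_sub, sub_mul]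
  · rw [integral_cumulant_kernel hf hg (hk.sub hk') hc, integral_cumulant_kernel hf hg hk hc,
      integral_cumulant_kernel hf hg hk' hc, ← integral_sub
      (integrable_cumulant_kernel hf hg hk hc) (integrable_cumulant_kernel hf hg hk' hc)]
    simp only [mul_sub, sub_mul]

end Kernel

theorem delayLaw_absolutelyContinuous (h : ℝ → ℝ) : delayLaw h ≪ volume :=
  withDensity_absolutelyContinuous _ _

/-- The third factorial cumulant density of the cluster process. -/
noncomputable def clusterDensity (ν m : ℝ≥0) (h : ℝ → ℝ) (τ : ℝ × ℝ) : ℝ :=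
  ν * ((lagMeasure m (delayLaw h)).rnDeriv volume τ).toReal

theorem hasThirdCumulantDensity_clusterProcess {Ω : Type*} [MeasurableSpace Ω] {P : Measure Ω}
    {ν m : ℝ≥0} {h : ℝ → ℝ} {U : ℕ → Ω → ℝ} {ξ : ℕ × List ℕ → Ω → ℕ × ℝ}
    [IsProbabilityMeasure P] (hh : IsDelayDensity h) (hmodel : IsBranchingModel P ν m h U ξ)
    (hm : m < 1) : HasThirdCumulantDensity P (clusterProcess U ξ) (clusterDensity ν m h) := by
  have := hh.isProbabilityMeasure
  have := isFiniteMeasure_lagMeasure (D := delayLaw h) hm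
  have hc : Integrable (clusterDensity ν m h) := Measure.integrable_toReal_rnDeriv.const_mul _
  have hc0 : ∀ τ, 0 ≤ clusterDensity ν m h τ := fun τ => mul_nonneg ν.2 ENNReal.toReal_nonneg
  refine .of_forall_nonneg (measurable_clusterProcess hmodel)
    (fun K hK => lintegral_clusterProcess_cube_lt_top hh hmodel hm hK) hc
    fun f g k hf hg hk pf pg pk => ?_
  have mf := hf.measurable
  have mg := hg.measurable
  have mk := hk.measurable
  have mr := Measure.measurable_rnDeriv (lagMeasure m (delayLaw h)) volume
  rw [factorialCumulant₃_clusterProcess_eq_toReal hh hmodel hm hf hg hk pf pg pk,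
    integral_cumulant_kernel hf hg hk hc, integral_eq_lintegral_of_nonneg_ae
    (Eventually.of_forall fun p => mul_nonneg (mul_nonneg (mul_nonneg (pf _) (pg _)) (pk _))
      (hc0 _)) (integrable_cumulant_kernel hf hg hk hc).1,
    intensity₃_eq_lintegral_lagMeasure hm (by fun_prop) (by fun_prop) (by fun_prop)]
  congr 1
  rw [lintegral_prod _ (integrable_cumulant_kernel hf hg hk hc).1.aemeasurable.ennreal_ofReal,
    ← lintegral_const_mul' _ _ ENNReal.coe_ne_top]
  refine lintegral_congr fun t => ?_
  rw [← lintegral_const_mul' _ _ ENNReal.coe_ne_top, ← lintegral_rnDeriv_mul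
    (lagMeasure_absolutelyContinuous (delayLaw_absolutelyContinuous h)) (by fun_prop)]
  refine lintegral_congr_ae ?_
  filter_upwards [Measure.rnDeriv_lt_top (lagMeasure m (delayLaw h)) volume] with τ hτ
  rw [ENNReal.ofReal_mul (mul_nonneg (mul_nonneg (pf _) (pg _)) (pk _)),
    ENNReal.ofReal_mul (mul_nonneg (pf _) (pg _)), ENNReal.ofReal_mul (pf _), clusterDensity,
    ENNReal.ofReal_mul (NNReal.coe_nonneg ν), ENNReal.ofReal_toReal hτ.ne, ENNReal.ofReal_coe_nnreal]
  ring

/-! ### The bispectrum is determined by the cumulant -/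

/-- The inner integral `Φ t` is continuous in `t`. Cutting `g` and `k` off to windows and letting
these grow shows that `Φ` is orthogonal to all test functions. Hence `Φ` vanishes almost everywhere,
by continuity everywhere, and the claim is its value at `0`. -/
theorem integral_mul_mul_eq_zero_of_kernel {d : ℝ × ℝ → ℝ} (hd : Integrable d)
    (h : ∀ f g k, IsTestFunction f → IsTestFunction g → IsTestFunction k →
      ∫ t, ∫ τ : ℝ × ℝ, f t * g (t + τ.1) * k (t + τ.2) * d τ = 0)
    {g k : ℝ → ℝ} (hg : Continuous g) (hk : Continuous k) {B C : ℝ} (hB : ∀ x, |g x| ≤ B)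
    (hC : ∀ x, |k x| ≤ C) : ∫ τ : ℝ × ℝ, g τ.1 * k τ.2 * d τ = 0 := by
  have mg := hg.measurable
  have mk := hk.measurable
  set Φ : ℝ → ℝ := fun t => ∫ τ : ℝ × ℝ, g (t + τ.1) * k (t + τ.2) * d τ
  have hΦ : Continuous Φ := by
    refine continuous_of_dominated (bound := fun τ => B * C * ‖d τ‖) (fun t => ?_) (fun t => ?_)
      (hd.norm.const_mul _) (Eventually.of_forall fun τ => by fun_prop)
    · exact AEStronglyMeasurable.mul (Measurable.aestronglyMeasurable (by fun_prop)) hd.1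
    · refine Eventually.of_forall fun τ => ?_
      rw [norm_mul, norm_mul]
      gcongr
      · exact (abs_nonneg _).trans (hB 0)
      · exact hB _
      · exact hC _
  have hbox : ∀ n : ℕ, ∀ {φ : ℝ → ℝ} {B : ℝ}, Measurable φ → (∀ x, |φ x| ≤ B) →
      IsTestFunction ((Icc (-n : ℝ) n).indicator φ) := fun n φ B mφ hφ => by
    refine ⟨mφ.indicator measurableSet_Icc, ⟨B, fun x => ?_⟩, HasCompactSupport.intro
      (isCompact_Icc (a := (-n : ℝ)) (b := n)) fun x hx => indicator_of_notMem hx _⟩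
    by_cases hx : x ∈ Icc (-n : ℝ) n
    · simpa [hx] using hφ x
    · simpa [hx] using (abs_nonneg _).trans (hφ 0)
  have hlim : ∀ (φ : ℝ → ℝ) x, Tendsto (fun n : ℕ => (Icc (-n : ℝ) n).indicator φ x) atTop
      (𝓝 (φ x)) := fun φ x => by
    refine tendsto_const_nhds.congr' ?_
    obtain ⟨n₀, hn₀⟩ := exists_nat_ge |x|
    filter_upwards [eventually_ge_atTop n₀] with n hn
    have : x ∈ Icc (-n : ℝ) n := abs_le.1 (hn₀.trans (by exact_mod_cast hn))
    rw [indicator_of_mem this]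
  have key : ∀ f, IsTestFunction f → ∫ t, f t * Φ t = 0 := fun f hf => by
    have mf := hf.measurable
    have h1 : Integrable f volume := hf.integrable hf.compactSupport.isCompact.measure_ne_top
    have e : ∫ t, f t * Φ t = ∫ p : ℝ × ℝ × ℝ, f p.1 * g (p.1 + p.2.1) * k (p.1 + p.2.2) * d p.2
        ∂(volume.prod volume) := by
      rw [integral_prod _ (integrable_kernel_of_bounded hf mg mk hB hC hd).1]
      refine integral_congr_ae (Eventually.of_forall fun t => ?_)
      simp only [Φ, ← integral_const_mul]
      refine integral_congr_ae (Eventually.of_forall fun τ => ?_)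
      simp only
      ring
    have hle : ∀ n : ℕ, ∀ {φ : ℝ → ℝ} {B : ℝ}, (∀ x, |φ x| ≤ B) → ∀ x,
      |(Icc (-n : ℝ) n).indicator φ x| ≤ B := fun n φ B hφ x => by
      by_cases hx : x ∈ Icc (-n : ℝ) n
      · simpa [hx] using hφ x
      · simpa [hx] using (abs_nonneg _).trans (hφ 0)
    have hT := tendsto_integral_of_dominated_convergence (μ := volume.prod volume)
      (F := fun (n : ℕ) (p : ℝ × ℝ × ℝ) => f p.1 * (Icc (-n : ℝ) n).indicator g (p.1 + p.2.1) *
        (Icc (-n : ℝ) n).indicator k (p.1 + p.2.2) * d p.2)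
      (fun p => B * C * ‖f p.1 * d p.2‖)
      (fun n => (integrable_cumulant_kernel hf (hbox n mg hB) (hbox n mk hC) hd).1)
      ((h1.mul_prod hd).norm.const_mul _)
      (fun n => Eventually.of_forall (integrable_kernel_of_bounded hf (hbox n mg hB).measurable
        (hbox n mk hC).measurable (hle n hB) (hle n hC) hd).2)
      (Eventually.of_forall fun p => ((tendsto_const_nhds.mul (hlim g _)).mul (hlim k _)).mul_const _)
    rw [e]
    refine tendsto_nhds_unique hT (tendsto_const_nhds.congr fun n => ?_)
    rw [← integral_cumulant_kernel hf (hbox n mg hB) (hbox n mk hC) hd,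
      h f _ _ hf (hbox n mg hB) (hbox n mk hC)]
  have h0 : Φ =ᵐ[volume] fun _ => 0 := by
    refine ae_eq_zero_of_integral_contDiff_smul_eq_zero hΦ.locallyIntegrable fun f hf hc => ?_
    obtain ⟨A, hA⟩ := hc.exists_bound_of_continuous hf.continuous
    exact key f ⟨hf.continuous.measurable, ⟨A, hA⟩, hc⟩
  have := congrFun ((hΦ.ae_eq_iff_eq volume continuous_const).1 h0) 0
  simpa [Φ] using this

/-- The addition formulas write the exponential as a combination of products of a sine or cosine in
each lag, to which the preceding lemma applies. This makes the bispectrum independent of the choice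
of density without first proving the density unique. -/
theorem bispectrum_eq_of_kernel_eq {c c' : ℝ × ℝ → ℝ} (hc : Integrable c) (hc' : Integrable c')
    (h : ∀ f g k, IsTestFunction f → IsTestFunction g → IsTestFunction k →
      ∫ t, ∫ τ : ℝ × ℝ, f t * g (t + τ.1) * k (t + τ.2) * c τ =
        ∫ t, ∫ τ : ℝ × ℝ, f t * g (t + τ.1) * k (t + τ.2) * c' τ) (ω₁ ω₂ : ℝ) :
    bispectrum c ω₁ ω₂ = bispectrum c' ω₁ ω₂ := by
  have hd := hc.sub hc'
  have h0 : ∀ {g k : ℝ → ℝ}, Continuous g → Continuous k → (∀ x, |g x| ≤ 1) → (∀ x, |k x| ≤ 1) →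
      Integrable (fun τ : ℝ × ℝ => g τ.1 * k τ.2 * (c τ - c' τ)) ∧
      ∫ τ : ℝ × ℝ, g τ.1 * k τ.2 * (c τ - c' τ) = 0 := fun {g k} hg hk hB hC => by
    refine ⟨hd.bdd_mul (c := 1) (Continuous.aestronglyMeasurable (by fun_prop))
      (Eventually.of_forall fun τ => ?_), integral_mul_mul_eq_zero_of_kernel (d := fun τ => c τ - c' τ)
      hd (fun f g k hf hg hk => ?_) hg hk hB hC⟩
    · rw [norm_mul]
      exact mul_le_one₀ (hB _) (norm_nonneg _) (hC _)
    · rw [integral_cumulant_kernel (c := fun τ => c τ - c' τ) hf hg hk hd]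
      simp only [mul_sub]
      rw [integral_sub (integrable_cumulant_kernel hf hg hk hc)
        (integrable_cumulant_kernel hf hg hk hc'), ← integral_cumulant_kernel hf hg hk hc,
        ← integral_cumulant_kernel hf hg hk hc', h f g k hf hg hk, sub_self]
  have hint : ∀ {c : ℝ × ℝ → ℝ}, Integrable c → Integrable fun τ : ℝ × ℝ =>
      Complex.exp (-(Complex.I * ((ω₁ * τ.1 + ω₂ * τ.2 : ℝ) : ℂ))) * (c τ : ℂ) := fun hc => by
    refine hc.ofReal.bdd_mul (c := 1) (Continuous.aestronglyMeasurable (by fun_prop))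
      (Eventually.of_forall fun τ => ?_)
    rw [Complex.norm_exp]
    simp
  have cc := h0 (g := fun x => Real.cos (ω₁ * x)) (k := fun x => Real.cos (ω₂ * x)) (by fun_prop)
    (by fun_prop) (fun x => Real.abs_cos_le_one _) fun x => Real.abs_cos_le_one _
  have cs := h0 (g := fun x => Real.cos (ω₁ * x)) (k := fun x => Real.sin (ω₂ * x)) (by fun_prop)
    (by fun_prop) (fun x => Real.abs_cos_le_one _) fun x => Real.abs_sin_le_one _
  have sc := h0 (g := fun x => Real.sin (ω₁ * x)) (k := fun x => Real.cos (ω₂ * x)) (by fun_prop)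
    (by fun_prop) (fun x => Real.abs_sin_le_one _) fun x => Real.abs_cos_le_one _
  have ss := h0 (g := fun x => Real.sin (ω₁ * x)) (k := fun x => Real.sin (ω₂ * x)) (by fun_prop)
    (by fun_prop) (fun x => Real.abs_sin_le_one _) fun x => Real.abs_sin_le_one _
  rw [← sub_eq_zero, bispectrum, bispectrum, ← integral_sub (hint hc) (hint hc')]
  have e : ∀ τ : ℝ × ℝ, Complex.exp (-(Complex.I * ((ω₁ * τ.1 + ω₂ * τ.2 : ℝ) : ℂ))) * (c τ : ℂ) -
      Complex.exp (-(Complex.I * ((ω₁ * τ.1 + ω₂ * τ.2 : ℝ) : ℂ))) * (c' τ : ℂ) =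
      ((Real.cos (ω₁ * τ.1) * Real.cos (ω₂ * τ.2) * (c τ - c' τ) -
        Real.sin (ω₁ * τ.1) * Real.sin (ω₂ * τ.2) * (c τ - c' τ) : ℝ) : ℂ) -
      Complex.I * ((Real.sin (ω₁ * τ.1) * Real.cos (ω₂ * τ.2) * (c τ - c' τ) +
        Real.cos (ω₁ * τ.1) * Real.sin (ω₂ * τ.2) * (c τ - c' τ) : ℝ) : ℂ) := fun τ => by
    rw [show -(Complex.I * ((ω₁ * τ.1 + ω₂ * τ.2 : ℝ) : ℂ)) =
      ((-(ω₁ * τ.1 + ω₂ * τ.2) : ℝ) : ℂ) * Complex.I by push_cast; ring, Complex.exp_mul_I,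
      ← Complex.ofReal_cos, ← Complex.ofReal_sin, Real.cos_neg, Real.sin_neg, Real.cos_add,
      Real.sin_add]
    push_cast
    ring
  simp_rw [e]
  rw [integral_sub (cc.1.sub ss.1).ofReal ((sc.1.add cs.1).ofReal.const_mul _), integral_const_mul,
    integral_complex_ofReal, integral_complex_ofReal, integral_sub cc.1 ss.1, integral_add sc.1 cs.1,
    cc.2, ss.2, sc.2, cs.2]
  simp

/-! ### Reversible processes -/

/-- Measurability is needed on the space of all measures, including those for which `f` is not
integrable and the Bochner integral takes its default value `0`; hence the case distinction. -/
theorem measurable_linStat {f : ℝ → ℝ} (hf : Measurable f) : Measurable fun μ => linStat μ f := by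
  classical
  have m1 : ∀ {φ : ℝ → ℝ}, Measurable φ →
      Measurable fun μ : Measure ℝ => ∫⁻ x, ENNReal.ofReal (φ x) ∂μ := fun hφ =>
    Measure.measurable_lintegral hφ.ennreal_ofReal
  have e : (fun μ => linStat μ f) = fun μ => if ∫⁻ x, ENNReal.ofReal |f x| ∂μ < ∞ then
      (∫⁻ x, ENNReal.ofReal (f x) ∂μ).toReal - (∫⁻ x, ENNReal.ofReal (-f x) ∂μ).toReal else 0 := by
    funext μ
    have : ∫⁻ x, ENNReal.ofReal |f x| ∂μ < ∞ ↔ Integrable f μ := by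
      rw [Integrable, and_iff_right hf.aestronglyMeasurable, hasFiniteIntegral_iff_norm]
      rfl
    simp only [this]
    split_ifs with h
    · exact linStat_eq_toReal_sub μ h
    · exact integral_undef h
  rw [e]
  exact Measurable.ite (measurableSet_lt (m1 (by fun_prop)) measurable_const)
    ((m1 hf).ennreal_toReal.sub (m1 hf.neg).ennreal_toReal) measurable_const

section Reversible

variable {Ω : Type*} [MeasurableSpace Ω] {P : Measure Ω} {N : Ω → Measure ℝ} {f g k : ℝ → ℝ}

theorem linStat_map_neg (μ : Measure ℝ) (f : ℝ → ℝ) :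
    linStat (μ.map fun x => -x) f = linStat μ fun x => f (-x) :=
  integral_map_equiv (MeasurableEquiv.neg ℝ) f

theorem IsReversible.integral_comp (hN : Measurable N) (hrev : IsReversible P N)
    {T : Measure ℝ → ℝ} (hT : Measurable T) :
    ∫ ω, T ((N ω).map fun x => -x) ∂P = ∫ ω, T (N ω) ∂P := by
  have hm : Measurable fun ω => (N ω).map fun x => -x :=
    (Measure.measurable_map _ measurable_neg).comp hN
  rw [← integral_map (φ := N) hN.aemeasurable hT.aestronglyMeasurable, ← hrev,
    integral_map hm.aemeasurable hT.aestronglyMeasurable]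

theorem IsReversible.factorialCumulant₃_comp_neg (hN : Measurable N) (hrev : IsReversible P N)
    (hf : Measurable f) (hg : Measurable g) (hk : Measurable k) :
    factorialCumulant₃ P N (fun x => f (-x)) (fun x => g (-x)) (fun x => k (-x)) =
      factorialCumulant₃ P N f g k := by
  have m1 : ∀ {φ : ℝ → ℝ}, Measurable φ →
      factorialMoment₁ P N (fun x => φ (-x)) = factorialMoment₁ P N φ := fun {φ} hφ => by
    have := hrev.integral_comp hN (measurable_linStat hφ)
    simp only [linStat_map_neg] at this
    exact this
  have m2 : ∀ {φ ψ : ℝ → ℝ}, Measurable φ → Measurable ψ →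
      factorialMoment₂ P N (fun x => φ (-x)) (fun x => ψ (-x)) = factorialMoment₂ P N φ ψ :=
    fun {φ ψ} hφ hψ => by
      have := hrev.integral_comp hN (T := fun μ => pairSum μ φ ψ) (((measurable_linStat hφ).mul
        (measurable_linStat hψ)).sub (measurable_linStat (hφ.mul hψ)))
      simp only [pairSum, linStat_map_neg] at this
      exact this
  have m3 : factorialMoment₃ P N (fun x => f (-x)) (fun x => g (-x)) (fun x => k (-x)) =
      factorialMoment₃ P N f g k := by
    have Lf := measurable_linStat hf
    have Lg := measurable_linStat hg
    have Lk := measurable_linStat hk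
    have Lfg := measurable_linStat (f := fun x => f x * g x) (hf.mul hg)
    have Lfk := measurable_linStat (f := fun x => f x * k x) (hf.mul hk)
    have Lgk := measurable_linStat (f := fun x => g x * k x) (hg.mul hk)
    have Lfgk := measurable_linStat (f := fun x => f x * g x * k x) ((hf.mul hg).mul hk)
    have := hrev.integral_comp hN (T := fun μ => tripleSum μ f g k) (by unfold tripleSum; fun_prop)
    simp only [tripleSum, linStat_map_neg] at this
    exact this
  simp only [factorialCumulant₃, factorialCumulant₂]
  rw [m3, m2 hf hg, m2 hf hk, m2 hg hk, m1 hf, m1 hg, m1 hk]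

theorem bispectrum_conj (c : ℝ × ℝ → ℝ) (ω₁ ω₂ : ℝ) :
    (starRingEnd ℂ) (bispectrum c ω₁ ω₂) = bispectrum (fun τ => c (-τ)) ω₁ ω₂ := by
  rw [bispectrum, ← integral_conj, bispectrum, ← integral_neg_eq_self]
  refine integral_congr_ae (Eventually.of_forall fun τ => ?_)
  simp only [map_mul, ← Complex.exp_conj, map_neg, Complex.conj_I, Complex.conj_ofReal]
  congr 2
  simp only [Prod.fst_neg, Prod.snd_neg]
  push_cast
  ring

/-- By reversibility `c` and its reflection define the same cumulant functional and so have the same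
bispectrum. For real `c`, reflection conjugates the bispectrum. -/
theorem IsReversible.bispectrum_im_eq_zero (hN : Measurable N) (hrev : IsReversible P N)
    {c : ℝ × ℝ → ℝ} (hc : HasThirdCumulantDensity P N c) (ω₁ ω₂ : ℝ) :
    (bispectrum c ω₁ ω₂).im = 0 := by
  have hc' : Integrable fun τ => c (-τ) := hc.integrable.comp_neg
  refine Complex.conj_eq_iff_im.1 ?_
  rw [bispectrum_conj]
  refine bispectrum_eq_of_kernel_eq hc' hc.integrable (fun f g k hf hg hk => ?_) ω₁ ω₂
  rw [← hc.cumulant_eq f g k hf hg hk, ← hrev.factorialCumulant₃_comp_neg hN hf.measurable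
    hg.measurable hk.measurable, hc.cumulant_eq _ _ _ hf.comp_neg hg.comp_neg hk.comp_neg,
    ← integral_neg_eq_self]
  refine integral_congr_ae (Eventually.of_forall fun t => ?_)
  simp only
  rw [← integral_neg_eq_self]
  refine integral_congr_ae (Eventually.of_forall fun τ => ?_)
  simp only [Prod.fst_neg, Prod.snd_neg, neg_add, neg_neg]

theorem HasThirdCumulantDensity.bispectrum_eq {c c' : ℝ × ℝ → ℝ} (hc : HasThirdCumulantDensity P N c)
    (hc' : HasThirdCumulantDensity P N c') (ω₁ ω₂ : ℝ) :
    bispectrum c ω₁ ω₂ = bispectrum c' ω₁ ω₂ :=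
  bispectrum_eq_of_kernel_eq hc.integrable hc'.integrable (fun f g k hf hg hk => by
    rw [← hc.cumulant_eq f g k hf hg hk, ← hc'.cumulant_eq f g k hf hg hk]) ω₁ ω₂

end Reversible

/-! ### Moments of complex sums over the children of the root -/

section ComplexMarkedSums

variable {T : Type*} [MeasurableSpace T] {Q : Measure T} [IsProbabilityMeasure Q] {a b c : T → ℂ}

theorem integral_infinitePi_eval (i : ℕ) (ha : Measurable a) :
    ∫ x, a (x i) ∂(Measure.infinitePi fun _ : ℕ => Q) = ∫ x, a x ∂Q := by
  have h := measurePreserving_eval_infinitePi (fun _ : ℕ => Q) i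
  have e := integral_map (μ := Measure.infinitePi fun _ : ℕ => Q) h.measurable.aemeasurable
    ha.aestronglyMeasurable
  rw [h.map_eq] at e
  exact e.symm

theorem integral_infinitePi_pair {i j : ℕ} (hij : i ≠ j) (ha : Measurable a) (hb : Measurable b) :
    ∫ x, a (x i) * b (x j) ∂(Measure.infinitePi fun _ : ℕ => Q) =
      (∫ x, a x ∂Q) * ∫ x, b x ∂Q := by
  have ind := (iIndepFun_infinitePi (P := fun _ : ℕ => Q) (X := fun _ ω => ω)
    (by fun_prop)).indepFun hij
  rw [← integral_infinitePi_eval i ha, ← integral_infinitePi_eval j hb]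
  exact (ind.comp ha hb).integral_fun_mul_eq_mul_integral
    (Measurable.aestronglyMeasurable (by fun_prop)) (Measurable.aestronglyMeasurable (by fun_prop))

theorem integral_infinitePi_triple {i j k : ℕ} (hij : i ≠ j) (hik : i ≠ k) (hjk : j ≠ k)
    (ha : Measurable a) (hb : Measurable b) (hc : Measurable c) :
    ∫ x, a (x i) * b (x j) * c (x k) ∂(Measure.infinitePi fun _ : ℕ => Q) =
      (∫ x, a x ∂Q) * (∫ x, b x ∂Q) * ∫ x, c x ∂Q := by
  have ind := (iIndepFun_infinitePi (P := fun _ : ℕ => Q) (X := fun _ ω => ω)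
    (by fun_prop)).indepFun_prodMk (by fun_prop) i j k hik hjk
  rw [← integral_infinitePi_pair hij ha hb, ← integral_infinitePi_eval k hc]
  exact (ind.comp (φ := fun p : T × T => a p.1 * b p.2) (by fun_prop)
    hc).integral_fun_mul_eq_mul_integral
    (Measurable.aestronglyMeasurable (by fun_prop)) (Measurable.aestronglyMeasurable (by fun_prop))

theorem MemLp.infinitePi_eval (ha : MemLp a 3 Q) (i : ℕ) :
    MemLp (fun x : ℕ → T => a (x i)) 3 (Measure.infinitePi fun _ : ℕ => Q) :=
  ha.comp_measurePreserving (measurePreserving_eval_infinitePi (fun _ : ℕ => Q) i)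

theorem integrable_mul_of_memLp {X Y : T → ℂ} (hX : MemLp X 3 Q) (hY : MemLp Y 3 Q) :
    Integrable (fun x => X x * Y x) Q := by
  simpa using integrable_mul_mul_of_memLp hX hY (memLp_const (1 : ℂ))

variable (ha : Measurable a) (hb : Measurable b) (hc : Measurable c) (la : MemLp a 3 Q)
  (lb : MemLp b 3 Q) (lc : MemLp c 3 Q)

include ha la in
theorem integral_sum_range (k : ℕ) :
    ∫ x, ∑ i ∈ Finset.range k, a (x i) ∂(Measure.infinitePi fun _ : ℕ => Q) =
      k * ∫ x, a x ∂Q := by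
  rw [integral_finsetSum _ fun i _ => ((MemLp.infinitePi_eval la i).integrable (by norm_num))]
  simp only [integral_infinitePi_eval _ ha, Finset.sum_const, Finset.card_range, nsmul_eq_mul]

include ha hb la lb in
theorem integral_sum_range_mul (k : ℕ) :
    ∫ x, (∑ i ∈ Finset.range k, a (x i)) * (∑ j ∈ Finset.range k, b (x j))
        ∂(Measure.infinitePi fun _ : ℕ => Q) =
      k ^ 2 * ((∫ x, a x ∂Q) * ∫ x, b x ∂Q) +
        k * (∫ x, a x * b x ∂Q - (∫ x, a x ∂Q) * ∫ x, b x ∂Q) := by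
  have hint : ∀ i j, Integrable (fun x : ℕ → T => a (x i) * b (x j))
      (Measure.infinitePi fun _ : ℕ => Q) := fun i j =>
    integrable_mul_of_memLp (MemLp.infinitePi_eval la i) (MemLp.infinitePi_eval lb j)
  have key : ∀ i j, ∫ x, a (x i) * b (x j) ∂(Measure.infinitePi fun _ : ℕ => Q) =
      (∫ x, a x ∂Q) * (∫ x, b x ∂Q) +
        if i = j then ∫ x, a x * b x ∂Q - (∫ x, a x ∂Q) * ∫ x, b x ∂Q else 0 := fun i j => by
    split_ifs with h
    · subst h
      rw [integral_infinitePi_eval (a := fun x => a x * b x) i (ha.mul hb)]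
      ring
    · rw [integral_infinitePi_pair h ha hb, add_zero]
  simp_rw [Finset.sum_mul_sum]
  rw [integral_finsetSum _ fun i _ => integrable_finsetSum _ fun j _ => hint i j]
  simp_rw [integral_finsetSum _ fun j _ => hint _ j, key]
  simp only [Finset.sum_add_distrib, Finset.sum_ite_eq, Finset.sum_const, Finset.card_range,
    nsmul_eq_mul, Finset.sum_ite_mem, Finset.inter_self]
  ring

-- Triples of distinct indices number `k³ - 3k² + 2k` and ordered pairs `k² - k`; the result is
-- collected by powers of `k`, ready for averaging over a Poisson `k`.
include ha hb hc la lb lc in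
theorem integral_sum_range_mul_mul (k : ℕ) :
    ∫ x, (∑ i ∈ Finset.range k, a (x i)) * (∑ j ∈ Finset.range k, b (x j)) *
        (∑ l ∈ Finset.range k, c (x l)) ∂(Measure.infinitePi fun _ : ℕ => Q) =
      k ^ 3 * ((∫ x, a x ∂Q) * (∫ x, b x ∂Q) * ∫ x, c x ∂Q) +
        k ^ 2 * ((∫ x, a x * b x ∂Q) * (∫ x, c x ∂Q) + (∫ x, a x * c x ∂Q) * (∫ x, b x ∂Q) +
          (∫ x, b x * c x ∂Q) * (∫ x, a x ∂Q) -
          3 * ((∫ x, a x ∂Q) * (∫ x, b x ∂Q) * ∫ x, c x ∂Q)) +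
        k * (∫ x, a x * b x * c x ∂Q - (∫ x, a x * b x ∂Q) * (∫ x, c x ∂Q) -
          (∫ x, a x * c x ∂Q) * (∫ x, b x ∂Q) - (∫ x, b x * c x ∂Q) * (∫ x, a x ∂Q) +
          2 * ((∫ x, a x ∂Q) * (∫ x, b x ∂Q) * ∫ x, c x ∂Q)) := by
  have hint : ∀ i j l, Integrable (fun x : ℕ → T => a (x i) * b (x j) * c (x l))
      (Measure.infinitePi fun _ : ℕ => Q) := fun i j l =>
    integrable_mul_mul_of_memLp (MemLp.infinitePi_eval la i) (MemLp.infinitePi_eval lb j)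
      (MemLp.infinitePi_eval lc l)
  have m12 : Measurable fun x => a x * b x := ha.mul hb
  have m13 : Measurable fun x => a x * c x := ha.mul hc
  have m23 : Measurable fun x => b x * c x := hb.mul hc
  have m123 : Measurable fun x => a x * b x * c x := m12.mul hc
  have key : ∀ i j l, ∫ x, a (x i) * b (x j) * c (x l) ∂(Measure.infinitePi fun _ : ℕ => Q) =
      (∫ x, a x ∂Q) * (∫ x, b x ∂Q) * (∫ x, c x ∂Q) +
      (if i = j then (∫ x, a x * b x ∂Q - (∫ x, a x ∂Q) * ∫ x, b x ∂Q) * ∫ x, c x ∂Q else 0) +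
      (if i = l then (∫ x, a x * c x ∂Q - (∫ x, a x ∂Q) * ∫ x, c x ∂Q) * ∫ x, b x ∂Q else 0) +
      (if j = l then (∫ x, b x * c x ∂Q - (∫ x, b x ∂Q) * ∫ x, c x ∂Q) * ∫ x, a x ∂Q else 0) +
      (if i = j then if i = l then ∫ x, a x * b x * c x ∂Q - (∫ x, a x * b x ∂Q) * (∫ x, c x ∂Q) -
          (∫ x, a x * c x ∂Q) * (∫ x, b x ∂Q) - (∫ x, b x * c x ∂Q) * (∫ x, a x ∂Q) +
          2 * ((∫ x, a x ∂Q) * (∫ x, b x ∂Q) * ∫ x, c x ∂Q) else 0 else 0) := fun i j l => by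
    by_cases h1 : i = j
    · by_cases h2 : i = l
      · subst h1 h2
        rw [integral_infinitePi_eval (a := fun x => a x * b x * c x) i m123]
        simp only [if_true]
        ring
      · subst h1
        rw [integral_infinitePi_pair (a := fun x => a x * b x) h2 m12 hc]
        simp only [if_true, h2, if_false]
        ring
    · by_cases h2 : i = l
      · subst h2
        simp_rw [mul_right_comm (a _) (b _)]
        rw [integral_infinitePi_pair (a := fun x => a x * c x) h1 m13 hb]
        simp only [if_true, h1, Ne.symm h1, if_false]
        ring
      · by_cases h3 : j = l
        · subst h3
          simp_rw [mul_assoc (a _) (b _)]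
          rw [integral_infinitePi_pair (b := fun x => b x * c x) h1 ha m23]
          simp only [if_true, h1, if_false]
          ring
        · rw [integral_infinitePi_triple h1 h2 h3 ha hb hc]
          simp only [h1, h2, h3, if_false]
          ring
  have expand : ∀ x : ℕ → T, (∑ i ∈ Finset.range k, a (x i)) * (∑ j ∈ Finset.range k, b (x j)) *
      (∑ l ∈ Finset.range k, c (x l)) = ∑ i ∈ Finset.range k, ∑ j ∈ Finset.range k,
        ∑ l ∈ Finset.range k, a (x i) * b (x j) * c (x l) := fun x => by
    rw [Finset.sum_mul_sum, Finset.sum_mul]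
    refine Finset.sum_congr rfl fun i _ => ?_
    rw [Finset.sum_mul]
    exact Finset.sum_congr rfl fun j _ => Finset.mul_sum _ _ _
  simp_rw [expand]
  rw [integral_finsetSum _ fun i _ => integrable_finsetSum _ fun j _ =>
    integrable_finsetSum _ fun l _ => hint i j l]
  simp_rw [integral_finsetSum _ fun j _ => integrable_finsetSum _ fun l _ => hint _ j l,
    integral_finsetSum _ fun l _ => hint _ _ l, key]
  have e1 : ∀ z : ℂ, ∀ i ∈ Finset.range k, ∑ j ∈ Finset.range k, (if i = j then z else 0) = z :=
    fun z i hi => by rw [Finset.sum_ite_eq, if_pos hi]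
  have e2 : ∀ z : ℂ, ∀ i ∈ Finset.range k, ∑ j ∈ Finset.range k, ∑ l ∈ Finset.range k,
      (if i = j then z else 0) = k * z := fun z i hi => by
    rw [Finset.sum_comm, Finset.sum_congr rfl fun l _ => e1 z i hi]
    simp
  have e3 : ∀ z : ℂ, ∀ i ∈ Finset.range k, ∑ j ∈ Finset.range k, ∑ l ∈ Finset.range k,
      (if i = l then z else 0) = k * z := fun z i hi => by
    rw [Finset.sum_congr rfl fun l _ => e1 z i hi]
    simp
  have e4 : ∀ z : ℂ, ∑ j ∈ Finset.range k, ∑ l ∈ Finset.range k,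
      (if j = l then z else 0) = k * z := fun z => by
    rw [Finset.sum_congr rfl fun j hj => e1 z j hj]
    simp
  have e5 : ∀ z : ℂ, ∀ i ∈ Finset.range k, ∑ j ∈ Finset.range k, ∑ l ∈ Finset.range k,
      (if i = j then if i = l then z else 0 else 0) = z := fun z i hi => by
    refine Eq.trans (Finset.sum_congr rfl fun j _ => ?_) (e1 z i hi)
    split_ifs
    · exact e1 z i hi
    · simp
  simp only [Finset.sum_add_distrib]
  rw [Finset.sum_congr rfl fun i hi => e2 _ i hi, Finset.sum_congr rfl fun i hi => e3 _ i hi,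
    Finset.sum_congr rfl fun i _ => e4 _, Finset.sum_congr rfl fun i hi => e5 _ i hi]
  simp only [Finset.sum_const, Finset.card_range, nsmul_eq_mul]
  ring

end ComplexMarkedSums

/-! ### Polynomial moments of a Poisson variable, with complex coefficients. -/

section PoissonMoments

variable (m : ℝ≥0)

theorem integrable_and_integral_natCast {u : ℕ → ℕ} {x : ℝ≥0}
    (h : ∫⁻ n, (u n : ℝ≥0∞) ∂(poissonMeasure m) = x) :
    Integrable (fun n => (u n : ℂ)) (poissonMeasure m) ∧
      ∫ n, (u n : ℂ) ∂(poissonMeasure m) = (x : ℝ) := by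
  have := integrable_and_integral_toReal (P := poissonMeasure m) (X := fun n => (u n : ℝ≥0∞))
    (by fun_prop) h ENNReal.coe_ne_top
  simp only [ENNReal.toReal_natCast, ENNReal.coe_toReal] at this
  refine ⟨by simpa using this.1.ofReal (𝕜 := ℂ), ?_⟩
  rw [← this.2, ← integral_complex_ofReal]
  simp

theorem integral_poisson_polynomial (p q r : ℂ) :
    ∫ n, ((n : ℂ) ^ 3 * p + (n : ℂ) ^ 2 * q + n * r) ∂(poissonMeasure m) =
      ((m : ℝ) ^ 3 + 3 * (m : ℝ) ^ 2 + (m : ℝ) : ℂ) * p + ((m : ℝ) ^ 2 + (m : ℝ) : ℂ) * q +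
        (m : ℝ) * r := by
  have h1 := integrable_and_integral_natCast m (u := fun n => n) (lintegral_poisson_one m)
  have h2 := integrable_and_integral_natCast m (u := fun n => n ^ 2) (x := m * m + m) (by
    rw [ENNReal.coe_add, ENNReal.coe_mul, ← lintegral_poisson_sq]
    push_cast
    simp only [sq])
  have h3 := integrable_and_integral_natCast m (u := fun n => n ^ 3)
    (x := m * m * m + 3 * (m * m) + m) (by
      push_cast
      rw [← lintegral_poisson_cube]
      exact lintegral_congr fun n => by ring)
  push_cast at h1 h2 h3
  have h32 : Integrable (fun n : ℕ => (n : ℂ) ^ 3 * p + (n : ℂ) ^ 2 * q) (poissonMeasure m) :=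
    (h3.1.mul_const p).add (h2.1.mul_const q)
  rw [integral_add h32 (h1.1.mul_const r), integral_add (h3.1.mul_const p) (h2.1.mul_const q),
    integral_mul_const, integral_mul_const,
    integral_mul_const, h1.2, h2.2, h3.2]
  ring

end PoissonMoments

/-! ### Complex sums over the children of the root. -/

section ComplexChildren

variable {m : ℝ≥0} {D : Measure ℝ} [IsProbabilityMeasure D] {a b c : Marks → ℂ}

/-- The sum of the complex function `a` over the families of the children of the root. -/
noncomputable def childSumC (a : Marks → ℂ) (ξ : Marks) : ℂ :=
  ∑ j ∈ Finset.range (ξ []).1, a (subMarks j ξ)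

theorem measurable_sum_range (ha : Measurable a) : Measurable fun p : ℕ × (ℕ → Marks) =>
    ∑ j ∈ Finset.range p.1, a (p.2 j) :=
  measurable_from_prod_countable_right fun k => Finset.measurable_sum (f := fun j (x : ℕ → Marks) =>
    a (x j)) (Finset.range k) fun j _ => ha.comp (measurable_pi_apply j)

/-- The displacement of the root is independent of the rest of the cluster. -/
theorem integral_displacement_mul {φ : ℝ → ℂ} (hφ : Measurable φ)
    {G : ℕ × (ℕ → Marks) → ℂ} (hG : Measurable G)
    (hint : Integrable (fun ξ : Marks => φ (ξ []).2 * G ((ξ []).1, fun j => subMarks j ξ))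
      (treeLaw m D)) :
    ∫ ξ, φ (ξ []).2 * G ((ξ []).1, fun j => subMarks j ξ) ∂(treeLaw m D) =
      (∫ d, φ d ∂D) * ∫ k, ∫ x, G (k, x) ∂(Measure.infinitePi fun _ : ℕ => treeLaw m D)
        ∂(poissonMeasure m) := by
  have mp := measurePreserving_root_subMarks (m := m) (D := D)
  have hF : Measurable fun p : (ℕ × ℝ) × (ℕ → Marks) => φ p.1.2 * G (p.1.1, p.2) := by fun_prop
  have hint' : Integrable (fun p : (ℕ × ℝ) × (ℕ → Marks) => φ p.1.2 * G (p.1.1, p.2))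
      ((markLaw m D).prod (Measure.infinitePi fun _ : ℕ => treeLaw m D)) := by
    rw [← mp.map_eq, integrable_map_measure hF.aestronglyMeasurable mp.measurable.aemeasurable]
    exact hint
  have e : ∫ ξ, φ (ξ []).2 * G ((ξ []).1, fun j => subMarks j ξ) ∂(treeLaw m D) =
      ∫ p : (ℕ × ℝ) × (ℕ → Marks), φ p.1.2 * G (p.1.1, p.2)
        ∂((markLaw m D).prod (Measure.infinitePi fun _ : ℕ => treeLaw m D)) := by
    rw [← mp.map_eq, integral_map mp.measurable.aemeasurable hF.aestronglyMeasurable]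
  rw [e, integral_prod _ hint', markLaw]
  simp_rw [integral_const_mul, mul_comm (φ _)]
  rw [integral_prod_mul (fun k : ℕ => ∫ x, G (k, x) ∂(Measure.infinitePi fun _ => treeLaw m D)),
    mul_comm]

theorem integral_children {G : ℕ × (ℕ → Marks) → ℂ} (hG : Measurable G)
    (hint : Integrable (fun ξ : Marks => G ((ξ []).1, fun j => subMarks j ξ)) (treeLaw m D)) :
    ∫ ξ, G ((ξ []).1, fun j => subMarks j ξ) ∂(treeLaw m D) =
      ∫ k, ∫ x, G (k, x) ∂(Measure.infinitePi fun _ : ℕ => treeLaw m D) ∂(poissonMeasure m) := by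
  have := integral_displacement_mul (m := m) (D := D) (φ := fun _ => 1) measurable_const hG
    (by simpa using hint)
  simpa using this

variable (ha : Measurable a) (hb : Measurable b) (hc : Measurable c) (la : MemLp a 3 (treeLaw m D))
  (lb : MemLp b 3 (treeLaw m D)) (lc : MemLp c 3 (treeLaw m D))
  (sa : MemLp (childSumC a) 3 (treeLaw m D)) (sb : MemLp (childSumC b) 3 (treeLaw m D))
  (sc : MemLp (childSumC c) 3 (treeLaw m D))

include ha la sa in
theorem integral_childSumC :
    ∫ ξ, childSumC a ξ ∂(treeLaw m D) = (m : ℝ) * ∫ ξ, a ξ ∂(treeLaw m D) := by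
  refine (integral_children (measurable_sum_range ha) (sa.integrable (by norm_num))).trans ?_
  simp only [integral_sum_range ha la]
  have := integral_poisson_polynomial m 0 0 (∫ ξ, a ξ ∂(treeLaw m D))
  simpa using this

include ha hb la lb sa sb in
theorem integral_childSumC_mul :
    ∫ ξ, childSumC a ξ * childSumC b ξ ∂(treeLaw m D) =
      (m : ℝ) ^ 2 * ((∫ ξ, a ξ ∂(treeLaw m D)) * ∫ ξ, b ξ ∂(treeLaw m D)) +
        (m : ℝ) * ∫ ξ, a ξ * b ξ ∂(treeLaw m D) := by
  refine (integral_children ((measurable_sum_range ha).mul (measurable_sum_range hb))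
    (integrable_mul_of_memLp sa sb)).trans ?_
  simp only [Pi.mul_apply, integral_sum_range_mul ha hb la lb]
  have := integral_poisson_polynomial m 0 ((∫ ξ, a ξ ∂(treeLaw m D)) * ∫ ξ, b ξ ∂(treeLaw m D))
    (∫ ξ, a ξ * b ξ ∂(treeLaw m D) - (∫ ξ, a ξ ∂(treeLaw m D)) * ∫ ξ, b ξ ∂(treeLaw m D))
  simp only [mul_zero, zero_add] at this
  rw [this]
  ring

-- For a Poisson number of terms the factorial moments are the powers of `m`. All negative
-- corrections therefore disappear and one term remains for each set partition.
include ha hb hc la lb lc sa sb sc in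
theorem integral_childSumC_mul_mul :
    ∫ ξ, childSumC a ξ * childSumC b ξ * childSumC c ξ ∂(treeLaw m D) =
      (m : ℝ) ^ 3 * ((∫ ξ, a ξ ∂(treeLaw m D)) * (∫ ξ, b ξ ∂(treeLaw m D)) *
        ∫ ξ, c ξ ∂(treeLaw m D)) +
      (m : ℝ) ^ 2 * ((∫ ξ, a ξ * b ξ ∂(treeLaw m D)) * (∫ ξ, c ξ ∂(treeLaw m D)) +
        (∫ ξ, a ξ * c ξ ∂(treeLaw m D)) * (∫ ξ, b ξ ∂(treeLaw m D)) +
        (∫ ξ, b ξ * c ξ ∂(treeLaw m D)) * (∫ ξ, a ξ ∂(treeLaw m D))) +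
      (m : ℝ) * ∫ ξ, a ξ * b ξ * c ξ ∂(treeLaw m D) := by
  refine (integral_children (((measurable_sum_range ha).mul (measurable_sum_range hb)).mul
    (measurable_sum_range hc)) (integrable_mul_mul_of_memLp sa sb sc)).trans ?_
  simp only [Pi.mul_apply, integral_sum_range_mul_mul ha hb hc la lb lc]
  rw [integral_poisson_polynomial]
  ring

end ComplexChildren

/-! ### The Fourier transform of a cluster -/

/-- The character `x ↦ exp (-i t x)`. -/
noncomputable def phase (t x : ℝ) : ℂ := Complex.exp (-(Complex.I * ((t * x : ℝ) : ℂ)))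

theorem phase_eq (t x : ℝ) : phase t x = Real.cos (t * x) - Complex.I * Real.sin (t * x) := by
  rw [phase, show -(Complex.I * ((t * x : ℝ) : ℂ)) = ((-(t * x) : ℝ) : ℂ) * Complex.I by
    push_cast; ring, Complex.exp_mul_I, ← Complex.ofReal_cos, ← Complex.ofReal_sin, Real.cos_neg,
    Real.sin_neg]
  push_cast
  ring

theorem norm_phase (t x : ℝ) : ‖phase t x‖ = 1 := by
  rw [phase, Complex.norm_exp]
  simp

theorem phase_add (t x y : ℝ) : phase t (x + y) = phase t x * phase t y := by
  rw [phase, phase, phase, ← Complex.exp_add]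
  congr 1
  push_cast
  ring

@[simp] theorem phase_zero (t : ℝ) : phase t 0 = 1 := by simp [phase]

theorem measurable_phase (t : ℝ) : Measurable (phase t) := by
  unfold phase
  fun_prop

theorem conj_phase (t x : ℝ) : (starRingEnd ℂ) (phase t x) = phase (-t) x := by
  rw [phase, phase, ← Complex.exp_conj]
  congr 1
  simp

theorem phase_mul_phase (s t x : ℝ) : phase s x * phase t x = phase (s + t) x := by
  rw [phase, phase, phase, ← Complex.exp_add]
  congr 1
  push_cast
  ring

/-- The Fourier transform `∑ exp (-i t x)` over the points `x` of the cluster. -/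
noncomputable def clusterFourier (t : ℝ) (ξ : Marks) : ℂ :=
  -- Adding `1` makes the summands nonnegative, so the sums live in `ℝ≥0∞` and are measurable at
  -- once; the size is subtracted afterwards.
  (((clusterSum (fun x => ENNReal.ofReal (1 + Real.cos (t * x))) 0 ξ).toReal -
    (size ξ).toReal : ℝ) : ℂ) - Complex.I *
  (((clusterSum (fun x => ENNReal.ofReal (1 + Real.sin (t * x))) 0 ξ).toReal -
    (size ξ).toReal : ℝ) : ℂ)

theorem measurable_clusterFourier (t : ℝ) : Measurable (clusterFourier t) := by
  have h1 := (measurable_clusterSum (f := fun x => ENNReal.ofReal (1 + Real.cos (t * x)))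
    (by fun_prop)).comp (measurable_prodMk_left (x := (0 : ℝ)))
  have h2 := (measurable_clusterSum (f := fun x => ENNReal.ofReal (1 + Real.sin (t * x)))
    (by fun_prop)).comp (measurable_prodMk_left (x := (0 : ℝ)))
  have h3 := measurable_size
  exact (Complex.measurable_ofReal.comp (h1.ennreal_toReal.sub h3.ennreal_toReal)).sub
    ((Complex.measurable_ofReal.comp (h2.ennreal_toReal.sub h3.ennreal_toReal)).const_mul _)

theorem exists_finset_alive {ξ : Marks} (hξ : size ξ ≠ ∞) :
    ∃ S : Finset (List ℕ), ∀ v, v ∈ S ↔ Alive ξ v := by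
  have hfin := ENNReal.finite_const_le_of_tsum_ne_top hξ one_ne_zero
  refine ⟨hfin.toFinset, fun v => ?_⟩
  rw [Set.Finite.mem_toFinset, mem_ofPred_eq, aliveInd]
  split_ifs with h <;> simp [h]

section FiniteCluster

variable {ξ : Marks} {S : Finset (List ℕ)} (hS : ∀ v, v ∈ S ↔ Alive ξ v)
include hS

theorem tsum_aliveInd_mul (g : List ℕ → ℝ≥0∞) : ∑' v, aliveInd ξ v * g v = ∑ v ∈ S, g v := by
  rw [tsum_eq_sum (s := S) fun v hv => by rw [aliveInd, if_neg ((hS v).not.1 hv), zero_mul]]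
  exact Finset.sum_congr rfl fun v hv => by rw [aliveInd, if_pos ((hS v).1 hv), one_mul]

theorem size_eq_card : size ξ = S.card := by
  have := tsum_aliveInd_mul hS fun _ => 1
  simpa [size] using this

theorem toReal_tsum_aliveInd_mul {g : List ℕ → ℝ} (hg : ∀ v, 0 ≤ g v) :
    (∑' v, aliveInd ξ v * ENNReal.ofReal (g v)).toReal = ∑ v ∈ S, g v := by
  rw [tsum_aliveInd_mul hS, ← ENNReal.ofReal_sum_of_nonneg fun v _ => hg v,
    ENNReal.toReal_ofReal (Finset.sum_nonneg fun v _ => hg v)]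

theorem clusterFourier_eq_sum (t : ℝ) : clusterFourier t ξ = ∑ v ∈ S, phase t (pos ξ v) := by
  have h1 := toReal_tsum_aliveInd_mul hS (g := fun v => 1 + Real.cos (t * pos ξ v))
    fun v => by linarith [Real.neg_one_le_cos (t * pos ξ v)]
  have h2 := toReal_tsum_aliveInd_mul hS (g := fun v => 1 + Real.sin (t * pos ξ v))
    fun v => by linarith [Real.neg_one_le_sin (t * pos ξ v)]
  simp only [clusterFourier, clusterSum, add_zero, h1, h2, size_eq_card hS, phase_eq]
  simp only [Finset.sum_add_distrib, Finset.sum_sub_distrib, ← Finset.mul_sum, Finset.sum_const]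
  simp

theorem norm_clusterFourier_le (t : ℝ) : ‖clusterFourier t ξ‖ ≤ (size ξ).toReal := by
  rw [clusterFourier_eq_sum hS, size_eq_card hS]
  refine (norm_sum_le _ _).trans ?_
  simp [norm_phase]

/-- The root sits at `0` and contributes `1`. The family of each child is a cluster translated by
the displacement of that child. -/
theorem clusterFourier_eq_one_add (t : ℝ) : clusterFourier t ξ =
    1 + childSumC (fun η => phase t (η []).2 * clusterFourier t η) ξ := by
  classical
  have hj : ∀ j : ℕ, Function.Injective (List.cons j) := fun j => List.cons_injective
  have hSj : ∀ j < (ξ []).1, ∀ w, w ∈ S.preimage (List.cons j) (hj j).injOn ↔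
      Alive (subMarks j ξ) w := fun j hjK w => by
    rw [Finset.mem_preimage, hS, alive_cons, and_iff_right hjK]
  have e : S = insert [] ((Finset.range (ξ []).1).biUnion fun j =>
      (S.preimage (List.cons j) (hj j).injOn).image (List.cons j)) := by
    ext v
    simp only [Finset.mem_insert, Finset.mem_biUnion, Finset.mem_range, Finset.mem_image,
      Finset.mem_preimage]
    constructor
    · intro hv
      cases v with
      | nil => exact Or.inl rfl
      | cons j w => exact Or.inr ⟨j, ((alive_cons _ _ _).1 ((hS _).1 hv)).1, w, hv, rfl⟩
    · rintro (rfl | ⟨j, -, w, hw, rfl⟩)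
      · exact (hS _).2 (alive_nil ξ)
      · exact hw
  rw [clusterFourier_eq_sum hS, e, Finset.sum_insert (by simp), Finset.sum_biUnion, pos_nil,
    phase_zero, childSumC]
  · congr 1
    refine Finset.sum_congr rfl fun j hjK => ?_
    rw [Finset.sum_image (hj j).injOn, clusterFourier_eq_sum (hSj j (Finset.mem_range.1 hjK)),
      Finset.mul_sum]
    exact Finset.sum_congr rfl fun w _ => by rw [pos_cons, phase_add]
  · intro i _ j _ hij
    rw [Function.onFun, Finset.disjoint_left]
    simp only [Finset.mem_image]
    rintro v ⟨w, -, rfl⟩ ⟨w', -, h⟩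
    exact hij (List.cons.inj h).1.symm

end FiniteCluster

/-! ### The third moment of the Fourier transform -/

section FourierMoments

variable {m : ℝ≥0} {D : Measure ℝ} [IsProbabilityMeasure D] (hm : m < 1)

include hm in
theorem ae_exists_finset_alive :
    ∀ᵐ ξ ∂(treeLaw m D), ∃ S : Finset (List ℕ), ∀ v, v ∈ S ↔ Alive ξ v :=
  (ae_lt_top measurable_size (lintegral_size_ne_top hm)).mono fun _ h => exists_finset_alive h.ne

include hm in
theorem memLp_clusterFourier (t : ℝ) : MemLp (clusterFourier t) 3 (treeLaw m D) := by
  have h1 := memLp_three_toReal (P := treeLaw m D) measurable_size (by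
    refine lt_top_iff_ne_top.2 ?_
    have := lintegral_size_cube_ne_top (D := D) hm
    simpa only [pow_succ, pow_zero, one_mul] using this)
  refine MemLp.of_le h1 (measurable_clusterFourier t).aestronglyMeasurable ?_
  filter_upwards [ae_exists_finset_alive hm] with ξ ⟨S, hS⟩
  rw [Real.norm_of_nonneg ENNReal.toReal_nonneg]
  exact norm_clusterFourier_le hS t

/-- The Fourier transform of a cluster translated by the displacement of its root. -/
noncomputable def shiftedFourier (t : ℝ) (ξ : Marks) : ℂ := phase t (ξ []).2 * clusterFourier t ξ

theorem measurable_shiftedFourier (t : ℝ) : Measurable (shiftedFourier t) :=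
  ((measurable_phase t).comp (measurable_snd.comp (measurable_pi_apply []))).mul
    (measurable_clusterFourier t)

include hm in
theorem memLp_shiftedFourier (t : ℝ) : MemLp (shiftedFourier t) 3 (treeLaw m D) :=
  (memLp_clusterFourier hm t).of_le (measurable_shiftedFourier t).aestronglyMeasurable
    (Eventually.of_forall fun ξ => by rw [shiftedFourier, norm_mul, norm_phase, one_mul])

include hm in
theorem ae_clusterFourier_eq :
    ∀ᵐ ξ ∂(treeLaw m D), ∀ t, clusterFourier t ξ = 1 + childSumC (shiftedFourier t) ξ := by
  filter_upwards [ae_exists_finset_alive hm] with ξ ⟨S, hS⟩ t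
  exact clusterFourier_eq_one_add hS t

include hm in
theorem memLp_childSumC_shiftedFourier (t : ℝ) :
    MemLp (childSumC (shiftedFourier t)) 3 (treeLaw m D) := by
  refine ((memLp_clusterFourier hm t).sub (memLp_const 1)).ae_eq ?_
  filter_upwards [ae_clusterFourier_eq hm] with ξ h
  simp [h]

/-- Positions relative to the root never use the displacement stored at the root. It is therefore
independent of any `F` built from the number of children and their families. -/
theorem integral_phase_mul {F : Marks → ℂ} {G : ℕ × (ℕ → Marks) → ℂ} (hG : Measurable G)
    (hFG : ∀ᵐ ξ ∂(treeLaw m D), F ξ = G ((ξ []).1, fun j => subMarks j ξ))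
    (hF : Integrable F (treeLaw m D)) (t : ℝ) :
    ∫ ξ, phase t (ξ []).2 * F ξ ∂(treeLaw m D) = (∫ d, phase t d ∂D) * ∫ ξ, F ξ ∂(treeLaw m D) := by
  have hF' := hF.congr hFG
  have e : ∫ ξ, phase t (ξ []).2 * F ξ ∂(treeLaw m D) =
      ∫ ξ, phase t (ξ []).2 * G ((ξ []).1, fun j => subMarks j ξ) ∂(treeLaw m D) :=
    integral_congr_ae (hFG.mono fun ξ h => by simp only [h])
  rw [e, integral_congr_ae hFG, integral_children hG hF', integral_displacement_mul
    (measurable_phase t) hG]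
  refine hF'.bdd_mul (c := 1) ?_ (Eventually.of_forall fun ξ => (norm_phase _ _).le)
  exact ((measurable_phase t).comp
    (measurable_snd.comp (measurable_pi_apply []))).aestronglyMeasurable

end FourierMoments

section FourierMoments

variable {m : ℝ≥0} {D : Measure ℝ} [IsProbabilityMeasure D]

theorem measurable_one_add_sum_range (t : ℝ) : Measurable fun p : ℕ × (ℕ → Marks) =>
    1 + ∑ j ∈ Finset.range p.1, shiftedFourier t (p.2 j) :=
  (measurable_sum_range (measurable_shiftedFourier t)).const_add 1

variable (hm : m < 1)
include hm

/-- Averaging the branching recursion gives a linear equation whose coefficient is `1 - m` times the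
delay transform at `s`. The next two moments solve similar equations, with the transform taken at
the sum of the frequencies. -/
theorem integral_clusterFourier (s : ℝ) :
    ∫ ξ, clusterFourier s ξ ∂(treeLaw m D) =
      1 + (m : ℝ) * ((∫ d, phase s d ∂D) * ∫ ξ, clusterFourier s ξ ∂(treeLaw m D)) := by
  have h1 := integral_phase_mul (measurable_one_add_sum_range s)
    ((ae_clusterFourier_eq (D := D) hm).mono fun ξ h => h s)
    ((memLp_clusterFourier hm s).integrable (by norm_num)) s
  have h2 : ∫ ξ, shiftedFourier s ξ ∂(treeLaw m D) = _ := h1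
  rw [← h2, ← integral_childSumC (measurable_shiftedFourier s) (memLp_shiftedFourier hm s)
    (memLp_childSumC_shiftedFourier hm s), integral_congr_ae
    ((ae_clusterFourier_eq (D := D) hm).mono fun ξ h => h s), integral_add (integrable_const _)
    ((memLp_childSumC_shiftedFourier hm s).integrable (by norm_num))]
  simp

theorem integral_shiftedFourier_mul (s t : ℝ) :
    ∫ ξ, shiftedFourier s ξ * shiftedFourier t ξ ∂(treeLaw m D) = (∫ d, phase (s + t) d ∂D) *
      ∫ ξ, clusterFourier s ξ * clusterFourier t ξ ∂(treeLaw m D) := by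
  rw [← integral_phase_mul ((measurable_one_add_sum_range s).mul
    (measurable_one_add_sum_range t)) ((ae_clusterFourier_eq (D := D) hm).mono
    fun ξ h => by rw [h, h]; rfl) (integrable_mul_of_memLp (memLp_clusterFourier hm s)
    (memLp_clusterFourier hm t))]
  refine integral_congr_ae (Eventually.of_forall fun ξ => ?_)
  simp only [shiftedFourier, ← phase_mul_phase]
  ring

theorem integral_shiftedFourier_mul_mul (s t u : ℝ) :
    ∫ ξ, shiftedFourier s ξ * shiftedFourier t ξ * shiftedFourier u ξ ∂(treeLaw m D) =
      (∫ d, phase (s + t + u) d ∂D) *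
        ∫ ξ, clusterFourier s ξ * clusterFourier t ξ * clusterFourier u ξ ∂(treeLaw m D) := by
  rw [← integral_phase_mul (((measurable_one_add_sum_range s).mul
    (measurable_one_add_sum_range t)).mul (measurable_one_add_sum_range u))
    ((ae_clusterFourier_eq (D := D) hm).mono fun ξ h => by rw [h, h, h]; rfl)
    (integrable_mul_mul_of_memLp (memLp_clusterFourier hm s)
    (memLp_clusterFourier hm t) (memLp_clusterFourier hm u))]
  refine integral_congr_ae (Eventually.of_forall fun ξ => ?_)
  simp only [shiftedFourier, ← phase_mul_phase]
  ring

theorem integral_childSumC_shiftedFourier (s : ℝ) :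
    ∫ ξ, childSumC (shiftedFourier s) ξ ∂(treeLaw m D) =
      ∫ ξ, clusterFourier s ξ ∂(treeLaw m D) - 1 := by
  rw [integral_congr_ae ((ae_clusterFourier_eq (D := D) hm).mono fun ξ h => h s), integral_add
    (integrable_const _) ((memLp_childSumC_shiftedFourier hm s).integrable (by norm_num))]
  simp

theorem integral_clusterFourier_mul (s t : ℝ) :
    ∫ ξ, clusterFourier s ξ * clusterFourier t ξ ∂(treeLaw m D) =
      (∫ ξ, clusterFourier s ξ ∂(treeLaw m D)) * (∫ ξ, clusterFourier t ξ ∂(treeLaw m D)) +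
      (m : ℝ) * ((∫ d, phase (s + t) d ∂D) *
        ∫ ξ, clusterFourier s ξ * clusterFourier t ξ ∂(treeLaw m D)) := by
  have S := fun s => memLp_childSumC_shiftedFourier (D := D) hm s
  have W := fun s => memLp_shiftedFourier (D := D) hm s
  have i1 := fun s => (S s).integrable (by norm_num)
  have e : ∀ᵐ ξ ∂(treeLaw m D), clusterFourier s ξ * clusterFourier t ξ =
      (1 + childSumC (shiftedFourier s) ξ + childSumC (shiftedFourier t) ξ) +
        childSumC (shiftedFourier s) ξ * childSumC (shiftedFourier t) ξ :=
    (ae_clusterFourier_eq hm).mono fun ξ h => by rw [h, h]; ring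
  have i2 : Integrable (fun ξ => 1 + childSumC (shiftedFourier s) ξ) (treeLaw m D) :=
    (integrable_const _).add (i1 s)
  have i3 : Integrable (fun ξ => 1 + childSumC (shiftedFourier s) ξ + childSumC (shiftedFourier t) ξ)
    (treeLaw m D) := i2.add (i1 t)
  rw [← integral_shiftedFourier_mul hm s t, integral_congr_ae e, integral_add i3
    (integrable_mul_of_memLp (S s) (S t)), integral_add i2 (i1 t),
    integral_add (integrable_const _) (i1 s), integral_childSumC_mul (measurable_shiftedFourier s)
      (measurable_shiftedFourier t) (W s) (W t) (S s) (S t)]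
  have a := integral_childSumC (measurable_shiftedFourier s) (W s) (S s)
  have b := integral_childSumC (measurable_shiftedFourier t) (W t) (S t)
  rw [integral_childSumC_shiftedFourier hm] at a b ⊢
  rw [integral_childSumC_shiftedFourier hm]
  simp only [integral_const, probReal_univ, one_smul]
  linear_combination (-(m : ℝ) * ∫ ξ, shiftedFourier t ξ ∂(treeLaw m D)) * a -
    (∫ ξ, clusterFourier s ξ ∂(treeLaw m D) - 1) * b

theorem integral_clusterFourier_mul_mul (s t u : ℝ) :
    ∫ ξ, clusterFourier s ξ * clusterFourier t ξ * clusterFourier u ξ ∂(treeLaw m D) =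
      (∫ ξ, clusterFourier s ξ ∂(treeLaw m D)) * (∫ ξ, clusterFourier t ξ ∂(treeLaw m D)) *
        (∫ ξ, clusterFourier u ξ ∂(treeLaw m D)) +
      (m : ℝ) * ((∫ d, phase (s + t) d ∂D) *
        ∫ ξ, clusterFourier s ξ * clusterFourier t ξ ∂(treeLaw m D)) *
        (∫ ξ, clusterFourier u ξ ∂(treeLaw m D)) +
      (m : ℝ) * ((∫ d, phase (s + u) d ∂D) *
        ∫ ξ, clusterFourier s ξ * clusterFourier u ξ ∂(treeLaw m D)) *
        (∫ ξ, clusterFourier t ξ ∂(treeLaw m D)) +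
      (m : ℝ) * ((∫ d, phase (t + u) d ∂D) *
        ∫ ξ, clusterFourier t ξ * clusterFourier u ξ ∂(treeLaw m D)) *
        (∫ ξ, clusterFourier s ξ ∂(treeLaw m D)) +
      (m : ℝ) * ((∫ d, phase (s + t + u) d ∂D) *
        ∫ ξ, clusterFourier s ξ * clusterFourier t ξ * clusterFourier u ξ ∂(treeLaw m D)) := by
  have S := fun s => memLp_childSumC_shiftedFourier (D := D) hm s
  have W := fun s => memLp_shiftedFourier (D := D) hm s
  have mW := measurable_shiftedFourier
  have Z := fun s => memLp_clusterFourier (D := D) hm s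
  have i1 := fun s => (S s).integrable (by norm_num)
  -- Keeping the product of the first two factors whole lets the second-moment identity be reused in
  -- `k`.
  have e : ∀ᵐ ξ ∂(treeLaw m D), clusterFourier s ξ * clusterFourier t ξ * clusterFourier u ξ =
      (((clusterFourier s ξ * clusterFourier t ξ +
        childSumC (shiftedFourier u) ξ) +
        childSumC (shiftedFourier s) ξ * childSumC (shiftedFourier u) ξ) +
        childSumC (shiftedFourier t) ξ * childSumC (shiftedFourier u) ξ) +
        childSumC (shiftedFourier s) ξ * childSumC (shiftedFourier t) ξ *
          childSumC (shiftedFourier u) ξ :=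
    (ae_clusterFourier_eq hm).mono fun ξ h => by rw [h, h, h]; ring
  have i2 : Integrable (fun ξ => clusterFourier s ξ * clusterFourier t ξ +
      childSumC (shiftedFourier u) ξ) (treeLaw m D) :=
    (integrable_mul_of_memLp (Z s) (Z t)).add (i1 u)
  have i3 : Integrable (fun ξ => clusterFourier s ξ * clusterFourier t ξ +
      childSumC (shiftedFourier u) ξ + childSumC (shiftedFourier s) ξ *
      childSumC (shiftedFourier u) ξ) (treeLaw m D) := i2.add (integrable_mul_of_memLp (S s) (S u))
  have i4 : Integrable (fun ξ => clusterFourier s ξ * clusterFourier t ξ +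
      childSumC (shiftedFourier u) ξ + childSumC (shiftedFourier s) ξ *
      childSumC (shiftedFourier u) ξ + childSumC (shiftedFourier t) ξ *
      childSumC (shiftedFourier u) ξ) (treeLaw m D) := i3.add (integrable_mul_of_memLp (S t) (S u))
  rw [← integral_shiftedFourier_mul_mul hm s t u, integral_congr_ae e, integral_add i4
    (integrable_mul_mul_of_memLp (S s) (S t) (S u)), integral_add i3
    (integrable_mul_of_memLp (S t) (S u)), integral_add i2
    (integrable_mul_of_memLp (S s) (S u)), integral_add (integrable_mul_of_memLp (Z s) (Z t)) (i1 u),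
    integral_childSumC_mul (mW s) (mW u) (W s) (W u) (S s) (S u),
    integral_childSumC_mul (mW t) (mW u) (W t) (W u) (S t) (S u),
    integral_childSumC_mul_mul (mW s) (mW t) (mW u) (W s) (W t) (W u) (S s) (S t) (S u)]
  have a := integral_childSumC (mW s) (W s) (S s)
  have b := integral_childSumC (mW t) (W t) (S t)
  have c := integral_childSumC (mW u) (W u) (S u)
  have k := integral_clusterFourier_mul (D := D) hm s t
  rw [integral_childSumC_shiftedFourier hm] at a b c ⊢
  rw [← integral_shiftedFourier_mul hm s t] at k ⊢
  rw [← integral_shiftedFourier_mul hm s u, ← integral_shiftedFourier_mul hm t u]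
  generalize ∫ ξ, shiftedFourier s ξ * shiftedFourier t ξ * shiftedFourier u ξ ∂(treeLaw m D) = w₃ at *
  generalize ∫ ξ, shiftedFourier s ξ * shiftedFourier t ξ ∂(treeLaw m D) = wst at *
  generalize ∫ ξ, shiftedFourier s ξ * shiftedFourier u ξ ∂(treeLaw m D) = wsu at *
  generalize ∫ ξ, shiftedFourier t ξ * shiftedFourier u ξ ∂(treeLaw m D) = wtu at *
  generalize ∫ ξ, shiftedFourier s ξ ∂(treeLaw m D) = ws at *
  generalize ∫ ξ, shiftedFourier t ξ ∂(treeLaw m D) = wt at *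
  generalize ∫ ξ, shiftedFourier u ξ ∂(treeLaw m D) = wu at *
  generalize ∫ ξ, clusterFourier s ξ * clusterFourier t ξ ∂(treeLaw m D) = zst at *
  obtain rfl := k
  rw [sub_eq_iff_eq_add.1 a, sub_eq_iff_eq_add.1 b, sub_eq_iff_eq_add.1 c]
  ring

/-- The third moment which governs the diagonal of the bispectrum. -/
theorem third_moment_identity (t : ℝ) :
    (1 - (m : ℝ)) *
      (∫ ξ, clusterFourier t ξ * clusterFourier t ξ * clusterFourier (-2 * t) ξ ∂(treeLaw m D)) *
      (Complex.normSq (1 - (m : ℝ) * ∫ d, phase t d ∂D) ^ 2 *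
        Complex.normSq (1 - (m : ℝ) * ∫ d, phase (2 * t) d ∂D) : ℝ) =
    1 - (m : ℝ) ^ 2 * (starRingEnd ℂ (∫ d, phase t d ∂D) ^ 2 +
      2 * starRingEnd ℂ (∫ d, phase t d ∂D) * (∫ d, phase (2 * t) d ∂D) -
      2 * (m : ℝ) * starRingEnd ℂ (∫ d, phase t d ∂D) ^ 2 * (∫ d, phase (2 * t) d ∂D)) := by
  have h0 := integral_clusterFourier_mul_mul (D := D) hm t t (-2 * t)
  have h1 := integral_clusterFourier_mul (D := D) hm t t
  have h2 := integral_clusterFourier_mul (D := D) hm t (-2 * t)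
  have h3 := integral_clusterFourier (D := D) hm t
  have h4 := integral_clusterFourier (D := D) hm (-2 * t)
  have p0 : ∫ d, phase 0 d ∂D = 1 := by simp [phase]
  have cj : ∀ s, ∫ d, phase (-s) d ∂D = starRingEnd ℂ (∫ d, phase s d ∂D) := fun s => by
    rw [← integral_conj]
    simp only [conj_phase]
  -- The three frequencies sum to zero, so the third-moment equation has the coefficient `1 - m`.
  rw [show t + t + -2 * t = 0 by ring, show t + -2 * t = -t by ring, ← two_mul, p0, cj] at h0
  rw [← two_mul] at h1
  rw [show t + -2 * t = -t by ring, cj] at h2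
  rw [show -2 * t = -(2 * t) by ring, cj, show -(2 * t) = -2 * t by ring] at h4
  rw [Complex.ofReal_mul, Complex.ofReal_pow, Complex.normSq_eq_conj_mul_self,
    Complex.normSq_eq_conj_mul_self]
  simp only [map_sub, map_one, map_mul, Complex.conj_ofReal]
  generalize ∫ d, phase t d ∂D = p at *
  generalize ∫ d, phase (2 * t) d ∂D = p2 at *
  generalize starRingEnd ℂ p = pb at *
  generalize starRingEnd ℂ p2 = p2b at *
  generalize ∫ ξ, clusterFourier t ξ * clusterFourier t ξ * clusterFourier (-2 * t) ξ
    ∂(treeLaw m D) = x at *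
  generalize ∫ ξ, clusterFourier t ξ * clusterFourier (-2 * t) ξ ∂(treeLaw m D) = B at *
  generalize ∫ ξ, clusterFourier t ξ * clusterFourier t ξ ∂(treeLaw m D) = A at *
  generalize ∫ ξ, clusterFourier t ξ ∂(treeLaw m D) = z at *
  generalize ∫ ξ, clusterFourier (-2 * t) ξ ∂(treeLaw m D) = c at *
  generalize ((m : ℝ) : ℂ) = μ at *
  have g3 : z * (1 - μ * p) = 1 := by linear_combination h3
  have g4 : c * (1 - μ * p2b) = 1 := by linear_combination h4
  have g1 : A * (1 - μ * p2) = z * z := by linear_combination h1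
  have g2 : B * (1 - μ * pb) = z * c := by linear_combination h2
  have g0 : x * (1 - μ) = A * c + 2 * B * z - 2 * (z * z) * c := by
    linear_combination h0 - c * h1 - 2 * z * h2
  -- The real factor multiplying the moment clears all denominators in `g1` to `g4`, so each summand
  -- of `g0` becomes a polynomial in `pb` and `p2`.
  have k1 : A * c * (((1 - μ * pb) * (1 - μ * p)) ^ 2 * ((1 - μ * p2b) * (1 - μ * p2))) =
      (1 - μ * pb) ^ 2 := by
    calc _ = (A * (1 - μ * p2)) * (c * (1 - μ * p2b)) * (1 - μ * p) ^ 2 * (1 - μ * pb) ^ 2 := by ring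
      _ = (z * (1 - μ * p)) ^ 2 * (1 - μ * pb) ^ 2 := by rw [g1, g4]; ring
      _ = _ := by rw [g3]; ring
  have k2 : B * z * (((1 - μ * pb) * (1 - μ * p)) ^ 2 * ((1 - μ * p2b) * (1 - μ * p2))) =
      (1 - μ * pb) * (1 - μ * p2) := by
    calc _ = (B * (1 - μ * pb)) * z * (1 - μ * p) ^ 2 * (1 - μ * pb) *
          ((1 - μ * p2b) * (1 - μ * p2)) := by ring
      _ = (z * (1 - μ * p)) ^ 2 * (c * (1 - μ * p2b)) * ((1 - μ * pb) * (1 - μ * p2)) := by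
          rw [g2]; ring
      _ = _ := by rw [g3, g4]; ring
  have k3 : z * z * c * (((1 - μ * pb) * (1 - μ * p)) ^ 2 * ((1 - μ * p2b) * (1 - μ * p2))) =
      (1 - μ * pb) ^ 2 * (1 - μ * p2) := by
    calc _ = (z * (1 - μ * p)) ^ 2 * (c * (1 - μ * p2b)) * ((1 - μ * pb) ^ 2 * (1 - μ * p2)) := by
          ring
      _ = _ := by rw [g3, g4]; ring
  linear_combination (((1 - μ * pb) * (1 - μ * p)) ^ 2 * ((1 - μ * p2b) * (1 - μ * p2))) * g0 + k1 +
    2 * k2 - 2 * k3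

end FourierMoments

/-! ### The imaginary part of the bispectrum on the diagonal -/

theorem phase_im (t x : ℝ) : (phase t x).im = -Real.sin (t * x) := by
  rw [phase_eq, Complex.sub_im, Complex.I_mul_im, Complex.ofReal_im, Complex.ofReal_re, zero_sub]

/-! ### Sine sums over triples, with and without coincidences. -/

section Trigonometric

variable {ι : Type*} (S : Finset ι) (θ : ι → ℝ)

theorem sum_sum_eq_zero_of_antisymm {f : ι → ι → ℝ} (hf : ∀ v w, f v w = -f w v) :
    ∑ v ∈ S, ∑ w ∈ S, f v w = 0 := by
  have h : ∑ v ∈ S, ∑ w ∈ S, f v w = -∑ v ∈ S, ∑ w ∈ S, f v w := by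
    conv_lhs => rw [Finset.sum_comm]
    rw [← Finset.sum_neg_distrib]
    refine Finset.sum_congr rfl fun v _ => ?_
    rw [← Finset.sum_neg_distrib]
    exact Finset.sum_congr rfl fun w _ => hf w v
  linarith

/-- If two of the three indices agree, the summand is antisymmetric in the two remaining ones, so
its sum vanishes; a total coincidence gives `sin 0`. Distinctness can therefore be dropped. -/
theorem sum_sin_distinct [DecidableEq ι] :
    ∑ v ∈ S, ∑ w ∈ S, ∑ r ∈ S,
        (if v ≠ w ∧ v ≠ r ∧ w ≠ r then Real.sin (θ w + θ r - 2 * θ v) else 0) =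
      ∑ v ∈ S, ∑ w ∈ S, ∑ r ∈ S, Real.sin (θ w + θ r - 2 * θ v) := by
  have key : ∀ v w r, (if v ≠ w ∧ v ≠ r ∧ w ≠ r then Real.sin (θ w + θ r - 2 * θ v) else 0) =
      Real.sin (θ w + θ r - 2 * θ v) - (if v = w then Real.sin (θ r - θ v) else 0)
        - (if v = r then Real.sin (θ w - θ v) else 0)
        - (if w = r then Real.sin (2 * θ w - 2 * θ v) else 0) := by
    intro v w r
    by_cases h1 : v = w
    · subst h1
      by_cases h2 : v = r
      · subst h2
        simp [show θ v + θ v - 2 * θ v = 0 by ring]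
      · simp only [ne_eq, not_true_eq_false, false_and, if_false, if_true, h2]
        rw [show θ v + θ r - 2 * θ v = θ r - θ v by ring]
        ring
    · by_cases h2 : v = r
      · subst h2
        simp only [ne_eq, not_true_eq_false, false_and, and_false, if_false, if_true, h1,
          Ne.symm h1]
        rw [show θ w + θ v - 2 * θ v = θ w - θ v by ring]
        ring
      · by_cases h3 : w = r
        · subst h3
          simp only [ne_eq, not_true_eq_false, and_false, if_false, if_true, h1]
          rw [show θ w + θ w - 2 * θ v = 2 * θ w - 2 * θ v by ring]
          ring
        · simp [h1, h2, h3]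
  have a1 : ∑ v ∈ S, ∑ w ∈ S, ∑ r ∈ S, (if v = w then Real.sin (θ r - θ v) else 0) = 0 := by
    refine Eq.trans (Finset.sum_congr rfl fun v hv => ?_) (sum_sum_eq_zero_of_antisymm S
      (f := fun v r => Real.sin (θ r - θ v)) fun v w => by rw [← Real.sin_neg, neg_sub])
    rw [Finset.sum_comm]
    exact Finset.sum_congr rfl fun r _ => by rw [Finset.sum_ite_eq, if_pos hv]
  have a2 : ∑ v ∈ S, ∑ w ∈ S, ∑ r ∈ S, (if v = r then Real.sin (θ w - θ v) else 0) = 0 := by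
    refine Eq.trans (Finset.sum_congr rfl fun v hv => ?_) (sum_sum_eq_zero_of_antisymm S
      (f := fun v r => Real.sin (θ r - θ v)) fun v w => by rw [← Real.sin_neg, neg_sub])
    exact Finset.sum_congr rfl fun r _ => by rw [Finset.sum_ite_eq, if_pos hv]
  have a3 : ∑ v ∈ S, ∑ w ∈ S, ∑ r ∈ S, (if w = r then Real.sin (2 * θ w - 2 * θ v) else 0) = 0 := by
    refine Eq.trans (Finset.sum_congr rfl fun v hv => ?_) (sum_sum_eq_zero_of_antisymm S
      (f := fun v r => Real.sin (2 * θ r - 2 * θ v)) fun v w => by rw [← Real.sin_neg, neg_sub])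
    exact Finset.sum_congr rfl fun r hr => by rw [Finset.sum_ite_eq, if_pos hr]
  simp_rw [key, Finset.sum_sub_distrib]
  rw [a1, a2, a3]
  ring

end Trigonometric

section FiniteCluster

variable {ξ : Marks} {S : Finset (List ℕ)} (hS : ∀ v, v ∈ S ↔ Alive ξ v)
include hS

theorem toReal_tsum_lag {F : ℝ × ℝ → ℝ} (hF : ∀ τ, 0 ≤ F τ) :
    (∑' v, ∑' w, ∑' r, (if v ≠ w ∧ v ≠ r ∧ w ≠ r then aliveInd ξ v * aliveInd ξ w * aliveInd ξ r *
      ENNReal.ofReal (F (lag v w r ξ)) else 0)).toReal =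
    ∑ v ∈ S, ∑ w ∈ S, ∑ r ∈ S, if v ≠ w ∧ v ≠ r ∧ w ≠ r then F (lag v w r ξ) else 0 := by
  have e : ∀ v w r, (if v ≠ w ∧ v ≠ r ∧ w ≠ r then aliveInd ξ v * aliveInd ξ w * aliveInd ξ r *
      ENNReal.ofReal (F (lag v w r ξ)) else 0) = aliveInd ξ v * (aliveInd ξ w * (aliveInd ξ r *
        ENNReal.ofReal (if v ≠ w ∧ v ≠ r ∧ w ≠ r then F (lag v w r ξ) else 0))) := fun v w r => by
    split_ifs
    · ring
    · simp
  have p : ∀ v w r, 0 ≤ (if v ≠ w ∧ v ≠ r ∧ w ≠ r then F (lag v w r ξ) else 0) := fun v w r => by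
    split_ifs
    · exact hF _
    · exact le_rfl
  simp_rw [e, ENNReal.tsum_mul_left, tsum_aliveInd_mul hS]
  simp_rw [← ENNReal.ofReal_sum_of_nonneg fun r _ => p _ _ r]
  simp_rw [← ENNReal.ofReal_sum_of_nonneg fun w _ => Finset.sum_nonneg fun r _ => p _ w r]
  rw [← ENNReal.ofReal_sum_of_nonneg fun v _ => Finset.sum_nonneg fun w _ =>
    Finset.sum_nonneg fun r _ => p v w r, ENNReal.toReal_ofReal (Finset.sum_nonneg fun v _ =>
    Finset.sum_nonneg fun w _ => Finset.sum_nonneg fun r _ => p v w r)]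

theorem clusterFourier_mul_mul_im (t : ℝ) :
    (clusterFourier t ξ * clusterFourier t ξ * clusterFourier (-2 * t) ξ).im =
      -∑ v ∈ S, ∑ w ∈ S, ∑ r ∈ S, Real.sin (t * pos ξ w + t * pos ξ r - 2 * (t * pos ξ v)) := by
  have e : clusterFourier t ξ * clusterFourier t ξ * clusterFourier (-2 * t) ξ =
      ∑ v ∈ S, ∑ w ∈ S, ∑ r ∈ S, phase 1 (t * pos ξ w + t * pos ξ r - 2 * (t * pos ξ v)) := by
    rw [mul_comm, clusterFourier_eq_sum hS, clusterFourier_eq_sum hS, Finset.sum_mul_sum,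
      Finset.sum_mul]
    refine Finset.sum_congr rfl fun v _ => ?_
    rw [Finset.mul_sum]
    refine Finset.sum_congr rfl fun w _ => ?_
    rw [Finset.mul_sum]
    refine Finset.sum_congr rfl fun r _ => ?_
    simp only [phase, ← Complex.exp_add]
    congr 1
    push_cast
    ring
  rw [e]
  simp only [Complex.im_sum, phase_im, one_mul, Finset.sum_neg_distrib]

end FiniteCluster

section Bispectrum

variable {m : ℝ≥0} {D : Measure ℝ} [IsProbabilityMeasure D] (hm : m < 1)
include hm

/-- In terms of positions, the phase of a triple has frequency `-2t` at the reference individual and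
`t` at the other two. Its sum over all triples is a product of three cluster transforms. -/
theorem integral_sin_lagMeasure (t : ℝ) :
    ∫ τ : ℝ × ℝ, Real.sin (t * τ.1 + t * τ.2) ∂(lagMeasure m D) =
      -(∫ ξ, clusterFourier t ξ * clusterFourier t ξ * clusterFourier (-2 * t) ξ
        ∂(treeLaw m D)).im := by
  have := isFiniteMeasure_lagMeasure (D := D) hm
  have hsin : Integrable (fun τ : ℝ × ℝ => Real.sin (t * τ.1 + t * τ.2)) (lagMeasure m D) :=
    Integrable.of_bound (Continuous.aestronglyMeasurable (by fun_prop)) 1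
      (Eventually.of_forall fun τ => Real.abs_sin_le_one _)
  have mT : ∀ {F : ℝ × ℝ → ℝ}, Measurable F → Measurable fun ξ => ∑' v, ∑' w, ∑' r,
      (if v ≠ w ∧ v ≠ r ∧ w ≠ r then aliveInd ξ v * aliveInd ξ w * aliveInd ξ r *
        ENNReal.ofReal (F (lag v w r ξ)) else 0) := fun hF =>
    Measurable.tsum fun v => Measurable.tsum fun w => Measurable.tsum fun r => by
      split_ifs
      · exact (((measurable_aliveInd v).mul (measurable_aliveInd w)).mul (measurable_aliveInd r)).mul
          (hF.comp (measurable_lag v w r)).ennreal_ofReal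
      · exact measurable_const
  have key : ∀ {F : ℝ × ℝ → ℝ}, Measurable F → (∀ τ, 0 ≤ F τ) → (∀ τ, F τ ≤ 2) →
      Integrable (fun ξ => (∑' v, ∑' w, ∑' r, (if v ≠ w ∧ v ≠ r ∧ w ≠ r then
        aliveInd ξ v * aliveInd ξ w * aliveInd ξ r *
        ENNReal.ofReal (F (lag v w r ξ)) else 0)).toReal) (treeLaw m D) ∧
      ∫ ξ, (∑' v, ∑' w, ∑' r, (if v ≠ w ∧ v ≠ r ∧ w ≠ r then
        aliveInd ξ v * aliveInd ξ w * aliveInd ξ r *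
        ENNReal.ofReal (F (lag v w r ξ)) else 0)).toReal ∂(treeLaw m D) =
      ∫ τ, F τ ∂(lagMeasure m D) := fun {F} hF h0 h2 => by
    have hi : Integrable F (lagMeasure m D) := Integrable.of_bound hF.aestronglyMeasurable 2
      (Eventually.of_forall fun τ => by rw [Real.norm_of_nonneg (h0 τ)]; exact h2 τ)
    have := integrable_and_integral_toReal (mT hF) (lintegral_lagMeasure hF.ennreal_ofReal).symm
      hi.lintegral_lt_top.ne
    rwa [← integral_eq_lintegral_of_nonneg_ae (Eventually.of_forall h0) hi.1] at this
  -- The shift by `1` makes the integrand nonnegative; the total mass, supplied by `k2`, is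
  -- subtracted again.
  have k1 := key (F := fun τ => 1 + Real.sin (t * τ.1 + t * τ.2)) (by fun_prop)
    (fun τ => by linarith [Real.neg_one_le_sin (t * τ.1 + t * τ.2)])
    (fun τ => by linarith [Real.sin_le_one (t * τ.1 + t * τ.2)])
  have k2 := key (F := fun _ => 1) (by fun_prop) (fun _ => zero_le_one) (fun _ => one_le_two)
  have e1 : ∫ τ : ℝ × ℝ, Real.sin (t * τ.1 + t * τ.2) ∂(lagMeasure m D) =
      ∫ τ : ℝ × ℝ, (1 + Real.sin (t * τ.1 + t * τ.2)) ∂(lagMeasure m D) -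
        ∫ τ : ℝ × ℝ, (1 : ℝ) ∂(lagMeasure m D) := by
    rw [integral_add (integrable_const _) hsin]
    ring
  have hZ := integrable_mul_mul_of_memLp (memLp_clusterFourier (D := D) hm t)
    (memLp_clusterFourier hm t) (memLp_clusterFourier hm (-2 * t))
  have e2 : (∫ ξ, clusterFourier t ξ * clusterFourier t ξ * clusterFourier (-2 * t) ξ
      ∂(treeLaw m D)).im = ∫ ξ, (clusterFourier t ξ * clusterFourier t ξ *
      clusterFourier (-2 * t) ξ).im ∂(treeLaw m D) := (integral_im hZ).symm
  rw [e1, ← k1.2, ← k2.2, ← integral_sub k1.1 k2.1, e2, ← integral_neg]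
  refine integral_congr_ae ?_
  filter_upwards [ae_exists_finset_alive hm] with ξ ⟨S, hS⟩
  rw [clusterFourier_mul_mul_im hS, neg_neg, ← sum_sin_distinct, toReal_tsum_lag hS (F := fun _ => 1)
    (fun _ => zero_le_one), toReal_tsum_lag hS (F := fun τ => 1 + Real.sin (t * τ.1 + t * τ.2))
    (fun τ => by linarith [Real.neg_one_le_sin (t * τ.1 + t * τ.2)])]
  simp only [← Finset.sum_sub_distrib]
  refine Finset.sum_congr rfl fun v _ => Finset.sum_congr rfl fun w _ =>
    Finset.sum_congr rfl fun r _ => ?_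
  split_ifs
  · rw [add_sub_cancel_left]
    congr 1
    simp only [lag]
    ring
  · ring

end Bispectrum

theorem bispectrum_clusterDensity_im {ν m : ℝ≥0} {h : ℝ → ℝ} (hh : IsDelayDensity h) (hm : m < 1)
    (t : ℝ) : (bispectrum (clusterDensity ν m h) t t).im =
      ν * (∫ ξ, clusterFourier t ξ * clusterFourier t ξ * clusterFourier (-2 * t) ξ
        ∂(treeLaw m (delayLaw h))).im := by
  have := hh.isProbabilityMeasure
  have := isFiniteMeasure_lagMeasure (D := delayLaw h) hm
  have e : bispectrum (clusterDensity ν m h) t t =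
      (ν : ℝ) * ∫ τ : ℝ × ℝ, phase 1 (t * τ.1 + t * τ.2) ∂(lagMeasure m (delayLaw h)) := by
    rw [← integral_rnDeriv_smul (lagMeasure_absolutelyContinuous (delayLaw_absolutelyContinuous h)),
      ← integral_const_mul, bispectrum]
    refine integral_congr_ae (Eventually.of_forall fun τ => ?_)
    simp only [clusterDensity, phase, one_mul, Complex.real_smul]
    push_cast
    ring
  have hi : Integrable (fun τ : ℝ × ℝ => phase 1 (t * τ.1 + t * τ.2))
      (lagMeasure m (delayLaw h)) := Integrable.of_bound
    ((measurable_phase 1).comp (by fun_prop)).aestronglyMeasurable 1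
    (Eventually.of_forall fun τ => (norm_phase _ _).le)
  have e2 : (∫ τ : ℝ × ℝ, phase 1 (t * τ.1 + t * τ.2) ∂(lagMeasure m (delayLaw h))).im =
      ∫ τ : ℝ × ℝ, (phase 1 (t * τ.1 + t * τ.2)).im ∂(lagMeasure m (delayLaw h)) :=
    (integral_im hi).symm
  rw [e, Complex.im_ofReal_mul, e2]
  simp only [phase_im, one_mul]
  rw [integral_neg, integral_sin_lagMeasure hm, neg_neg]

/-! ### Symmetry forced by a vanishing imaginary part -/

/-- Vanishing sine integrals mean that the characteristic function is real, hence equal to that of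
the reflected measure. -/
theorem map_neg_eq_of_integral_sin_eq_zero {μ : Measure ℝ} [IsFiniteMeasure μ]
    (hμ : ∀ t : ℝ, ∫ x, Real.sin (t * x) ∂μ = 0) : μ.map (fun x => -x) = μ := by
  refine Measure.ext_of_charFun (funext fun t => ?_)
  have e : ∀ x : ℝ, Complex.exp (t * x * Complex.I) = phase (-t) x := fun x => by
    rw [phase]
    congr 1
    push_cast
    ring
  have i : ∀ s : ℝ, Integrable (phase s) μ := fun s =>
    Integrable.of_bound (measurable_phase s).aestronglyMeasurable 1
      (Eventually.of_forall fun x => (norm_phase _ _).le)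
  have im0 : ∀ s : ℝ, (∫ x, phase s x ∂μ).im = 0 := fun s => by
    have h : (∫ x, phase s x ∂μ).im = ∫ x, (phase s x).im ∂μ := (integral_im (i s)).symm
    rw [h]
    simp only [phase_im]
    rw [integral_neg, hμ, neg_zero]
  have h1 : charFun (μ.map fun x => -x) t = ∫ x, phase t x ∂μ := by
    rw [charFun_apply_real, integral_map measurable_neg.aemeasurable (by fun_prop)]
    refine integral_congr_ae (Eventually.of_forall fun x => ?_)
    simp only [phase]
    congr 1
    push_cast
    ring
  have h2 : charFun μ t = ∫ x, phase (-t) x ∂μ := by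
    rw [charFun_apply_real]
    simp only [e]
  have h3 : ∫ x, phase (-t) x ∂μ = starRingEnd ℂ (∫ x, phase t x ∂μ) := by
    rw [← integral_conj]
    simp only [conj_phase]
  rw [h1, h2, h3, Complex.conj_eq_iff_im.2 (im0 t)]

theorem integral_odd_eq_zero {μ : Measure ℝ} [IsFiniteMeasure μ]
    (hμ : ∀ t : ℝ, ∫ x, Real.sin (t * x) ∂μ = 0) {F : ℝ → ℝ} (hF : Measurable F)
    (hodd : ∀ x, F (-x) = -F x) : ∫ x, F x ∂μ = 0 := by
  have h : ∫ x, F x ∂(μ.map fun x => -x) = -∫ x, F x ∂μ := by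
    rw [integral_map measurable_neg.aemeasurable hF.aestronglyMeasurable, ← integral_neg]
    simp only [hodd]
  rw [map_neg_eq_of_integral_sin_eq_zero hμ] at h
  linarith

/-! ### The diagonal form and three independent delays. -/

section ThreeDelays

variable {D : Measure ℝ} [IsProbabilityMeasure D]

theorem integral_phase_three (D : Measure ℝ) [IsProbabilityMeasure D] (t a b c : ℝ) :
    ∫ p : ℝ × ℝ × ℝ, phase t (a * p.1 + b * p.2.1 + c * p.2.2) ∂(D.prod (D.prod D)) =
      (∫ x, phase (a * t) x ∂D) * ((∫ x, phase (b * t) x ∂D) * ∫ x, phase (c * t) x ∂D) := by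
  rw [← integral_prod_mul, ← integral_prod_mul]
  refine integral_congr_ae (Eventually.of_forall fun p => ?_)
  simp only [phase, ← Complex.exp_add]
  congr 1
  push_cast
  ring

theorem integral_sin_three (D : Measure ℝ) [IsProbabilityMeasure D] (t a b c : ℝ) :
    ∫ p : ℝ × ℝ × ℝ, Real.sin (t * (a * p.1 + b * p.2.1 + c * p.2.2)) ∂(D.prod (D.prod D)) =
      -((∫ x, phase (a * t) x ∂D) * ((∫ x, phase (b * t) x ∂D) *
        ∫ x, phase (c * t) x ∂D)).im := by
  have hi : Integrable (fun p : ℝ × ℝ × ℝ => phase t (a * p.1 + b * p.2.1 + c * p.2.2))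
      (D.prod (D.prod D)) := Integrable.of_bound
    ((measurable_phase t).comp (by fun_prop)).aestronglyMeasurable 1
    (Eventually.of_forall fun x => (norm_phase _ _).le)
  have h : (∫ p : ℝ × ℝ × ℝ, phase t (a * p.1 + b * p.2.1 + c * p.2.2) ∂(D.prod (D.prod D))).im =
      ∫ p : ℝ × ℝ × ℝ, (phase t (a * p.1 + b * p.2.1 + c * p.2.2)).im ∂(D.prod (D.prod D)) :=
    (integral_im hi).symm
  rw [← integral_phase_three, h]
  simp only [phase_im]
  rw [integral_neg, neg_neg]

/-- The combination of Fourier transforms of the delay law which appears in the bispectrum on the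
diagonal. -/
noncomputable def diagonalForm (m : ℝ≥0) (D : Measure ℝ) (t : ℝ) : ℂ :=
  starRingEnd ℂ (∫ d, phase t d ∂D) ^ 2 +
    2 * starRingEnd ℂ (∫ d, phase t d ∂D) * (∫ d, phase (2 * t) d ∂D) -
    2 * (m : ℝ) * starRingEnd ℂ (∫ d, phase t d ∂D) ^ 2 * (∫ d, phase (2 * t) d ∂D)

/-- The hypothesis says that one measure, assembled from the laws of the three combinations of
delays, has vanishing sine transform. It is then symmetric and annihilates odd functions, bounded or
not. -/
theorem integral_three_odd_eq_zero {m : ℝ≥0} (hD : ∀ t : ℝ, 0 < t → (diagonalForm m D t).im = 0)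
    {F : ℝ → ℝ} (hF : Measurable F) (hodd : ∀ x, F (-x) = -F x)
    (i1 : Integrable (fun p : ℝ × ℝ × ℝ => F (p.1 + p.2.1)) (D.prod (D.prod D)))
    (i2 : Integrable (fun p : ℝ × ℝ × ℝ => F (p.1 - 2 * p.2.1)) (D.prod (D.prod D)))
    (i3 : Integrable (fun p : ℝ × ℝ × ℝ => F (p.1 + p.2.1 - 2 * p.2.2)) (D.prod (D.prod D))) :
    ∫ p : ℝ × ℝ × ℝ, F (p.1 + p.2.1) ∂(D.prod (D.prod D)) +
      2 * ∫ p : ℝ × ℝ × ℝ, F (p.1 - 2 * p.2.1) ∂(D.prod (D.prod D)) -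
      2 * m * ∫ p : ℝ × ℝ × ℝ, F (p.1 + p.2.1 - 2 * p.2.2) ∂(D.prod (D.prod D)) = 0 := by
  have g1 : Measurable fun p : ℝ × ℝ × ℝ => p.1 + p.2.1 := by fun_prop
  have g2 : Measurable fun p : ℝ × ℝ × ℝ => p.1 - 2 * p.2.1 := by fun_prop
  have g3 : Measurable fun p : ℝ × ℝ × ℝ => -(p.1 + p.2.1 - 2 * p.2.2) := by fun_prop
  set K := D.prod (D.prod D)
  -- The third combination is reflected: on odd functions this turns the coefficient `-2m` into the
  -- positive mass `2m`, so that `μ` is a genuine finite measure.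
  set μ : Measure ℝ := K.map (fun p => p.1 + p.2.1) +
    ((2 : ℝ≥0) • K.map (fun p => p.1 - 2 * p.2.1) +
      (2 * m) • K.map (fun p => -(p.1 + p.2.1 - 2 * p.2.2))) with hμ
  have key : ∀ {G : ℝ → ℝ}, Measurable G → (∀ x, G (-x) = -G x) →
      Integrable (fun p : ℝ × ℝ × ℝ => G (p.1 + p.2.1)) K →
      Integrable (fun p : ℝ × ℝ × ℝ => G (p.1 - 2 * p.2.1)) K →
      Integrable (fun p : ℝ × ℝ × ℝ => G (p.1 + p.2.1 - 2 * p.2.2)) K →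
      ∫ x, G x ∂μ = ∫ p : ℝ × ℝ × ℝ, G (p.1 + p.2.1) ∂K +
        2 * ∫ p : ℝ × ℝ × ℝ, G (p.1 - 2 * p.2.1) ∂K -
        2 * m * ∫ p : ℝ × ℝ × ℝ, G (p.1 + p.2.1 - 2 * p.2.2) ∂K := fun {G} hG ho j1 j2 j3 => by
    have k1 : Integrable G (K.map (fun p => p.1 + p.2.1)) :=
      (integrable_map_measure hG.aestronglyMeasurable g1.aemeasurable).2 j1
    have k2 : Integrable G (K.map (fun p => p.1 - 2 * p.2.1)) :=
      (integrable_map_measure hG.aestronglyMeasurable g2.aemeasurable).2 j2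
    have k3 : Integrable G (K.map (fun p => -(p.1 + p.2.1 - 2 * p.2.2))) := by
      refine (integrable_map_measure hG.aestronglyMeasurable g3.aemeasurable).2 ?_
      refine j3.neg.congr (Eventually.of_forall fun p => ?_)
      simp only [Function.comp_apply, ho, Pi.neg_apply]
    rw [hμ, integral_add_measure k1 ((k2.smul_measure_nnreal).add_measure k3.smul_measure_nnreal),
      integral_add_measure k2.smul_measure_nnreal k3.smul_measure_nnreal,
      integral_smul_nnreal_measure, integral_smul_nnreal_measure,
      integral_map g1.aemeasurable hG.aestronglyMeasurable,
      integral_map g2.aemeasurable hG.aestronglyMeasurable,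
      integral_map g3.aemeasurable hG.aestronglyMeasurable]
    simp only [ho, integral_neg, NNReal.smul_def, smul_eq_mul]
    push_cast
    ring
  have fin : IsFiniteMeasure μ := by
    rw [hμ]
    infer_instance
  rw [← key hF hodd i1 i2 i3]
  refine integral_odd_eq_zero ?_ hF hodd
  have pos : ∀ t : ℝ, 0 < t → ∫ x, Real.sin (t * x) ∂μ = 0 := fun t ht => by
    have b : ∀ {g : ℝ × ℝ × ℝ → ℝ}, Measurable g → Integrable (fun p => Real.sin (t * g p)) K :=
      fun hg => Integrable.of_bound (Measurable.aestronglyMeasurable (by fun_prop)) 1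
        (Eventually.of_forall fun p => Real.abs_sin_le_one _)
    rw [key (G := fun x => Real.sin (t * x)) (by fun_prop)
      (fun x => by rw [mul_neg, Real.sin_neg]) (b (by fun_prop)) (b (by fun_prop))
      (b (by fun_prop))]
    have s1 := integral_sin_three D t 1 1 0
    have s2 := integral_sin_three D t 1 (-2) 0
    have s3 := integral_sin_three D t 1 1 (-2)
    have h0 : ∫ x, phase 0 x ∂D = 1 := by simp [phase]
    have h2 : ∫ x, phase (-(2 * t)) x ∂D = starRingEnd ℂ (∫ x, phase (2 * t) x ∂D) := by
      rw [← integral_conj]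
      simp only [conj_phase]
    simp only [one_mul, zero_mul, add_zero, h0, mul_one, h2, neg_mul, ← sub_eq_add_neg] at s1 s2 s3
    rw [s1, s2, s3]
    have := hD t ht
    rw [diagonalForm] at this
    generalize ∫ x, phase t x ∂D = z at *
    generalize ∫ x, phase (2 * t) x ∂D = w at *
    simp only [Complex.sub_im, Complex.add_im, Complex.mul_im, Complex.mul_re, pow_two,
      Complex.conj_re, Complex.conj_im, Complex.ofReal_re, Complex.ofReal_im, Complex.re_ofNat,
      Complex.im_ofNat] at this ⊢
    linear_combination this
  intro t
  rcases lt_trichotomy t 0 with ht | rfl | ht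
  · have := pos (-t) (by linarith)
    simp only [neg_mul, Real.sin_neg, integral_neg, neg_eq_zero] at this
    exact this
  · simp
  · exact pos t ht

end ThreeDelays

/-! ### The tail of the delay law when the diagonal form is real -/

/-- `f` is integrable with integral `a`. -/
def HasMean {α : Type*} [MeasurableSpace α] (μ : Measure α) (f : α → ℝ) (a : ℝ) : Prop :=
  Integrable f μ ∧ ∫ x, f x ∂μ = a

section HasMean

variable {α : Type*} [MeasurableSpace α] {μ : Measure α} {f g : α → ℝ} {a b : ℝ}

theorem HasMean.add (hf : HasMean μ f a) (hg : HasMean μ g b) :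
    HasMean μ (fun x => f x + g x) (a + b) :=
  ⟨hf.1.add hg.1, by rw [integral_add hf.1 hg.1, hf.2, hg.2]⟩

theorem HasMean.const_mul (hf : HasMean μ f a) (c : ℝ) :
    HasMean μ (fun x => c * f x) (c * a) :=
  ⟨hf.1.const_mul c, by rw [integral_const_mul, hf.2]⟩

theorem HasMean.congr (hf : HasMean μ f a) (hfg : ∀ x, g x = f x) (hab : b = a) :
    HasMean μ g b := by
  rw [show g = f from funext hfg, hab]
  exact hf

theorem hasMean_one [IsProbabilityMeasure μ] : HasMean μ (fun _ => 1) 1 :=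
  ⟨integrable_const _, by simp⟩

theorem HasMean.three {D : Measure ℝ} [IsProbabilityMeasure D] {f g k : ℝ → ℝ} {a b c : ℝ}
    (hf : HasMean D f a) (hg : HasMean D g b) (hk : HasMean D k c) :
    HasMean (D.prod (D.prod D)) (fun p => f p.1 * (g p.2.1 * k p.2.2)) (a * (b * c)) :=
  ⟨hf.1.mul_prod (hg.1.mul_prod hk.1), by
    rw [integral_prod_mul f fun q : ℝ × ℝ => g q.1 * k q.2, integral_prod_mul, hf.2, hg.2, hk.2]⟩

end HasMean

/-- Truncation to `[-1, 1]`. -/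
noncomputable def clamp (x : ℝ) : ℝ := max (-1) (min x 1)

theorem measurable_clamp : Measurable clamp := by
  unfold clamp
  fun_prop

theorem clamp_neg (x : ℝ) : clamp (-x) = -clamp x := by
  unfold clamp
  rcases le_total x 1 with h1 | h1 <;> rcases le_total (-1) x with h2 | h2
  · rw [min_eq_left (by linarith), max_eq_right (by linarith), min_eq_left h1, max_eq_right h2]
  · rw [min_eq_right (by linarith), max_eq_right (by linarith), min_eq_left h1, max_eq_left h2,
      neg_neg]
  · rw [min_eq_left (by linarith), max_eq_left (by linarith), min_eq_right h1,
      max_eq_right (by linarith)]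
  · linarith

theorem abs_clamp_le_one (x : ℝ) : |clamp x| ≤ 1 :=
  abs_le.2 ⟨le_max_left _ _, max_le (by norm_num) (min_le_right _ _)⟩

theorem clamp_of_nonneg {x : ℝ} (hx : 0 ≤ x) : clamp x = min x 1 :=
  max_eq_right (le_trans (by norm_num) (le_min hx zero_le_one))

theorem clamp_of_abs_le {x : ℝ} (hx : |x| ≤ 1) : clamp x = x := by
  rw [clamp, min_eq_left (abs_le.1 hx).2, max_eq_right (abs_le.1 hx).1]

theorem abs_clamp_sub_le (x y : ℝ) : |clamp x - clamp y| ≤ |x - y| := by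
  unfold clamp
  calc _ ≤ |min x 1 - min y 1| := by
        rw [max_comm (-1), max_comm (-1)]
        exact abs_max_sub_max_le_abs _ _ _
    _ ≤ _ := by
        have := abs_min_sub_min_le_max x 1 y 1
        simpa using this

/-- The indicator of `[1/4, ∞)`. -/
noncomputable def farInd (u : ℝ) : ℝ := (Ici (1 / 4 : ℝ)).indicator (fun _ => 1) u

theorem farInd_nonneg (u : ℝ) : 0 ≤ farInd u := indicator_nonneg (fun _ _ => zero_le_one) u

/-- `clamp` is 1-Lipschitz and bounded by one, so removing `v` and `w` costs only a multiple of
their clamped values. -/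
theorem abs_clamp_combination_le_of_far {u v w : ℝ} (hu : 0 ≤ u) (hv : 0 ≤ v) (hw : 0 ≤ w) :
    |clamp (u + v - 2 * w) - clamp u - clamp v + clamp (2 * w)| ≤ 4 * (clamp v + clamp w) := by
  have l1 := abs_clamp_sub_le (u + v - 2 * w) u
  have l2 : |u + v - 2 * w - u| ≤ v + 2 * w := abs_le.2 ⟨by linarith, by linarith⟩
  have l3 := abs_le.1 (abs_clamp_le_one (u + v - 2 * w))
  have l4 := abs_le.1 (l1.trans l2)
  rw [clamp_of_nonneg hu, clamp_of_nonneg hv, clamp_of_nonneg hw,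
    clamp_of_nonneg (by linarith : 0 ≤ 2 * w)] at *
  have p1 : 0 ≤ min u 1 := le_min hu zero_le_one
  have p2 : 0 ≤ min (2 * w) 1 := le_min (by linarith) zero_le_one
  have p3 := min_le_right u 1
  have p4 := min_le_right (2 * w) 1
  have p5 := min_le_left (2 * w) 1
  rcases le_total v 1 with h1 | h1
  · rw [min_eq_left h1]
    rcases le_total w 1 with h2 | h2
    · rw [min_eq_left h2]
      exact abs_le.2 ⟨by linarith, by linarith⟩
    · rw [min_eq_right h2]
      exact abs_le.2 ⟨by linarith, by linarith⟩
  · rw [min_eq_right h1]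
    have p6 : 0 ≤ min w 1 := le_min hw zero_le_one
    exact abs_le.2 ⟨by linarith, by linarith⟩

/-- If all three variables lie below `1/4`, every argument stays in `[-1, 1]`, where `clamp` is the
identity, and the combination is zero. Otherwise one variable is far and the error is controlled by
the other two. Each error term is thus a product over two different variables, which makes it small
in the mean. -/
theorem abs_clamp_combination_le {u v w : ℝ} (hu : 0 ≤ u) (hv : 0 ≤ v) (hw : 0 ≤ w) :
    |clamp (u + v - 2 * w) - clamp u - clamp v + clamp (2 * w)| ≤
      4 * (farInd u * (clamp v + clamp w) + farInd v * (clamp u + clamp w) +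
        farInd w * (clamp u + clamp v)) := by
  have cu : 0 ≤ clamp u := by rw [clamp_of_nonneg hu]; exact le_min hu zero_le_one
  have cv : 0 ≤ clamp v := by rw [clamp_of_nonneg hv]; exact le_min hv zero_le_one
  have cw : 0 ≤ clamp w := by rw [clamp_of_nonneg hw]; exact le_min hw zero_le_one
  have q1 : 0 ≤ farInd u * (clamp v + clamp w) := mul_nonneg (farInd_nonneg u) (by linarith)
  have q2 : 0 ≤ farInd v * (clamp u + clamp w) := mul_nonneg (farInd_nonneg v) (by linarith)
  have q3 : 0 ≤ farInd w * (clamp u + clamp v) := mul_nonneg (farInd_nonneg w) (by linarith)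
  have far : ∀ {x : ℝ}, 1 / 4 ≤ x → farInd x = 1 := fun hx => indicator_of_mem (mem_Ici.2 hx) _
  rcases le_or_gt (1 / 4) u with h1 | h1
  · have := abs_clamp_combination_le_of_far hu hv hw
    rw [far h1] at *
    linarith
  rcases le_or_gt (1 / 4) v with h2 | h2
  · have := abs_clamp_combination_le_of_far hv hu hw
    rw [far h2] at *
    rw [show u + v - 2 * w = v + u - 2 * w by ring,
      show clamp (v + u - 2 * w) - clamp u - clamp v = clamp (v + u - 2 * w) - clamp v - clamp u by
        ring]
    linarith
  rcases le_or_gt (1 / 4) w with h3 | h3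
  · have l1 := abs_clamp_sub_le (u + v - 2 * w) (-(2 * w))
    rw [clamp_neg, show u + v - 2 * w - -(2 * w) = u + v by ring, abs_of_nonneg (add_nonneg hu hv)]
      at l1
    have l2 := abs_le.1 (abs_clamp_le_one (u + v - 2 * w))
    have l3 := abs_le.1 (abs_clamp_le_one (2 * w))
    have l4 := abs_le.1 l1
    have l5 := abs_le.1 (abs_clamp_le_one u)
    have l6 := abs_le.1 (abs_clamp_le_one v)
    rw [far h3] at *
    suffices |clamp (u + v - 2 * w) - clamp u - clamp v + clamp (2 * w)| ≤
      4 * (clamp u + clamp v) by linarith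
    rcases le_total u 1 with h4 | h4
    · have e1 : clamp u = u := by rw [clamp_of_nonneg hu, min_eq_left h4]
      rcases le_total v 1 with h5 | h5
      · have e2 : clamp v = v := by rw [clamp_of_nonneg hv, min_eq_left h5]
        exact abs_le.2 ⟨by linarith, by linarith⟩
      · have e2 : clamp v = 1 := by rw [clamp_of_nonneg hv, min_eq_right h5]
        exact abs_le.2 ⟨by linarith, by linarith⟩
    · have e1 : clamp u = 1 := by rw [clamp_of_nonneg hu, min_eq_right h4]
      exact abs_le.2 ⟨by linarith, by linarith⟩
  · rw [clamp_of_abs_le (abs_le.2 ⟨by linarith, by linarith⟩),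
      clamp_of_abs_le (x := u) (abs_le.2 ⟨by linarith, by linarith⟩),
      clamp_of_abs_le (x := v) (abs_le.2 ⟨by linarith, by linarith⟩),
      clamp_of_abs_le (x := 2 * w) (abs_le.2 ⟨by linarith, by linarith⟩),
      clamp_of_abs_le (x := w) (abs_le.2 ⟨by linarith, by linarith⟩),
      show u + v - 2 * w - u - v + 2 * w = 0 by ring, abs_zero]
    rw [clamp_of_abs_le (x := u) (abs_le.2 ⟨by linarith, by linarith⟩),
      clamp_of_abs_le (x := v) (abs_le.2 ⟨by linarith, by linarith⟩),
      clamp_of_abs_le (x := w) (abs_le.2 ⟨by linarith, by linarith⟩)] at *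
    linarith

/-- The preceding estimate is applied to `(u, v, 0)`, `(u, 0, v)` and `(u, v, w)` with weights `1`,
`2` and `2m ≤ 2`. The pair `u`, `v` collects the error `4 + 8 + 8 = 20`, and pairs involving `w`
collect `8`. -/
theorem clamp_combination_ge {m u v w : ℝ} (hm : 0 ≤ m) (hm1 : m ≤ 1)
    (hu : 0 ≤ u) (hv : 0 ≤ v) (hw : 0 ≤ w) :
    (3 - 2 * m) * clamp u + (1 - 2 * m) * clamp v - 2 * clamp (2 * v) + 2 * m * clamp (2 * w) -
      (20 * (farInd u * clamp v) + 20 * (farInd v * clamp u) + 8 * (farInd u * clamp w) +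
        8 * (farInd w * clamp u) + 8 * (farInd v * clamp w) + 8 * (farInd w * clamp v)) ≤
      clamp (u + v) + 2 * clamp (u - 2 * v) - 2 * m * clamp (u + v - 2 * w) := by
  have c0 : clamp 0 = 0 := clamp_of_abs_le (by simp)
  have f0 : farInd 0 = 0 := indicator_of_notMem (by norm_num) _
  have b1 := abs_le.1 (abs_clamp_combination_le hu hv le_rfl)
  have b2 := abs_le.1 (abs_clamp_combination_le hu le_rfl hv)
  have b3 := (abs_le.1 (abs_clamp_combination_le hu hv hw)).2
  simp only [mul_zero, sub_zero, add_zero, c0, f0, zero_mul] at b1 b2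
  have cu : 0 ≤ clamp u := by rw [clamp_of_nonneg hu]; exact le_min hu zero_le_one
  have cv : 0 ≤ clamp v := by rw [clamp_of_nonneg hv]; exact le_min hv zero_le_one
  have cw : 0 ≤ clamp w := by rw [clamp_of_nonneg hw]; exact le_min hw zero_le_one
  have q1 : 0 ≤ farInd u * (clamp v + clamp w) := mul_nonneg (farInd_nonneg u) (by linarith)
  have q2 : 0 ≤ farInd v * (clamp u + clamp w) := mul_nonneg (farInd_nonneg v) (by linarith)
  have q3 : 0 ≤ farInd w * (clamp u + clamp v) := mul_nonneg (farInd_nonneg w) (by linarith)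
  have b4 := mul_le_mul_of_nonneg_left b3 hm
  have b5 := mul_le_mul_of_nonneg_right hm1 (add_nonneg (add_nonneg q1 q2) q3)
  linarith [b1.1, b2.1]

section Tail

variable {m : ℝ≥0} {D : Measure ℝ} [IsProbabilityMeasure D] (hm : m < 1)
  (hD0 : ∀ᵐ x ∂D, 0 ≤ x)
include hm hD0

/-- The odd function is `clamp (x / r)`. In the mean of the lower bound the linear terms add up to
`2(1 - m)(2A - B)`, and the six error terms factor by independence into `72 T A`. -/
theorem tail_le (hD : ∀ t : ℝ, 0 < t → (diagonalForm m D t).im = 0) {r : ℝ} (hr : 0 < r) :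
    (1 - (m : ℝ)) * D.real (Ici r) ≤ 36 * (D.real (Ici (r / 4)) * ∫ x, clamp (x / r) ∂D) := by
  have bdd : ∀ {α : Type} [MeasurableSpace α] {μ : Measure α} [IsFiniteMeasure μ] {g : α → ℝ},
      Measurable g → Integrable (fun p => clamp (g p)) μ := fun hg =>
    Integrable.of_bound (measurable_clamp.comp hg).aestronglyMeasurable 1
      (Eventually.of_forall fun p => abs_clamp_le_one _)
  have h0 := integral_three_odd_eq_zero hD (F := fun x => clamp (x / r))
    (measurable_clamp.comp (by fun_prop)) (fun x => by rw [neg_div, clamp_neg])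
    (bdd (by fun_prop)) (bdd (by fun_prop)) (bdd (by fun_prop))
  set A := ∫ x, clamp (x / r) ∂D with hA
  set B := ∫ x, clamp (2 * (x / r)) ∂D with hB
  set T := D.real (Ici (r / 4)) with hT
  have mA : HasMean D (fun x => clamp (x / r)) A := ⟨bdd (by fun_prop), rfl⟩
  have mB : HasMean D (fun x => clamp (2 * (x / r))) B := ⟨bdd (by fun_prop), rfl⟩
  have mT : HasMean D (fun x => farInd (x / r)) T := by
    have e : (fun x => farInd (x / r)) = (Ici (r / 4)).indicator fun _ => (1 : ℝ) := by
      funext x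
      simp only [farInd, indicator, mem_Ici]
      congr 1
      rw [le_div_iff₀ hr]
      exact propext ⟨fun h => by linarith, fun h => by linarith⟩
    rw [e]
    exact ⟨(integrable_const _).indicator measurableSet_Ici, by
      rw [integral_indicator_const _ measurableSet_Ici, smul_eq_mul, mul_one]⟩
  have m1 : HasMean D (fun _ => (1 : ℝ)) 1 := hasMean_one
  have pos3 : ∀ᵐ p ∂(D.prod (D.prod D)), 0 ≤ p.1 ∧ 0 ≤ p.2.1 ∧ 0 ≤ p.2.2 := by
    filter_upwards [Measure.quasiMeasurePreserving_fst.ae hD0,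
      Measure.quasiMeasurePreserving_snd.ae (Measure.quasiMeasurePreserving_fst.ae hD0),
      Measure.quasiMeasurePreserving_snd.ae (Measure.quasiMeasurePreserving_snd.ae hD0)]
      with p h1 h2 h3 using ⟨h1, h2, h3⟩
  have low : HasMean (D.prod (D.prod D)) (fun p : ℝ × ℝ × ℝ =>
      (3 - 2 * (m : ℝ)) * clamp (p.1 / r) + (1 - 2 * (m : ℝ)) * clamp (p.2.1 / r) -
      2 * clamp (2 * (p.2.1 / r)) + 2 * m * clamp (2 * (p.2.2 / r)) -
      (20 * (farInd (p.1 / r) * clamp (p.2.1 / r)) + 20 * (farInd (p.2.1 / r) * clamp (p.1 / r)) +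
        8 * (farInd (p.1 / r) * clamp (p.2.2 / r)) + 8 * (farInd (p.2.2 / r) * clamp (p.1 / r)) +
        8 * (farInd (p.2.1 / r) * clamp (p.2.2 / r)) +
        8 * (farInd (p.2.2 / r) * clamp (p.2.1 / r))))
      (2 * (1 - m) * (2 * A - B) - 72 * (T * A)) :=
    (((((((((((mA.three m1 m1).const_mul (3 - 2 * (m : ℝ))).add
      ((m1.three mA m1).const_mul (1 - 2 * (m : ℝ)))).add
      ((m1.three mB m1).const_mul (-2))).add ((m1.three m1 mB).const_mul (2 * m))).add
      ((mT.three mA m1).const_mul (-20))).add ((mA.three mT m1).const_mul (-20))).add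
      ((mT.three m1 mA).const_mul (-8))).add ((mA.three m1 mT).const_mul (-8))).add
      ((m1.three mT mA).const_mul (-8))).add ((m1.three mA mT).const_mul (-8))).congr
      (fun p => by ring) (by ring)
  have j1 : Integrable (fun p : ℝ × ℝ × ℝ => clamp ((p.1 + p.2.1) / r)) (D.prod (D.prod D)) :=
    bdd (by fun_prop)
  have j2 : Integrable (fun p : ℝ × ℝ × ℝ => clamp ((p.1 - 2 * p.2.1) / r)) (D.prod (D.prod D)) :=
    bdd (by fun_prop)
  have j3 : Integrable (fun p : ℝ × ℝ × ℝ => clamp ((p.1 + p.2.1 - 2 * p.2.2) / r))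
    (D.prod (D.prod D)) := bdd (by fun_prop)
  have up : HasMean (D.prod (D.prod D)) (fun p : ℝ × ℝ × ℝ => clamp ((p.1 + p.2.1) / r) +
      2 * clamp ((p.1 - 2 * p.2.1) / r) + (-(2 * m)) * clamp ((p.1 + p.2.1 - 2 * p.2.2) / r)) 0 :=
    ((HasMean.add ⟨j1, rfl⟩ (HasMean.const_mul ⟨j2, rfl⟩ 2)).add
      (HasMean.const_mul ⟨j3, rfl⟩ (-(2 * m)))).congr (fun p => rfl) (by rw [← h0]; ring)
  have main : 2 * (1 - m) * (2 * A - B) - 72 * (T * A) ≤ 0 := by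
    rw [← low.2, ← up.2]
    refine integral_mono_ae low.1 up.1 ?_
    filter_upwards [pos3] with p ⟨h1, h2, h3⟩
    have := clamp_combination_ge m.2 (NNReal.coe_le_coe.2 hm.le) (div_nonneg h1 hr.le)
      (div_nonneg h2 hr.le) (div_nonneg h3 hr.le)
    rw [add_div, sub_div, mul_div_assoc, sub_div, add_div, mul_div_assoc]
    refine this.trans (le_of_eq ?_)
    rw [neg_mul, ← sub_eq_add_neg]
    rfl
  -- `2 min(x, 1) - min(2x, 1)` is nonnegative for `x ≥ 0`, by concavity, and equals `1` for `x ≥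
  -- 1`.
  have lead : D.real (Ici r) ≤ 2 * A - B := by
    rw [hA, hB, ← integral_const_mul, ← integral_sub (mA.1.const_mul 2) mB.1,
      ← mul_one (D.real (Ici r)), ← smul_eq_mul, ← integral_indicator_const _ measurableSet_Ici]
    refine integral_mono_ae ((integrable_const _).indicator measurableSet_Ici)
      ((mA.1.const_mul 2).sub mB.1) ?_
    filter_upwards [hD0] with x hx
    have hx' := div_nonneg hx hr.le
    simp only [indicator, mem_Ici]
    rw [clamp_of_nonneg hx', clamp_of_nonneg (by linarith)]
    split_ifs with h
    · have h1 : 1 ≤ x / r := (one_le_div hr).2 h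
      rw [min_eq_right h1, min_eq_right (by linarith)]
      norm_num
    · rcases le_total (x / r) 1 with h1 | h1
      · rw [min_eq_left h1]
        linarith [min_le_left (2 * (x / r)) 1]
      · rw [min_eq_right h1]
        linarith [min_le_right (2 * (x / r)) 1]
  have hm' : (0 : ℝ) < 1 - m := sub_pos.2 (by exact_mod_cast hm)
  nlinarith

/-- The truncated mean in the tail bound tends to zero by dominated convergence, without any moment
assumption. -/
theorem eventually_tail_le (hD : ∀ t : ℝ, 0 < t → (diagonalForm m D t).im = 0) {ε : ℝ}
    (hε : 0 < ε) : ∀ᶠ r in atTop, D.real (Ici r) ≤ ε * D.real (Ici (r / 4)) := by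
  have hm' : (0 : ℝ) < 1 - m := sub_pos.2 (by exact_mod_cast hm)
  have lim : Tendsto (fun r : ℝ => ∫ x, clamp (x / r) ∂D) atTop (𝓝 (∫ _, (0 : ℝ) ∂D)) := by
    refine tendsto_integral_filter_of_dominated_convergence (fun _ => 1)
      (Eventually.of_forall fun r => (measurable_clamp.comp (by fun_prop)).aestronglyMeasurable)
      (Eventually.of_forall fun r => Eventually.of_forall fun x => abs_clamp_le_one _)
      (integrable_const _) (Eventually.of_forall fun x => ?_)
    have h : Tendsto (fun r : ℝ => x / r) atTop (𝓝 0) := tendsto_id.const_div_atTop x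
    have c : Continuous clamp := by
      unfold clamp
      fun_prop
    have := (c.tendsto 0).comp h
    rwa [clamp_of_abs_le (by simp)] at this
  rw [integral_zero] at lim
  filter_upwards [lim.eventually_lt_const (show 0 < ε * (1 - m) / 36 by positivity),
    eventually_gt_atTop 0] with r h1 h2
  have := tail_le hm hD0 hD h2
  have h3 : D.real (Ici (r / 4)) * ∫ x, clamp (x / r) ∂D ≤
      D.real (Ici (r / 4)) * (ε * (1 - m) / 36) :=
    mul_le_mul_of_nonneg_left h1.le measureReal_nonneg
  have h4 : (1 - (m : ℝ)) * D.real (Ici r) ≤ (1 - (m : ℝ)) * (ε * D.real (Ici (r / 4))) := by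
    linarith
  exact le_of_mul_le_mul_left h4 hm'

end Tail

/-! ### Regularly varying tails -/

/-- For a regularly varying tail, `T(4x) / T(x)` tends to the positive number `4^(-α)`. -/
theorem exists_not_eventually_le_of_isEquivalent {T L : ℝ → ℝ} {α : ℝ}
    (hL : IsSlowlyVarying L) (hT : Asymptotics.IsEquivalent atTop T fun x => x ^ (-α) * L x) :
    ∃ ε : ℝ, 0 < ε ∧ ¬ ∀ᶠ r in atTop, T r ≤ ε * T (r / 4) := by
  have hv : ∀ᶠ x in atTop, 0 < x ^ (-α) * L x := by
    filter_upwards [hL.eventually_pos, eventually_gt_atTop 0] with x h1 h2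
    exact mul_pos (Real.rpow_pos_of_pos h2 _) h1
  have hr := (Asymptotics.isEquivalent_iff_tendsto_one (hv.mono fun x hx => hx.ne')).1 hT
  have h4 : Tendsto (fun x : ℝ => 4 * x) atTop atTop := tendsto_id.const_mul_atTop (by norm_num)
  have up := hr.eventually_lt_const (show (1 : ℝ) < 2 by norm_num)
  have low := h4.eventually (hr.eventually_const_lt (show (1 / 2 : ℝ) < 1 by norm_num))
  have hs := (hL.tendsto_ratio 4 (by norm_num)).eventually_const_lt
    (show (1 / 2 : ℝ) < 1 by norm_num)
  have c0 : (0 : ℝ) < 4 ^ (-α) := Real.rpow_pos_of_pos (by norm_num) _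
  -- The factors `1/2`, `1/2` and `2` lost in the three asymptotic relations leave the ratio above
  -- `4^(-α)/8`.
  refine ⟨4 ^ (-α) / 16, by positivity, fun hev => ?_⟩
  obtain ⟨x, h1, h2, h3, h4, h5, h6, h7, h8⟩ := (hv.and <| (h4.eventually hv).and <| up.and <|
    low.and <| hs.and <| (h4.eventually hev).and <| hL.eventually_pos.and
    (eventually_gt_atTop 0)).exists
  simp only [Pi.div_apply] at h3 h4
  rw [div_lt_iff₀ h1] at h3
  rw [lt_div_iff₀ h2, Real.mul_rpow (by norm_num) h8.le] at h4
  rw [lt_div_iff₀ h7] at h5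
  rw [mul_div_cancel_left₀ x (by norm_num : (4 : ℝ) ≠ 0)] at h6
  have p : 0 < x ^ (-α) := Real.rpow_pos_of_pos h8 _
  have e1 := mul_lt_mul_of_pos_left h5 (mul_pos c0 p)
  have e2 := mul_lt_mul_of_pos_left h3 c0
  have e3 := mul_pos c0 h1
  nlinarith

theorem delayLaw_real_Ici {h : ℝ → ℝ} (hh : IsDelayDensity h) (r : ℝ) :
    (delayLaw h).real (Ici r) = ∫ u in Ioi r, h u := by
  rw [measureReal_def, delayLaw, withDensity_apply _ measurableSet_Ici,
    ← restrict_Ioi_eq_restrict_Ici,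
    integral_eq_lintegral_of_nonneg_ae (Eventually.of_forall hh.nonneg)
      hh.measurable.aestronglyMeasurable]

theorem ae_delayLaw_pos {h : ℝ → ℝ} (hh : IsDelayDensity h) : ∀ᵐ x ∂(delayLaw h), 0 < x := by
  rw [delayLaw, ae_withDensity_iff hh.measurable.ennreal_ofReal]
  refine Eventually.of_forall fun x hx => ?_
  by_contra h0
  exact hx (by rw [hh.eq_zero x (not_lt.1 h0), ENNReal.ofReal_zero])

/-! ### The third moment -/

/-- Beyond some scale, each multiplication of the threshold by `4` divides the tail by at least
`256` and multiplies the cube by `64`, so the dyadic-type sum is geometric with ratio `1/4`. -/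
theorem integrable_pow_three_of_tail_le {D : Measure ℝ} [IsProbabilityMeasure D]
    (hD0 : ∀ᵐ x ∂D, 0 ≤ x)
    (hD : ∀ᶠ r in atTop, D.real (Ici r) ≤ (1 / 256) * D.real (Ici (r / 4))) :
    Integrable (fun x => x ^ 3) D := by
  obtain ⟨r₀, hr₀⟩ := eventually_atTop.1 hD
  obtain ⟨N, hN⟩ := pow_unbounded_of_one_lt r₀ (show (1 : ℝ) < 4 by norm_num)
  have tail : ∀ k : ℕ, D.real (Ici (4 ^ (N + k) : ℝ)) ≤ (1 / 256) ^ k := fun k => by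
    induction k with
    | zero => simp
    | succ k ih =>
      have h1 : r₀ ≤ 4 ^ (N + (k + 1)) := hN.le.trans
        (pow_le_pow_right₀ (by norm_num) (Nat.le_add_right _ _))
      have h2 := hr₀ _ h1
      rw [show (4 : ℝ) ^ (N + (k + 1)) / 4 = 4 ^ (N + k) by rw [← add_assoc, pow_succ]; field_simp]
        at h2
      calc _ ≤ _ := h2
        _ ≤ 1 / 256 * (1 / 256) ^ k := by gcongr
        _ = _ := by ring
  refine ⟨(by fun_prop : Measurable fun x : ℝ => x ^ 3).aestronglyMeasurable, ?_⟩
  rw [hasFiniteIntegral_iff_ofReal (hD0.mono fun x hx => pow_nonneg hx 3)]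
  have pt : ∀ᵐ x ∂D, ENNReal.ofReal (x ^ 3) ≤ ENNReal.ofReal (64 ^ N) +
      ∑' k : ℕ, ENNReal.ofReal (64 ^ (N + k + 1)) *
        (Ici (4 ^ (N + k) : ℝ)).indicator (fun _ => (1 : ℝ≥0∞)) x := by
    filter_upwards [hD0] with x hx
    rcases le_total x (4 ^ N) with h | h
    · refine le_add_right (ENNReal.ofReal_le_ofReal ?_)
      calc x ^ 3 ≤ (4 ^ N) ^ 3 := by gcongr
        _ = 64 ^ N := by rw [← pow_mul, mul_comm, pow_mul]; norm_num
    · have h1 : 1 ≤ x / 4 ^ N := (one_le_div (by positivity)).2 h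
      obtain ⟨k, hk1, hk2⟩ := exists_nat_pow_near h1 (show (1 : ℝ) < 4 by norm_num)
      rw [le_div_iff₀ (by positivity), ← pow_add, add_comm] at hk1
      rw [div_lt_iff₀ (by positivity), ← pow_add] at hk2
      refine le_add_left (le_trans ?_ (ENNReal.le_tsum k))
      rw [indicator_of_mem (mem_Ici.2 hk1), mul_one]
      refine ENNReal.ofReal_le_ofReal ?_
      calc x ^ 3 ≤ (4 ^ (k + 1 + N)) ^ 3 := by gcongr
        _ = 64 ^ (N + k + 1) := by
          rw [← pow_mul, mul_comm, pow_mul, show k + 1 + N = N + k + 1 by ring]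
          norm_num
  calc ∫⁻ x, ENNReal.ofReal (x ^ 3) ∂D ≤ _ := lintegral_mono_ae pt
    _ = ENNReal.ofReal (64 ^ N) + ∑' k : ℕ, ENNReal.ofReal (64 ^ (N + k + 1)) *
        D (Ici (4 ^ (N + k) : ℝ)) := by
      rw [lintegral_add_left measurable_const, lintegral_const, measure_univ, mul_one,
        lintegral_tsum fun k => Measurable.aemeasurable
          ((measurable_const.indicator measurableSet_Ici).const_mul _)]
      congr 1
      refine tsum_congr fun k => ?_
      rw [lintegral_const_mul _ (measurable_const.indicator measurableSet_Ici),
        lintegral_indicator_const measurableSet_Ici, one_mul]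
    _ ≤ ENNReal.ofReal (64 ^ N) + ∑' k : ℕ, ENNReal.ofReal (64 ^ (N + 1) * (1 / 4) ^ k) := by
      gcongr with k
      rw [← ofReal_measureReal (measure_ne_top D _), ← ENNReal.ofReal_mul (by positivity)]
      refine ENNReal.ofReal_le_ofReal ?_
      calc _ ≤ 64 ^ (N + k + 1) * (1 / 256 : ℝ) ^ k := by gcongr; exact tail k
        _ = 64 ^ (N + 1) * (64 * (1 / 256)) ^ k := by rw [mul_pow]; ring
        _ = _ := by norm_num
    _ < ∞ := by
      rw [← ENNReal.ofReal_tsum_of_nonneg (fun k => by positivity)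
        ((summable_geometric_of_lt_one (by norm_num) (by norm_num)).mul_left _)]
      exact ENNReal.add_lt_top.2 ⟨ENNReal.ofReal_lt_top, ENNReal.ofReal_lt_top⟩

/-- The odd function is the cube. The result is arranged so that both brackets have a sign for
nonincreasing densities. -/
theorem third_moment_relation {m : ℝ≥0} {D : Measure ℝ} [IsProbabilityMeasure D]
    (hD : ∀ t : ℝ, 0 < t → (diagonalForm m D t).im = 0) {μ₁ μ₂ μ₃ : ℝ}
    (h1 : HasMean D (fun x => x) μ₁) (h2 : HasMean D (fun x => x ^ 2) μ₂)
    (h3 : HasMean D (fun x => x ^ 3) μ₃) :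
    (1 - m) * (2 * μ₃ - 3 * (μ₁ * μ₂)) + m * (μ₁ * (3 * μ₂ - 4 * μ₁ ^ 2)) = 0 := by
  have h0 : HasMean D (fun _ => (1 : ℝ)) 1 := hasMean_one
  have two : ∀ b : ℝ, HasMean (D.prod (D.prod D)) (fun p => (p.1 + b * p.2.1) ^ 3)
      ((1 + b ^ 3) * μ₃ + (3 * b + 3 * b ^ 2) * (μ₁ * μ₂)) := fun b =>
    ((((h3.three h0 h0).add ((h2.three h1 h0).const_mul (3 * b))).add
      ((h1.three h2 h0).const_mul (3 * b ^ 2))).add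
      ((h0.three h3 h0).const_mul (b ^ 3))).congr (fun p => by ring) (by ring)
  have three : HasMean (D.prod (D.prod D)) (fun p => (p.1 + p.2.1 - 2 * p.2.2) ^ 3)
      (-6 * μ₃ + 18 * (μ₁ * μ₂) - 12 * μ₁ ^ 3) :=
    ((((((((((h3.three h0 h0).add (h0.three h3 h0)).add
      ((h0.three h0 h3).const_mul (-8))).add ((h2.three h1 h0).const_mul 3)).add
      ((h1.three h2 h0).const_mul 3)).add ((h2.three h0 h1).const_mul (-6))).add
      ((h0.three h2 h1).const_mul (-6))).add ((h1.three h0 h2).const_mul 12)).add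
      ((h0.three h1 h2).const_mul 12)).add ((h1.three h1 h1).const_mul (-12))).congr
      (fun p => by ring) (by ring)
  have a1 : HasMean (D.prod (D.prod D)) (fun p => (p.1 + p.2.1) ^ 3) (2 * μ₃ + 6 * (μ₁ * μ₂)) :=
    (two 1).congr (fun p => by ring) (by ring)
  have a2 : HasMean (D.prod (D.prod D)) (fun p => (p.1 - 2 * p.2.1) ^ 3)
    (-7 * μ₃ + 6 * (μ₁ * μ₂)) := (two (-2)).congr (fun p => by ring) (by ring)
  have := integral_three_odd_eq_zero hD (F := fun x => x ^ 3) (by fun_prop) (fun x => by ring)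
    a1.1 a2.1 three.1
  rw [a1.2, a2.2, three.2] at this
  linear_combination (-1 / 6) * this

/-! ### Moment inequalities for monotone densities -/

/-- On `(0, a)` the uniform density is constant and `h` decreases, so the difference passes from
nonnegative to nonpositive at some `s`; beyond `a` it is nonnegative again. These are the signs of
`(x - s)(x - a)`. -/
theorem exists_crossing {h : ℝ → ℝ} (hh : IsDelayDensity h) (hanti : AntitoneOn h (Ioi 0)) {a : ℝ}
    (ha : 0 < a) : ∃ s : ℝ, 0 ≤ s ∧
      ∀ x, 0 ≤ (h x - (Ioo 0 a).indicator (fun _ => a⁻¹) x) * ((x - s) * (x - a)) := by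
  -- Inserting `0` keeps the supremum meaningful when `h` lies below the uniform density on the
  -- whole interval.
  set A : Set ℝ := insert 0 {x | 0 < x ∧ x < a ∧ a⁻¹ ≤ h x} with hA
  have bdd : BddAbove A := ⟨a, by rintro x (rfl | hx); exacts [ha.le, hx.2.1.le]⟩
  have s0 : 0 ≤ sSup A := le_csSup bdd (mem_insert _ _)
  have sa : sSup A ≤ a := csSup_le (insert_nonempty _ _)
    (by rintro x (rfl | hx); exacts [ha.le, hx.2.1.le])
  refine ⟨sSup A, s0, fun x => ?_⟩
  rcases le_or_gt x 0 with hx | hx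
  · rw [hh.eq_zero x hx, indicator_of_notMem (fun hm => absurd hm.1 (not_lt.2 hx)), sub_zero,
      zero_mul]
  rcases le_or_gt a x with hxa | hxa
  · rw [indicator_of_notMem (fun hm => absurd hm.2 (not_lt.2 hxa)), sub_zero]
    exact mul_nonneg (hh.nonneg x) (mul_nonneg (by linarith) (by linarith))
  rw [indicator_of_mem (mem_Ioo.2 ⟨hx, hxa⟩)]
  rcases lt_trichotomy x (sSup A) with hs | hs | hs
  · obtain ⟨y, hy, hxy⟩ := exists_lt_of_lt_csSup (insert_nonempty _ _) hs
    rcases hy with rfl | hy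
    · linarith
    · have := hanti (mem_Ioi.2 hx) (mem_Ioi.2 hy.1) hxy.le
      exact mul_nonneg (by linarith [hy.2.2]) (mul_nonneg_of_nonpos_of_nonpos
        (by linarith) (by linarith))
  · rw [← hs, sub_self, zero_mul, mul_zero]
  · have : h x < a⁻¹ := by
      by_contra hc
      exact absurd (le_csSup bdd (mem_insert_of_mem _ ⟨hx, hxa, not_lt.1 hc⟩)) (not_le.2 hs)
    exact mul_nonneg_of_nonpos_of_nonpos (by linarith)
      (mul_nonpos_of_nonneg_of_nonpos (by linarith) (by linarith))

theorem hasMean_pow_mul_uniform {a : ℝ} (ha : 0 < a) (n : ℕ) :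
    HasMean volume (fun x => x ^ n * (Ioo 0 a).indicator (fun _ => a⁻¹) x) (a ^ n / (n + 1)) := by
  have e : (fun x => x ^ n * (Ioo 0 a).indicator (fun _ => a⁻¹) x) =
      (Ioo 0 a).indicator fun x => x ^ n * a⁻¹ := by
    funext x
    simp only [indicator]
    split_ifs <;> simp
  rw [e]
  refine ⟨(integrable_indicator_iff measurableSet_Ioo).2 ?_, ?_⟩
  · exact ((by fun_prop : Continuous fun x : ℝ => x ^ n * a⁻¹).integrableOn_Icc).mono_set
      Ioo_subset_Icc_self
  · rw [integral_indicator measurableSet_Ioo, ← integral_Ioc_eq_integral_Ioo,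
      ← intervalIntegral.integral_of_le ha.le, intervalIntegral.integral_mul_const, integral_pow]
    field_simp
    simp [pow_succ']

theorem hasMean_mul_density {h : ℝ → ℝ} (hh : IsDelayDensity h) {f : ℝ → ℝ} {μ : ℝ}
    (hf : HasMean (delayLaw h) f μ) : HasMean volume (fun x => f x * h x) μ := by
  have lt : ∀ᵐ x ∂(volume : Measure ℝ), ENNReal.ofReal (h x) < ∞ :=
    Eventually.of_forall fun x => ENNReal.ofReal_lt_top
  refine ⟨?_, ?_⟩
  · have := (integrable_withDensity_iff hh.measurable.ennreal_ofReal lt).1 hf.1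
    simpa only [ENNReal.toReal_ofReal (hh.nonneg _)] using this
  · rw [← hf.2, delayLaw, integral_withDensity_eq_integral_toReal_smul
      hh.measurable.ennreal_ofReal lt]
    refine integral_congr_ae (Eventually.of_forall fun x => ?_)
    simp only [ENNReal.toReal_ofReal (hh.nonneg _), smul_eq_mul]
    ring

section Monotone

variable {h : ℝ → ℝ} (hh : IsDelayDensity h) (hanti : AntitoneOn h (Ioi 0)) {μ₁ μ₂ μ₃ : ℝ}
  (hμ : 0 < μ₁) (h1 : HasMean (delayLaw h) (fun x => x) μ₁)
  (h2 : HasMean (delayLaw h) (fun x => x ^ 2) μ₂)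
include hh hanti hμ h1 h2

/-- For `a = 2μ₁` the uniform density on `(0, a)` has the same mass and mean as `h`. Integrating the
difference against `(x - s)(x - a)` thus leaves only second moments. The integrand is nonnegative,
and a zero integral would force `h` to be uniform almost everywhere. -/
theorem second_moment_gt (hne : ¬ ∃ a : ℝ, 0 < a ∧
    h =ᵐ[volume] (Ioo 0 a).indicator (fun _ => a⁻¹)) : 4 * μ₁ ^ 2 < 3 * μ₂ := by
  have := hh.isProbabilityMeasure
  set a := 2 * μ₁ with ha'
  have ha : 0 < a := by positivity
  obtain ⟨s, hs, hq⟩ := exists_crossing hh hanti ha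
  set u := (Ioo 0 a).indicator fun _ => a⁻¹
  have q : HasMean volume (fun x => (h x - u x) * ((x - s) * (x - a))) (μ₂ - a ^ 2 / 3) :=
    ((((((hasMean_mul_density hh h2).add ((hasMean_mul_density hh h1).const_mul (-(s + a)))).add
      ((hasMean_mul_density hh hasMean_one).const_mul (s * a))).add
      ((hasMean_pow_mul_uniform ha 2).const_mul (-1))).add
      ((hasMean_pow_mul_uniform ha 1).const_mul (s + a))).add
      ((hasMean_pow_mul_uniform ha 0).const_mul (-(s * a)))).congr (fun x => by ring)
      (by push_cast; ring)
  have p : μ₂ - a ^ 2 / 3 ≠ 0 := fun h0 => hne ⟨a, ha, by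
    have z := (integral_eq_zero_iff_of_nonneg hq q.1).1 (q.2.trans h0)
    have n : ∀ᵐ x ∂(volume : Measure ℝ), x ≠ s ∧ x ≠ a := by
      filter_upwards [Measure.ae_ne volume s, Measure.ae_ne volume a] with x h1 h2 using ⟨h1, h2⟩
    filter_upwards [z, n] with x hx ⟨h1, h2⟩
    rcases mul_eq_zero.1 hx with h | h
    · linarith
    · exact absurd h (mul_ne_zero (sub_ne_zero.2 h1) (sub_ne_zero.2 h2))⟩
  have nn : 0 ≤ μ₂ - a ^ 2 / 3 := by
    rw [← q.2]
    exact integral_nonneg hq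
  have := lt_of_le_of_ne nn p.symm
  rw [ha'] at this
  nlinarith

/-- The additional factor `x + s + a/4` is positive on the support. Its constant is chosen so that
the cubic has `x²` coefficient `-3a/4`, and `x³ - (3a/4) x²` has mean zero under the uniform law. -/
theorem third_moment_ge (h3 : HasMean (delayLaw h) (fun x => x ^ 3) μ₃) :
    3 * (μ₁ * μ₂) ≤ 2 * μ₃ := by
  have := hh.isProbabilityMeasure
  set a := 2 * μ₁ with ha'
  have ha : 0 < a := by positivity
  obtain ⟨s, hs, hq⟩ := exists_crossing hh hanti ha
  set u := (Ioo 0 a).indicator fun _ => a⁻¹ with hu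
  have q : HasMean volume (fun x => (h x - u x) * ((x - s) * (x - a)) * (x + (s + a / 4)))
      (μ₃ - 3 * a / 4 * μ₂) :=
    ((((((((hasMean_mul_density hh h3).add ((hasMean_mul_density hh h2).const_mul
        (-(3 * a / 4)))).add
      ((hasMean_mul_density hh h1).const_mul (s * a - (s + a) * (s + a / 4)))).add
      ((hasMean_mul_density hh hasMean_one).const_mul (s * a * (s + a / 4)))).add
      ((hasMean_pow_mul_uniform ha 3).const_mul (-1))).add
      ((hasMean_pow_mul_uniform ha 2).const_mul (3 * a / 4))).add
      ((hasMean_pow_mul_uniform ha 1).const_mul (-(s * a - (s + a) * (s + a / 4))))).add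
      ((hasMean_pow_mul_uniform ha 0).const_mul (-(s * a * (s + a / 4))))).congr
      (fun x => by ring) (by push_cast; rw [ha']; ring)
  have nn : 0 ≤ μ₃ - 3 * a / 4 * μ₂ := by
    rw [← q.2]
    refine integral_nonneg fun x => ?_
    rcases le_or_gt x 0 with hx | hx
    · simp only [hu, hh.eq_zero x hx, indicator_of_notMem (fun hm : x ∈ Ioo 0 a =>
        absurd hm.1 (not_lt.2 hx)), sub_zero, zero_mul, Pi.zero_apply, le_refl]
    · exact mul_nonneg (hq x) (by positivity)
  rw [ha'] at nn
  linarith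

end Monotone

/-! ### The diagonal form is not real -/

theorem exists_diagonalForm_im_ne_zero {m : ℝ≥0} (hm₀ : 0 < m) (hm : m < 1) {h : ℝ → ℝ}
    (hh : IsDelayDensity h) (hcase : HasRegularlyVaryingTail h ∨ IsNonuniformMonotone h) :
    ∃ t : ℝ, 0 < t ∧ (diagonalForm m (delayLaw h) t).im ≠ 0 := by
  by_contra! hD
  have := hh.isProbabilityMeasure
  have hpos := ae_delayLaw_pos hh
  have hD0 : ∀ᵐ x ∂(delayLaw h), 0 ≤ x := hpos.mono fun x hx => hx.le
  rcases hcase with ⟨α, L, -, -, hL, hT⟩ | ⟨hanti, -, hne⟩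
  · obtain ⟨ε, hε, hnot⟩ := exists_not_eventually_le_of_isEquivalent hL hT
    refine hnot ?_
    simpa only [delayLaw_real_Ici hh] using eventually_tail_le hm hD0 hD hε
  -- The kernel condition supplies two moments; the third comes from the assumption that the
  -- diagonal form is real.
  · have i3 := integrable_pow_three_of_tail_le hD0
      (eventually_tail_le hm hD0 hD (by norm_num : (0 : ℝ) < 1 / 256))
    have i : ∀ n ≤ 3, Integrable (fun x : ℝ => x ^ n) (delayLaw h) := fun n hn => by
      refine Integrable.mono' ((integrable_const (1 : ℝ)).add i3)
        (by fun_prop : Measurable fun x : ℝ => x ^ n).aestronglyMeasurable ?_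
      filter_upwards [hD0] with x hx
      rw [Real.norm_of_nonneg (pow_nonneg hx n)]
      rcases le_total x 1 with h1 | h1
      · exact (pow_le_one₀ hx h1).trans (le_add_of_nonneg_right (pow_nonneg hx 3))
      · exact (pow_le_pow_right₀ h1 hn).trans (le_add_of_nonneg_left zero_le_one)
    have i1 : Integrable (fun x : ℝ => x) (delayLaw h) := by simpa using i 1 (by norm_num)
    have hμ : 0 < ∫ x, x ∂(delayLaw h) := by
      rw [integral_pos_iff_support_of_nonneg_ae hD0 i1]
      refine pos_iff_ne_zero.2 fun h0 => ?_
      have : ∀ᵐ x ∂(delayLaw h), False := by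
        filter_upwards [hpos, measure_eq_zero_iff_ae_notMem.1 h0] with x h1 h2
        exact h2 h1.ne'
      rw [eventually_false_iff_eq_bot, ae_eq_bot] at this
      exact IsProbabilityMeasure.ne_zero _ this
    have m1 : HasMean (delayLaw h) (fun x => x) _ := ⟨i1, rfl⟩
    have m2 : HasMean (delayLaw h) (fun x => x ^ 2) _ := ⟨i 2 (by norm_num), rfl⟩
    have m3 : HasMean (delayLaw h) (fun x => x ^ 3) _ := ⟨i3, rfl⟩
    have rel := third_moment_relation hD m1 m2 m3
    have c1 := second_moment_gt hh hanti hμ m1 m2 hne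
    have c2 := third_moment_ge hh hanti hμ m1 m2 m3
    have d1 : (0 : ℝ) ≤ 1 - m := sub_nonneg.2 (by exact_mod_cast hm.le)
    have d2 : (0 : ℝ) < m := by exact_mod_cast hm₀
    have e1 := mul_nonneg d1 (sub_nonneg.2 c2)
    have e2 := mul_pos d2 (mul_pos hμ (sub_pos.2 c1))
    linarith

/-- In the moment identity the factors beside the moment are real. If the moment were real, so would
be `m²` times the diagonal form. -/
theorem exists_bispectrum_clusterDensity_im_ne_zero {ν m : ℝ≥0} (hν : 0 < ν) (hm₀ : 0 < m)
    (hm : m < 1) {h : ℝ → ℝ} (hh : IsDelayDensity h)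
    (hcase : HasRegularlyVaryingTail h ∨ IsNonuniformMonotone h) :
    ∃ t : ℝ, 0 < t ∧ (bispectrum (clusterDensity ν m h) t t).im ≠ 0 := by
  obtain ⟨t, ht, hne⟩ := exists_diagonalForm_im_ne_zero hm₀ hm hh hcase
  refine ⟨t, ht, ?_⟩
  have := hh.isProbabilityMeasure
  rw [bispectrum_clusterDensity_im hh hm]
  refine mul_ne_zero (NNReal.coe_ne_zero.2 hν.ne') fun h0 => hne ?_
  have key := congrArg Complex.im (third_moment_identity (D := delayLaw h) hm t)
  rw [← diagonalForm, mul_assoc, ← Complex.ofReal_one, ← Complex.ofReal_sub, Complex.im_ofReal_mul,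
    Complex.im_mul_ofReal, h0, zero_mul, mul_zero, Complex.sub_im, Complex.ofReal_im,
    ← Complex.ofReal_pow, Complex.im_ofReal_mul, zero_sub, eq_comm, neg_eq_zero] at key
  exact (mul_eq_zero.1 key).resolve_left (pow_ne_zero 2 (NNReal.coe_ne_zero.2 hm₀.ne'))

end HawkesBispectrum

theorem mainTheorem1 {Ω : Type*} [MeasurableSpace Ω] (P : Measure Ω) [IsProbabilityMeasure P]
    (ν m : ℝ≥0) (hν : 0 < ν) (hm₀ : 0 < m) (hm₁ : m < 1)
    (h : ℝ → ℝ) (hh : IsDelayDensity h)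
    (hcase : HasRegularlyVaryingTail h ∨ IsNonuniformMonotone h)
    (U : ℕ → Ω → ℝ) (ξ : ℕ × List ℕ → Ω → ℕ × ℝ) (hmodel : IsBranchingModel P ν m h U ξ) :
    (∃ c : ℝ × ℝ → ℝ, HasThirdCumulantDensity P (clusterProcess U ξ) c) ∧
    ∃ t₀ : ℝ, 0 < t₀ ∧
      ∀ c : ℝ × ℝ → ℝ, HasThirdCumulantDensity P (clusterProcess U ξ) c →
        (bispectrum c t₀ t₀).im ≠ 0 ∧
        ∀ {Ω' : Type*} [MeasurableSpace Ω'] (P' : Measure Ω') [IsProbabilityMeasure P']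
          (N' : Ω' → Measure ℝ) (c' : ℝ × ℝ → ℝ),
          IsPointProcess P' N' → IsStationaryProcess P' N' → IsReversible P' N' →
          HasThirdCumulantDensity P' N' c' →
            (∀ ω₁ ω₂ : ℝ, (bispectrum c' ω₁ ω₂).im = 0) ∧
            bispectrum c' t₀ t₀ ≠ bispectrum c t₀ t₀ ∧ ¬ c' =ᵐ[volume] c := by

  have hdens := hasThirdCumulantDensity_clusterProcess hh hmodel hm₁
  obtain ⟨t, ht, hne⟩ := exists_bispectrum_clusterDensity_im_ne_zero hν hm₀ hm₁ hh hcase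
  refine ⟨⟨_, hdens⟩, t, ht, fun c hc => ?_⟩
  -- Any two densities of the same process have the same bispectrum, so the frequency found for
  -- `clusterDensity` serves every `c`.
  have him : (bispectrum c t t).im ≠ 0 := by rwa [hc.bispectrum_eq hdens]
  refine ⟨him, fun P' _ N' c' hN' _ hrev hc' => ?_⟩
  have hreal := hrev.bispectrum_im_eq_zero hN'.measurable hc'
  have hsep : bispectrum c' t t ≠ bispectrum c t t := fun he => him (he ▸ hreal t t)
  refine ⟨hreal, hsep, fun hcc => hsep (integral_congr_ae ?_)⟩
  filter_upwards [hcc] with τ hτ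
  rw [hτ]
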